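/- In each of the following six cases let \(\Gamma\), \(t\), \(f\) be as listed, where \(m^k\) denotes \(\eta(m\tau)^k\), \(\eta\) is the Dedekind eta function, and \(q=e^{2\pi i\tau}\), \(\tau\in\mathbb H\): - \((a,b,c)=(7,2,-8)\): \(\Gamma=\Gamma_0(6)\), \(t=\frac{1^3 6^9}{2^3 3^9}\), \(f=\frac{2^1 3^6}{1^2 6^3}\). - \((10,3,9)\): \(\Gamma=\Gamma_0(6)\), \(t=\frac{1^4 6^8}{2^8 3^4}\), \(f=\frac{2^6 3^1}{1^3 6^2}\). - \((-17,-6,72)\): \(\Gamma=\Gamma_0(6)\), \(t=\frac{2^1 6^5}{1^5 3^1}\), \(f=\frac{1^6 6^1}{2^3 3^2}\). - \((12,4,32)\): \(\Gamma=\Gamma_0(8)\), \(t=\frac{1^4 4^2 8^4}{2^{10}}\), \(f=\frac{2^{10}}{1^4 4^4}\). - \((-9,-3,27)\): \(\Gamma=\Gamma_0(9)\), \(t=\frac{9^3}{1^3}\), \(f=\frac{1^3}{3^1}\). - \((11,3,-1)\): \(\Gamma=\{\gamma\in SL(2,\mathbb Z):\gamma\equiv\pm\begin{pmatrix}1&*\\0&1\end{pmatrix}\bmod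 5\}=\langle\Gamma_1(5),-1\rangle\), \(t=q\prod_{n\ge1}(1-q^n)^{5\left(\frac n5\right)}\), \(f=\prod_{n\ge1}(1-q^{5n})^2\prod_{n\equiv1,4\,(5)}(1-q^n)^{-3}\prod_{n\equiv2,3\,(5)}(1-q^n)^2\). Let \(N(\Gamma)\) be the normalizer of \(\Gamma\) in \(SL(2,\mathbb R)\). An integral matrix \(M\) of positive determinant stands for \(M/\sqrt{\det M}\in SL(2,\mathbb R)\), and \(w_m\) (for \(\Gamma_0(N)\), \(m\,\|\,N\)) stands for any matrix \(\begin{pmatrix}m a'&b'\\N c'&m d'\end{pmatrix}\) with \(a',b',c',d'\in\mathbb Z\) and determinant \(m\); \(\Gamma'+S\) is the subgroup of \(SL(2,\mathbb R)\) generated by \(\Gamma'\) and \(S\). Write \([p,q;r,s]\) for \(\begin{pmatrix}p&q\\r&s\end{pmatrix}\). **Bimodular forms.** For a congruence subgroup \(\Gamma\), a group \(G\) with \(\Gamma\le G\le N(\Gamma)\), and characters \(\chi_1\) of \(\Gamma\), \(\chi_2\) of \(G\) with \(\chi_2|_\Gamma=\chi_1^2\), a function \(F:\mathbb H^2\to\mathbb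 C\) is a bimodular form of weight \(k\) on \((\Gamma,G)\) with characters \((\chi_1,\chi_2)\) if in each variable (the other one being fixed) it is a holomorphic modular form of weight \(k\) on \(\Gamma\) with character \(\chi_1\) (holomorphic on \(\mathbb H\), transforming by \(\chi_1(\gamma)(r\tau+s)^k\) under \(\gamma=[p,q;r,s]\in\Gamma\), and bounded at all cusps), and \(F(g\tau_1,g\tau_2)=\chi_2(g)(r\tau_1+s)^k(r\tau_2+s)^kF(\tau_1,\tau_2)\) for all \(g=[p,q;r,s]\in G\). A bimodular function on \((\Gamma,G)\) is a meromorphic function on \(\mathbb H^2\) invariant under \(\Gamma\) in each variable and under the diagonal action of \(G\). **Proposition.** In each of the six cases the following hold. (1) The numbers \(\alpha,\beta\) in the table satisfy \(1-aX+cX^2=(1-\alpha X)(1-\beta X)\). Every matrix listed under \(\sigma_1\) or \(\sigma_2\) (every representative, in the case of \(w_m\)) gives an element \(g\in N(\Gamma)\), and for all \(\tau\in\mathbb H\) \[ t(g\tau)=\frac1{c\,t(\tau)}\ \text{ for }\sigma_1,\qquad t(g\tau)=\frac{1-\alpha t(\tau)}{\alpha(1-\beta t(\tau))}\ \text{ for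 }\sigma_2, \] with nonvanishing denominators. | \((a,b,c)\) | \(\alpha\) | \(\beta\) | \(\sigma_1\) | \(\sigma_2\) | |---|---|---|---|---| | \((7,2,-8)\) | \(-1\) | \(8\) | \(w_2\) | \(w_3\) | | \((10,3,9)\) | \(1\) | \(9\) | \(w_3\) | \(w_2\) | | \((-17,-6,72)\) | \(-8\) | \(-9\) | \(w_6\) | \(w_2\) | | \((12,4,32)\) | \(4\) | \(8\) | \([4,1;8,4]\) | \([2,-1;8,-2]\) | | \((-9,-3,27)\) | \((-9+3\sqrt{-3})/2\) | \((-9-3\sqrt{-3})/2\) | \(w_9\) | \([-3,-2;9,3]\) | | \((11,3,-1)\) | \((11+5\sqrt5)/2\) | \((11-5\sqrt5)/2\) | \([2,-1;5,-2]\) | \([0,-1;5,0]\) | Here \(\sqrt{-3}=i\sqrt3\). (2) Put \(t_j=t(\tau_j)\). With \(G\) as in the table below, the functions \[ x=\frac{(t_1+t_2)(1+ct_1t_2)-2at_1t_2}{(1-ct_1t_2)^2},\qquad y=\frac{t_1t_2(1-at_1+ct_1^2)(1-at_2+ct_2^2)}{((t_1+t_2)(1+ct_1t_2)-2at_1t_2)^2}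 \] of \((\tau_1,\tau_2)\) are bimodular functions on \((\Gamma,G)\). (3) There are characters \(\chi_1\) of \(\Gamma\) and \(\chi_2\) of \(G\) with the values in the table (for \(w_m\): at every representative), and \(F(\tau_1,\tau_2)=(1-ct_1t_2)f(\tau_1)f(\tau_2)\) is a bimodular form of weight \(1\) on \((\Gamma,G)\) with characters \((\chi_1,\chi_2)\). | \((a,b,c)\) | \(G\) | \(\chi_1([*,*;*,d])\) | \(\chi_2\) | |---|---|---|---| | \((7,2,-8)\) | \(\Gamma_0(6)+w_2,w_3\) | \(\left(\frac{-3}d\right)\) | \(w_2\mapsto1,\ w_3\mapsto-1\) | | \((10,3,9)\) | \(\Gamma_0(6)+w_2,w_3\) | \(\left(\frac{-3}d\right)\) | \(w_2\mapsto-1,\ w_3\mapsto1\) | | \((-17,-6,72)\) | \(\Gamma_0(6)+w_2,w_3\) | \(\left(\frac{-3}d\right)\) | \(w_2\mapsto-1,\ w_3\mapsto-1\) | | \((12,4,32)\) | \(\Gamma_0(8)+[4,1;8,4],w_8\) | \(\left(\frac{-4}d\right)\) | \([4,1;8,4]\mapsto1,\ w_8\mapsto-1\) | | \((-9,-3,27)\)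 | \(\Gamma_0(9)+[-3,-2;9,3],w_9\) | \(\left(\frac{-3}d\right)\) | \([-3,-2;9,3]\mapsto-1,\ w_9\mapsto1\) | | \((11,3,-1)\) | \(\Gamma_0(5)+w_5\) | \(1\) if \(d\equiv1\), \(-1\) if \(d\equiv-1\pmod 5\) | \([2,-1;5,-2]\mapsto1,\ w_5\mapsto-1\) | -/

import Mathlib

open scoped MatrixGroups Manifold Topology
open UpperHalfPlane CongruenceSubgroup

noncomputable section

namespace Bimodular

/-! ### Subgroups of `SL(2, ℝ)` -/

/-- A subgroup of `SL(2, ℤ)`, viewed inside `SL(2, ℝ)`. -/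
def toReal (Γ : Subgroup SL(2, ℤ)) : Subgroup SL(2, ℝ) :=
  Γ.map (Matrix.SpecialLinearGroup.map (Int.castRingHom ℝ))

/-- `N(Γ)`, the normalizer of `Γ` in `SL(2, ℝ)`. -/
def realNormalizer (Γ : Subgroup SL(2, ℤ)) : Subgroup SL(2, ℝ) :=
  Subgroup.normalizer (toReal Γ : Set SL(2, ℝ))

/-- The elements of `SL(2, ℝ)` that are represented by the integral matrices in `S`
(of positive determinant), i.e. the matrices `M / √(det M)` with `M ∈ S`. -/
def represented (S : Set (Matrix (Fin 2) (Fin 2) ℤ)) : Set SL(2, ℝ) :=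
  {g | ∃ M ∈ S, ∃ r : ℝ, 0 < r ∧ (g : Matrix (Fin 2) (Fin 2) ℝ) = r • M.map (Int.cast : ℤ → ℝ)}

/-- The integral matrices representing the Atkin-Lehner involution `w_m` of `Γ₀(N)`: all matrices
`(m a, b; N c, m d)` of determinant `m` with integers `a, b, c, d`. -/
def atkinLehner (N m : ℤ) : Set (Matrix (Fin 2) (Fin 2) ℤ) :=
  {M | ∃ a b c d : ℤ, M = !![m * a, b; N * c, m * d] ∧ M.det = m}

/-- `Γ + S`: the subgroup of `SL(2, ℝ)` generated by `Γ` and the elements represented by the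
matrices in `S`. -/
def adjoin (Γ : Subgroup SL(2, ℤ)) (S : Set (Matrix (Fin 2) (Fin 2) ℤ)) : Subgroup SL(2, ℝ) :=
  Subgroup.closure ((toReal Γ : Set SL(2, ℝ)) ∪ represented S)

/-- The group `{γ ∈ SL(2, ℤ) : γ ≡ ±(1, *; 0, 1) mod N}`, generated by `Γ₁(N)` and `-1`. -/
def pmGamma1 (N : ℕ) : Subgroup SL(2, ℤ) where
  carrier := {γ | γ ∈ Gamma1 N ∨ -γ ∈ Gamma1 N}
  one_mem' := Or.inl (one_mem _)
  mul_mem' := by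
    rintro x y (hx | hx) (hy | hy)
    · exact Or.inl (mul_mem hx hy)
    · exact Or.inr (by simpa using mul_mem hx hy)
    · exact Or.inr (by simpa using mul_mem hx hy)
    · exact Or.inl (by simpa using mul_mem hx hy)
  inv_mem' := by
    rintro x (hx | hx)
    · exact Or.inl (inv_mem hx)
    · have h : (-x)⁻¹ = -x⁻¹ := inv_eq_of_mul_eq_one_right (by simp)
      exact Or.inr (h ▸ inv_mem hx)

/-! ### Bimodular forms and functions -/

/-- `f` is a (holomorphic) modular form of weight `k` on `Γ` with character `χ`. -/
structure IsModularForm (k : ℤ) (Γ : Subgroup SL(2, ℤ)) (χ : Γ →* ℂˣ) (f : ℍ → ℂ) : Prop where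
  holo : MDifferentiable 𝓘(ℂ) 𝓘(ℂ) f
  transform : ∀ (γ : Γ) (τ : ℍ), f ((γ : SL(2, ℤ)) • τ) =
    (χ γ : ℂ) * (((γ : SL(2, ℤ)) 1 0 : ℂ) * (τ : ℂ) + ((γ : SL(2, ℤ)) 1 1 : ℂ)) ^ k * f τ
  bounded_at_cusps : ∀ A : SL(2, ℤ), IsBoundedAtImInfty (SlashAction.map k A f)

/-- The standing assumptions on a pair `(Γ, G)`: `Γ` is a congruence subgroup, and `G` is a
subgroup of `N(Γ)` containing `Γ`. -/
structure IsAdmissiblePair (Γ : Subgroup SL(2, ℤ)) (G : Subgroup SL(2, ℝ)) : Prop where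
  congruence : IsCongruenceSubgroup Γ
  contains : toReal Γ ≤ G
  normalizes : G ≤ realNormalizer Γ

/-- `F` is a bimodular form of weight `k` on `(Γ, G)` with characters `(χ₁, χ₂)`. -/
structure IsBimodularForm (k : ℤ) (Γ : Subgroup SL(2, ℤ)) (G : Subgroup SL(2, ℝ))
    (χ₁ : Γ →* ℂˣ) (χ₂ : G →* ℂˣ) (F : ℍ → ℍ → ℂ) : Prop where
  pair : IsAdmissiblePair Γ G
  characters : ∀ (γ : Γ) (g : G),
    (g : SL(2, ℝ)) = Matrix.SpecialLinearGroup.map (Int.castRingHom ℝ) (γ : SL(2, ℤ)) →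
      χ₂ g = χ₁ γ ^ 2
  modular_left : ∀ τ₂ : ℍ, IsModularForm k Γ χ₁ (fun τ₁ => F τ₁ τ₂)
  modular_right : ∀ τ₁ : ℍ, IsModularForm k Γ χ₁ (fun τ₂ => F τ₁ τ₂)
  diagonal : ∀ (g : G) (τ₁ τ₂ : ℍ), F ((g : SL(2, ℝ)) • τ₁) ((g : SL(2, ℝ)) • τ₂) =
    (χ₂ g : ℂ) *
      ((((g : SL(2, ℝ)) 1 0 : ℝ) : ℂ) * (τ₁ : ℂ) + (((g : SL(2, ℝ)) 1 1 : ℝ) : ℂ)) ^ k *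
      ((((g : SL(2, ℝ)) 1 0 : ℝ) : ℂ) * (τ₂ : ℂ) + (((g : SL(2, ℝ)) 1 1 : ℝ) : ℂ)) ^ k * F τ₁ τ₂

/-- `φ` is a meromorphic function of two variables on `ℍ × ℍ`: near every point it is the quotient
of two holomorphic functions, the denominator having nonzero germ (the values of `φ` on the zero set
of the denominator are irrelevant). -/
def IsMeromorphic (φ : ℍ → ℍ → ℂ) : Prop :=
  ∀ τ₁ τ₂ : ℍ, ∃ g h : ℂ × ℂ → ℂ,
    AnalyticAt ℂ g ((τ₁ : ℂ), (τ₂ : ℂ)) ∧ AnalyticAt ℂ h ((τ₁ : ℂ), (τ₂ : ℂ)) ∧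
    (¬ ∀ᶠ z in 𝓝 ((τ₁ : ℂ), (τ₂ : ℂ)), h z = 0) ∧
    ∀ᶠ z in 𝓝 ((τ₁ : ℂ), (τ₂ : ℂ)),
      h z ≠ 0 → φ (ofComplex z.1) (ofComplex z.2) = g z / h z

/-- `φ` is a bimodular function on `(Γ, G)`. -/
structure IsBimodularFunction (Γ : Subgroup SL(2, ℤ)) (G : Subgroup SL(2, ℝ))
    (φ : ℍ → ℍ → ℂ) : Prop where
  pair : IsAdmissiblePair Γ G
  meromorphic : IsMeromorphic φ
  invariant_left : ∀ γ ∈ Γ, ∀ τ₁ τ₂ : ℍ, φ (γ • τ₁) τ₂ = φ τ₁ τ₂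
  invariant_right : ∀ γ ∈ Γ, ∀ τ₁ τ₂ : ℍ, φ τ₁ (γ • τ₂) = φ τ₁ τ₂
  invariant_diagonal : ∀ g ∈ G, ∀ τ₁ τ₂ : ℍ, φ (g • τ₁) (g • τ₂) = φ τ₁ τ₂

/-! ### The six sporadic cases -/

/-- The six sporadic cases `(a, b, c)`. -/
inductive Sporadic where
  /-- `(7, 2, -8)` -/
  | case7
  /-- `(10, 3, 9)` -/
  | case10
  /-- `(-17, -6, 72)` -/
  | caseNeg17
  /-- `(12, 4, 32)` -/
  | case12
  /-- `(-9, -3, 27)` -/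
  | caseNeg9
  /-- `(11, 3, -1)` -/
  | case11

namespace Sporadic

/-- The triple `(a, b, c)`. -/
def abc : Sporadic → ℤ × ℤ × ℤ
  | case7 => (7, 2, -8)
  | case10 => (10, 3, 9)
  | caseNeg17 => (-17, -6, 72)
  | case12 => (12, 4, 32)
  | caseNeg9 => (-9, -3, 27)
  | case11 => (11, 3, -1)

/-- The parameter `a`, as a complex number. -/
def a (s : Sporadic) : ℂ := (s.abc.1 : ℂ)

/-- The parameter `c`, as a complex number. -/
def c (s : Sporadic) : ℂ := (s.abc.2.2 : ℂ)

/-- `√(-3) = i √3`. -/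
def sqrtNegThree : ℂ := Complex.I * (Real.sqrt 3 : ℂ)

/-- The number `α`. -/
def α : Sporadic → ℂ
  | case7 => -1
  | case10 => 1
  | caseNeg17 => -8
  | case12 => 4
  | caseNeg9 => (-9 + 3 * sqrtNegThree) / 2
  | case11 => (11 + 5 * (Real.sqrt 5 : ℂ)) / 2

/-- The number `β`. -/
def β : Sporadic → ℂ
  | case7 => 8
  | case10 => 9
  | caseNeg17 => -9
  | case12 => 8
  | caseNeg9 => (-9 - 3 * sqrtNegThree) / 2
  | case11 => (11 - 5 * (Real.sqrt 5 : ℂ)) / 2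

/-- The group `Γ`. -/
def Γ : Sporadic → Subgroup SL(2, ℤ)
  | case7 => Gamma0 6
  | case10 => Gamma0 6
  | caseNeg17 => Gamma0 6
  | case12 => Gamma0 8
  | caseNeg9 => Gamma0 9
  | case11 => pmGamma1 5

/-- `η(m τ)`. -/
def etaAt (m : ℕ) (τ : ℍ) : ℂ := ModularForm.eta ((m : ℂ) * (τ : ℂ))

/-- `q = exp(2 π i τ)`. -/
def q (τ : ℍ) : ℂ := Complex.exp (2 * (Real.pi : ℂ) * Complex.I * (τ : ℂ))

/-- The modular function `t`. -/
def t : Sporadic → ℍ → ℂ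
  | case7, τ => etaAt 1 τ ^ 3 * etaAt 6 τ ^ 9 / (etaAt 2 τ ^ 3 * etaAt 3 τ ^ 9)
  | case10, τ => etaAt 1 τ ^ 4 * etaAt 6 τ ^ 8 / (etaAt 2 τ ^ 8 * etaAt 3 τ ^ 4)
  | caseNeg17, τ => etaAt 2 τ * etaAt 6 τ ^ 5 / (etaAt 1 τ ^ 5 * etaAt 3 τ)
  | case12, τ => etaAt 1 τ ^ 4 * etaAt 4 τ ^ 2 * etaAt 8 τ ^ 4 / etaAt 2 τ ^ 10
  | caseNeg9, τ => etaAt 9 τ ^ 3 / etaAt 1 τ ^ 3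
  | case11, τ => q τ * ∏' n : ℕ, (1 - q τ ^ (n + 1)) ^ (5 * jacobiSym ((n + 1 : ℕ) : ℤ) 5)

/-- The modular form `f` of weight one. -/
def f : Sporadic → ℍ → ℂ
  | case7, τ => etaAt 2 τ * etaAt 3 τ ^ 6 / (etaAt 1 τ ^ 2 * etaAt 6 τ ^ 3)
  | case10, τ => etaAt 2 τ ^ 6 * etaAt 3 τ / (etaAt 1 τ ^ 3 * etaAt 6 τ ^ 2)
  | caseNeg17, τ => etaAt 1 τ ^ 6 * etaAt 6 τ / (etaAt 2 τ ^ 3 * etaAt 3 τ ^ 2)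
  | case12, τ => etaAt 2 τ ^ 10 / (etaAt 1 τ ^ 4 * etaAt 4 τ ^ 4)
  | caseNeg9, τ => etaAt 1 τ ^ 3 / etaAt 3 τ
  | case11, τ =>
      (∏' n : ℕ, (1 - q τ ^ (5 * (n + 1))) ^ 2) *
      (∏' n : ℕ, if (n + 1) % 5 = 1 ∨ (n + 1) % 5 = 4
        then ((1 - q τ ^ (n + 1)) ^ 3)⁻¹ else 1) *
      (∏' n : ℕ, if (n + 1) % 5 = 2 ∨ (n + 1) % 5 = 3
        then (1 - q τ ^ (n + 1)) ^ 2 else 1)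

/-- The integral matrices that realize `σ₁ : t ↦ 1 / (c t)`. -/
def σ₁ : Sporadic → Set (Matrix (Fin 2) (Fin 2) ℤ)
  | case7 => atkinLehner 6 2
  | case10 => atkinLehner 6 3
  | caseNeg17 => atkinLehner 6 6
  | case12 => {!![4, 1; 8, 4]}
  | caseNeg9 => atkinLehner 9 9
  | case11 => {!![2, -1; 5, -2]}

/-- The integral matrices that realize `σ₂ : t ↦ (1 - α t) / (α (1 - β t))`. -/
def σ₂ : Sporadic → Set (Matrix (Fin 2) (Fin 2) ℤ)
  | case7 => atkinLehner 6 3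
  | case10 => atkinLehner 6 2
  | caseNeg17 => atkinLehner 6 2
  | case12 => {!![2, -1; 8, -2]}
  | caseNeg9 => {!![-3, -2; 9, 3]}
  | case11 => {!![0, -1; 5, 0]}

/-- The group `G`. -/
def G : Sporadic → Subgroup SL(2, ℝ)
  | case7 => adjoin (Gamma0 6) (atkinLehner 6 2 ∪ atkinLehner 6 3)
  | case10 => adjoin (Gamma0 6) (atkinLehner 6 2 ∪ atkinLehner 6 3)
  | caseNeg17 => adjoin (Gamma0 6) (atkinLehner 6 2 ∪ atkinLehner 6 3)
  | case12 => adjoin (Gamma0 8) ({!![4, 1; 8, 4]} ∪ atkinLehner 8 8)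
  | caseNeg9 => adjoin (Gamma0 9) ({!![-3, -2; 9, 3]} ∪ atkinLehner 9 9)
  | case11 => adjoin (Gamma0 5) (atkinLehner 5 5)

/-- The values of `χ₁` at `γ = (*, *; *, d)`. The Kronecker symbol `(-3 / d)` is the Legendre symbol
`(d / 3)`, and `(-4 / d)` is the nontrivial Dirichlet character modulo `4`. -/
def chi₁Value : Sporadic → SL(2, ℤ) → ℤ
  | case7, γ => jacobiSym (γ 1 1) 3
  | case10, γ => jacobiSym (γ 1 1) 3
  | caseNeg17, γ => jacobiSym (γ 1 1) 3
  | case12, γ => ZMod.χ₄ (γ 1 1 : ZMod 4)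
  | caseNeg9, γ => jacobiSym (γ 1 1) 3
  | case11, γ => if (γ 1 1 : ZMod 5) = 1 then 1 else -1

/-- The values of `χ₂`: the pairs (representing integral matrices, value). -/
def chi₂Table : Sporadic → List (Set (Matrix (Fin 2) (Fin 2) ℤ) × ℂˣ)
  | case7 => [(atkinLehner 6 2, 1), (atkinLehner 6 3, -1)]
  | case10 => [(atkinLehner 6 2, -1), (atkinLehner 6 3, 1)]
  | caseNeg17 => [(atkinLehner 6 2, -1), (atkinLehner 6 3, -1)]
  | case12 => [({!![4, 1; 8, 4]}, 1), (atkinLehner 8 8, -1)]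
  | caseNeg9 => [({!![-3, -2; 9, 3]}, -1), (atkinLehner 9 9, 1)]
  | case11 => [({!![2, -1; 5, -2]}, 1), (atkinLehner 5 5, -1)]

/-- The function `x(τ₁, τ₂)`. -/
def x (s : Sporadic) (τ₁ τ₂ : ℍ) : ℂ :=
  ((s.t τ₁ + s.t τ₂) * (1 + s.c * s.t τ₁ * s.t τ₂) - 2 * s.a * s.t τ₁ * s.t τ₂) /
    (1 - s.c * s.t τ₁ * s.t τ₂) ^ 2

/-- The function `y(τ₁, τ₂)`. -/
def y (s : Sporadic) (τ₁ τ₂ : ℍ) : ℂ :=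
  (s.t τ₁ * s.t τ₂ * (1 - s.a * s.t τ₁ + s.c * s.t τ₁ ^ 2) *
      (1 - s.a * s.t τ₂ + s.c * s.t τ₂ ^ 2)) /
    ((s.t τ₁ + s.t τ₂) * (1 + s.c * s.t τ₁ * s.t τ₂) - 2 * s.a * s.t τ₁ * s.t τ₂) ^ 2

/-- The function `F(τ₁, τ₂)`. -/
def F (s : Sporadic) (τ₁ τ₂ : ℍ) : ℂ :=
  (1 - s.c * s.t τ₁ * s.t τ₂) * s.f τ₁ * s.f τ₂

end Sporadic

end Bimodular

end

/-!
# Bimodular forms attached to the six sporadic cases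

In each case there are two trace zero elements `s₁`, `s₂` of the normalizer of `Γ`, in the classes
of `σ₁` and `σ₂`, such that the cusps of `Γ` are represented by `∞`, `s₁∞`, `s₂∞`, `s₁s₂∞`, and
`Γ` is generated by `-1` and by generators of the unipotent stabilizers of these four cusps
(`CuspData`). Hence a function transforms under `Γ` with weight one and the quadratic character
`χ₁` as soon as it and its transforms under `s₁`, `s₂`, `s₁s₂` are invariant under `τ ↦ τ + 1`.
Since `f|s₁` is a multiple of `t f`, the invariance of `f`, `t f`, `f|s₂` and `(t f)|s₂` under the
translation is all that has to be known (`FormData`).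

The form `t f` vanishes only at `∞`, to first order, and `f|s₂` tends to a constant `l` there. So
the quotient `(f|s₂ - l f) / (t f)` is a modular function without poles, and constant
(`FormData.exists_const`). Applying `s₂` once more determines the constant, and
`f|s₂ = l (1 - β t) f`, `(t f)|s₂ = (l / α) (1 - α t) f`. These relations, with `f|s₁ = κ t f`, give the
transformation of `t` under `s₁` and `s₂`, the invariance of the rational functions `x` and `y` of
`t(τ₁)`, `t(τ₂)`, and the behaviour of `F` under the diagonal action: it is fixed by `s₁` and
changes its sign under `s₂`. Since `F` does not vanish identically, its multiplier is a character
`χ₂` of `G`. The tabulated matrices are in the cosets `Γ s₁`, `Γ s₂`, `Γ s₁s₂` (`GroupData`), and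
`statement_of_data` draws the conclusion.

The generators of `Γ` and its cusps are found by a coset enumeration over the generators `S`, `T`
of `SL(2, ℤ)` (`exists_coset_decomposition`). The analytic data come from explicit transformation
laws:

* In the five cases where `t` and `f` are eta quotients, the law of `η` under `SL(2, ℤ)` gives the
  action of `s₁` and `s₂` on the functions `η(n τ)`, and `FormData.of_eta` assembles these. In
  level 8 the function `η(τ + 1/2)` occurs, which is itself an eta quotient (`eta_add_half`).
* In the case of level five, `t` and `f` are quotients of products of Klein forms `klein a b`,
  i.e. of values of the odd theta function `oddTheta` at division points. The behaviour of the odd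
  theta function under `τ ↦ -1/τ` (`oddTheta_neg_inv`) holds because an entire function with given
  quasi-periods and given simple zeros is determined by its derivative at the origin
  (`eq_of_quasiPeriodic`). The number `α = ((1 + √5) / 2) ^ 5` appears as the fifth power of
  `sin (2π/5) / sin (π/5)`.
-/

namespace Bimodular

open Filter Asymptotics

/-! ### The weight one slash relation -/

/-- The inclusion of `SL(2, ℤ)` into `SL(2, ℝ)`. -/
abbrev intToReal : SL(2, ℤ) →* SL(2, ℝ) := Matrix.SpecialLinearGroup.map (Int.castRingHom ℝ)

/-- The automorphy factor `c τ + d` of `g = (*, *; c, d)`. -/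
noncomputable def autFactor (g : SL(2, ℝ)) (τ : ℍ) : ℂ :=
  ((g 1 0 : ℝ) : ℂ) * (τ : ℂ) + ((g 1 1 : ℝ) : ℂ)

lemma autFactor_ne_zero (g : SL(2, ℝ)) (τ : ℍ) : autFactor g τ ≠ 0 :=
  denom_ne_zero (g : GL (Fin 2) ℝ) τ

lemma coe_smul_eq (g : SL(2, ℝ)) (τ : ℍ) :
    ((g • τ : ℍ) : ℂ) = (((g 0 0 : ℝ) : ℂ) * τ + ((g 0 1 : ℝ) : ℂ)) / autFactor g τ :=
  coe_specialLinearGroup_apply g τ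

lemma autFactor_mul (g h : SL(2, ℝ)) (τ : ℍ) :
    autFactor (g * h) τ = autFactor g (h • τ) * autFactor h τ := by
  have h0 := autFactor_ne_zero h τ
  rw [autFactor, autFactor, coe_smul_eq]
  field_simp
  simp only [autFactor, Matrix.SpecialLinearGroup.coe_mul, Matrix.mul_apply, Fin.sum_univ_two]
  push_cast
  ring

lemma intToReal_smul (γ : SL(2, ℤ)) (τ : ℍ) : intToReal γ • τ = γ • τ := by
  ext
  rw [coe_specialLinearGroup_apply, coe_specialLinearGroup_apply]
  simp

lemma autFactor_intToReal (γ : SL(2, ℤ)) (τ : ℍ) :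
    autFactor (intToReal γ) τ = (γ 1 0 : ℂ) * τ + (γ 1 1 : ℂ) := by
  simp [autFactor]

lemma neg_smul_real (g : SL(2, ℝ)) (τ : ℍ) : (-g) • τ = g • τ := by
  ext
  rw [coe_smul_eq, coe_smul_eq, autFactor, autFactor]
  simp only [Matrix.SpecialLinearGroup.coe_neg, Matrix.neg_apply, Complex.ofReal_neg]
  rw [← neg_div_neg_eq]
  congr 1 <;> ring

lemma autFactor_neg (g : SL(2, ℝ)) (τ : ℍ) : autFactor (-g) τ = -autFactor g τ := by
  simp only [autFactor, Matrix.SpecialLinearGroup.coe_neg, Matrix.neg_apply, Complex.ofReal_neg]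
  ring

/-- `SlashEq φ g ψ` says that the weight one slash action of `g` takes `φ` to `ψ`. -/
def SlashEq (φ : ℍ → ℂ) (g : SL(2, ℝ)) (ψ : ℍ → ℂ) : Prop :=
  ∀ τ, φ (g • τ) = autFactor g τ * ψ τ

namespace SlashEq

variable {φ ψ ξ : ℍ → ℂ} {g h : SL(2, ℝ)}

lemma one (φ : ℍ → ℂ) : SlashEq φ 1 φ := fun τ ↦ by simp [autFactor]

lemma mul (h1 : SlashEq φ g ψ) (h2 : SlashEq ψ h ξ) : SlashEq φ (g * h) ξ := fun τ ↦ by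
  rw [mul_smul, h1, h2, autFactor_mul, mul_assoc]

lemma inv (h1 : SlashEq φ g ψ) : SlashEq ψ g⁻¹ φ := fun τ ↦ by
  have h2 := h1 (g⁻¹ • τ)
  have h3 := autFactor_mul g g⁻¹ τ
  rw [smul_inv_smul] at h2
  simp only [mul_inv_cancel] at h3
  rw [h2, ← mul_assoc, mul_comm (autFactor g⁻¹ τ), ← h3]
  simp [autFactor]

lemma smul (h1 : SlashEq φ g ψ) (c : ℂ) : SlashEq (c • φ) g (c • ψ) := fun τ ↦ by
  simp only [Pi.smul_apply, smul_eq_mul, h1 τ]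
  ring

lemma neg (h1 : SlashEq φ g ψ) : SlashEq φ (-g) (-ψ) := fun τ ↦ by
  rw [neg_smul_real, h1, autFactor_neg]
  simp

lemma neg_one (φ : ℍ → ℂ) : SlashEq φ (-1) (-φ) := (one φ).neg

lemma unique (h1 : SlashEq φ g ψ) (h2 : SlashEq φ g ξ) : ψ = ξ := by
  ext τ
  exact mul_left_cancel₀ (autFactor_ne_zero g τ) ((h1 τ).symm.trans (h2 τ))

/-- If `φ|g = ψ` and `ψ|h = ψ`, then `φ` is invariant under `γ = g h g⁻¹`. -/
lemma conj (h1 : SlashEq φ g ψ) (h2 : SlashEq ψ h ψ) {γ : SL(2, ℝ)} (hγ : γ * g = g * h) :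
    SlashEq φ γ φ := by
  rw [← mul_inv_eq_iff_eq_mul.mpr hγ.symm]
  exact (h1.mul h2).mul h1.inv

lemma differentiable (h1 : SlashEq φ g ψ) (hφ : MDifferentiable 𝓘(ℂ) 𝓘(ℂ) φ) :
    MDifferentiable 𝓘(ℂ) 𝓘(ℂ) ψ := by
  have hψ : ψ = SlashAction.map (1 : ℤ) (g : GL (Fin 2) ℝ) φ := by
    ext τ
    have h2 : φ ((g : GL (Fin 2) ℝ) • τ) = denom (g : GL (Fin 2) ℝ) τ * ψ τ := h1 τ
    rw [ModularForm.slash_apply, h2]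
    have h3 := denom_ne_zero (g : GL (Fin 2) ℝ) τ
    simp [σ]
    field_simp
  rw [hψ]
  exact hφ.slash 1 _

end SlashEq

/-! ### Functions without poles are constant -/

lemma eq_const_of_bounded {Γ : Subgroup SL(2, ℤ)} [Γ.FiniteIndex] {R : ℍ → ℂ}
    (holo : MDifferentiable 𝓘(ℂ) 𝓘(ℂ) R) (inv : ∀ γ ∈ Γ, ∀ τ, R (γ • τ) = R τ)
    (bdd : ∀ A : SL(2, ℤ), IsBoundedAtImInfty fun τ ↦ R (A • τ)) : ∃ c, ∀ τ, R τ = c := by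
  have hslash (A : SL(2, ℤ)) : SlashAction.map (0 : ℤ) A R = fun τ ↦ R (A • τ) := by
    ext τ
    simp [ModularForm.SL_slash_apply]
  let F : ModularForm (Γ : Subgroup (GL (Fin 2) ℝ)) 0 :=
    { toFun := R
      slash_action_eq' := by
        rintro _ ⟨γ, hγ, rfl⟩
        exact (hslash γ).trans (funext (inv γ hγ))
      holo' := holo
      bdd_at_cusps' := by
        intro c hc
        have hc' : IsCusp c (Matrix.SpecialLinearGroup.mapGL ℝ : SL(2, ℤ) →* _).range :=
          hc.mono (Subgroup.map_le_range _ _)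
        rw [OnePoint.isBoundedAt_iff_forall_SL2Z hc']
        intro A _
        have := hslash A
        exact this ▸ bdd A }
  obtain ⟨c, hc⟩ := ModularForm.eq_const_of_weight_zero F
  exact ⟨c, fun τ ↦ congrFun hc τ⟩

end Bimodular

namespace Bimodular

open Filter Asymptotics

/-! ### Cusp data and form data -/

/-- The group theory behind a sporadic case: two trace zero elements `s₁`, `s₂` of `SL(2, ℝ)` such
that `∞`, `s₁∞`, `s₂∞`, `s₁s₂∞` represent all cusps of `Γ`, and `Γ` is generated by `-1`, by the
translation `T`, and by its conjugates `gᵢ` that generate the stabilizers of the other three cusps.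
The function `e` is the quadratic character of `Γ` that is trivial on these unipotent generators and
takes the value `-1` at `-1`. -/
structure CuspData (Γ : Subgroup SL(2, ℤ)) (e : SL(2, ℤ) → ℤ) (s₁ s₂ : SL(2, ℝ))
    (g₁ g₂ g₃ δ : SL(2, ℤ)) : Prop where
  congruence : IsCongruenceSubgroup Γ
  generated : Γ = Subgroup.closure {-1, ModularGroup.T, g₁, g₂, g₃}
  sq₁ : s₁ * s₁ = -1
  sq₂ : s₂ * s₂ = -1
  conj₁ : intToReal g₁ * s₁ = s₁ * intToReal ModularGroup.T
  conj₂ : intToReal g₂ * s₂ = s₂ * intToReal ModularGroup.T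
  conj₃ : intToReal g₃ * (s₁ * s₂) = s₁ * s₂ * intToReal ModularGroup.T
  comm_mem : δ ∈ Γ
  comm : s₂ * s₁ = intToReal δ * (s₁ * s₂)
  cusps : ∀ A : SL(2, ℤ), ∃ γ ∈ Γ, ∃ s, (s = 1 ∨ s = s₁ ∨ s = s₂ ∨ s = s₁ * s₂) ∧
    (s⁻¹ * intToReal (γ * A)) 1 0 = 0
  e_mul : ∀ γ ∈ Γ, ∀ γ' ∈ Γ, e (γ * γ') = e γ * e γ'
  e_neg_one : e (-1) = -1
  e_T : e ModularGroup.T = 1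
  e_g₁ : e g₁ = 1
  e_g₂ : e g₂ = 1
  e_g₃ : e g₃ = 1

/-- The analysis behind a sporadic case. The weight one forms `f`, `t f` and their transforms
`φ₂ = f|s₂`, `φ₃ = (t f)|s₂` are holomorphic, invariant under translation, and have the prescribed
leading terms at `i∞`; moreover `f|s₁` is a multiple of `t f`. By `t_bound`, the order of `t` at
`i∞` is at most one in `q`. The condition `l_sq` is what makes the relation `φ₂ = l (1 - β t) f`
compatible with a second application of `s₂`. -/
structure FormData (α β : ℂ) (t f : ℍ → ℂ) (s₁ s₂ : SL(2, ℝ)) (κ l : ℂ) (φ₂ φ₃ : ℍ → ℂ) :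
    Prop where
  α_ne : α ≠ 0
  β_ne : β ≠ 0
  t_holo : MDifferentiable 𝓘(ℂ) 𝓘(ℂ) t
  f_holo : MDifferentiable 𝓘(ℂ) 𝓘(ℂ) f
  t_ne : ∀ τ, t τ ≠ 0
  f_ne : ∀ τ, f τ ≠ 0
  f_T : SlashEq f (intToReal ModularGroup.T) f
  tf_T : SlashEq (t * f) (intToReal ModularGroup.T) (t * f)
  φ₂_T : SlashEq φ₂ (intToReal ModularGroup.T) φ₂
  φ₃_T : SlashEq φ₃ (intToReal ModularGroup.T) φ₃
  f_s₁ : SlashEq f s₁ (κ • (t * f))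
  f_s₂ : SlashEq f s₂ φ₂
  tf_s₂ : SlashEq (t * f) s₂ φ₃
  t_lim : Tendsto t atImInfty (𝓝 0)
  t_bound : (fun τ : ℍ ↦ Real.exp (-2 * Real.pi * τ.im)) =O[atImInfty] t
  f_lim : Tendsto f atImInfty (𝓝 1)
  φ₂_lim : Tendsto φ₂ atImInfty (𝓝 l)
  φ₃_lim : Tendsto φ₃ atImInfty (𝓝 (l / α))
  κ_sq : κ ^ 2 = -(α * β)
  l_sq : l ^ 2 * (β - α) = α

lemma SlashEq.swap {φ ψ : ℍ → ℂ} {s : SL(2, ℝ)} (hs : s * s = -1) (h : SlashEq φ s ψ) :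
    SlashEq ψ s (-φ) := by
  have h1 : s⁻¹ = -s := inv_eq_of_mul_eq_one_right (by simp [hs])
  have h2 := h.inv.neg
  rwa [h1, neg_neg] at h2

namespace CuspData

variable {Γ : Subgroup SL(2, ℤ)} {e : SL(2, ℤ) → ℤ} {s₁ s₂ : SL(2, ℝ)} {g₁ g₂ g₃ δ : SL(2, ℤ)}
  (C : CuspData Γ e s₁ s₂ g₁ g₂ g₃ δ)
include C

lemma gens_mem : ({-1, ModularGroup.T, g₁, g₂, g₃} : Set SL(2, ℤ)) ⊆ Γ := by
  rw [C.generated]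
  exact Subgroup.subset_closure

lemma neg_one_mem : -1 ∈ Γ := C.gens_mem (by simp)

lemma e_one : e 1 = 1 := by
  have h := C.e_mul _ C.neg_one_mem _ C.neg_one_mem
  simpa [C.e_neg_one] using h

lemma e_sq {γ : SL(2, ℤ)} (hγ : γ ∈ Γ) : e γ ^ 2 = 1 := by
  have h := C.e_mul γ hγ _ (inv_mem hγ)
  rw [mul_inv_cancel, C.e_one] at h
  rw [sq, Int.isUnit_mul_self (IsUnit.of_mul_eq_one _ h.symm)]

/-- The character `χ₁` of `Γ` with values `e`. -/
noncomputable def chi : Γ →* ℂˣ :=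
  MonoidHom.toHomUnits
    { toFun := fun γ ↦ (e γ : ℂ)
      map_one' := by simp [C.e_one]
      map_mul' := fun γ γ' ↦ by
        simp [C.e_mul γ γ.2 γ' γ'.2] }

lemma coe_chi (γ : Γ) : (C.chi γ : ℂ) = (e γ : ℂ) := rfl

lemma chi_sq (γ : Γ) : C.chi γ ^ 2 = 1 := by
  ext
  rw [Units.val_pow_eq_pow_val, C.coe_chi, Units.val_one]
  exact_mod_cast C.e_sq γ.2

/-- A function fixed by the unipotent generators of `Γ` is a form of weight one on `Γ` with
character `e`. -/
lemma slashEq_of_gens {φ : ℍ → ℂ} (hT : SlashEq φ (intToReal ModularGroup.T) φ)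
    (h₁ : SlashEq φ (intToReal g₁) φ) (h₂ : SlashEq φ (intToReal g₂) φ)
    (h₃ : SlashEq φ (intToReal g₃) φ) {γ : SL(2, ℤ)} (hγ : γ ∈ Γ) :
    SlashEq φ (intToReal γ) ((e γ : ℂ) • φ) := by
  rw [C.generated] at hγ
  induction hγ using Subgroup.closure_induction with
  | mem x hx =>
    rcases hx with rfl | rfl | rfl | rfl | rfl
    · simpa [C.e_neg_one, intToReal] using SlashEq.neg_one φ
    · simpa [C.e_T] using hT
    · simpa [C.e_g₁] using h₁
    · simpa [C.e_g₂] using h₂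
    · simpa [C.e_g₃] using h₃
  | one => simpa [C.e_one] using SlashEq.one φ
  | mul x y hx hy ihx ihy =>
    rw [← C.generated] at hx hy
    rw [map_mul, C.e_mul x hx y hy]
    have := ihx.mul (ihy.smul (e x))
    simpa [smul_smul] using this
  | inv x hx ih =>
    rw [← C.generated] at hx
    have h1 : (e x⁻¹ : ℂ) * (e x : ℂ) = 1 := by
      have := C.e_mul _ (inv_mem hx) x hx
      rw [inv_mul_cancel, C.e_one] at this
      exact_mod_cast this.symm
    have := (ih.smul (e x⁻¹)).inv
    rw [smul_smul, h1, one_smul] at this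
    rwa [map_inv]

omit C in
lemma mem_toReal {γ : SL(2, ℤ)} (hγ : γ ∈ Γ) : intToReal γ ∈ toReal Γ := ⟨γ, hγ, rfl⟩

omit C in
lemma normalizer_of_conj {s : SL(2, ℝ)} (hs : s * s = -1)
    (h : ∀ γ ∈ toReal Γ, s * γ * s⁻¹ ∈ toReal Γ) : s ∈ realNormalizer Γ := by
  intro γ
  refine ⟨h γ, fun h1 ↦ ?_⟩
  have h2 := h _ h1
  have h3 : s⁻¹ = -s := inv_eq_of_mul_eq_one_right (by simp [hs])
  have h4 : s * (s * γ * s⁻¹) * s⁻¹ = γ := by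
    calc s * (s * γ * s⁻¹) * s⁻¹ = (s * s) * γ * (s⁻¹ * s⁻¹) := by group
      _ = γ := by rw [h3]; simp [hs]
  rwa [h4] at h2

lemma map_closure : toReal Γ = Subgroup.closure {-1, intToReal ModularGroup.T, intToReal g₁,
    intToReal g₂, intToReal g₃} := by
  have h : ∀ H : Subgroup SL(2, ℤ), H = Γ → toReal H = H.map intToReal := fun _ _ ↦ rfl
  rw [h Γ rfl, C.generated, MonoidHom.map_closure]
  congr 1
  simp [Set.image_insert_eq]

/-- It suffices to check that conjugation by `s` maps the generators of `Γ` into `Γ`. -/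
lemma mem_normalizer {s : SL(2, ℝ)} (hs : s * s = -1)
    (hT : s * intToReal ModularGroup.T * s⁻¹ ∈ toReal Γ)
    (h₁ : s * intToReal g₁ * s⁻¹ ∈ toReal Γ) (h₂ : s * intToReal g₂ * s⁻¹ ∈ toReal Γ)
    (h₃ : s * intToReal g₃ * s⁻¹ ∈ toReal Γ) : s ∈ realNormalizer Γ := by
  refine normalizer_of_conj hs fun γ hγ ↦ ?_
  have hle : toReal Γ ≤ (toReal Γ).comap (MulAut.conj s).toMonoidHom := by
    nth_rw 1 [C.map_closure]
    rw [Subgroup.closure_le]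
    rintro x (rfl | rfl | rfl | rfl | rfl)
    · have : intToReal (-1) ∈ toReal Γ := mem_toReal C.neg_one_mem
      simpa [Subgroup.mem_comap, intToReal] using this
    exacts [hT, h₁, h₂, h₃]
  exact hle hγ

lemma s₁_mem_normalizer : s₁ ∈ realNormalizer Γ := by
  have m1 : intToReal ModularGroup.T ∈ toReal Γ := mem_toReal (C.gens_mem (by simp))
  have m2 : intToReal g₁ ∈ toReal Γ := mem_toReal (C.gens_mem (by simp))
  have m3 : intToReal g₂ ∈ toReal Γ := mem_toReal (C.gens_mem (by simp))
  have m4 : intToReal g₃ ∈ toReal Γ := mem_toReal (C.gens_mem (by simp))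
  have c1 := eq_mul_inv_of_mul_eq C.conj₁
  have c2 := eq_mul_inv_of_mul_eq C.conj₂
  have c3 := eq_mul_inv_of_mul_eq C.conj₃
  have h3 : s₁⁻¹ = -s₁ := inv_eq_of_mul_eq_one_right (by simp [C.sq₁])
  refine C.mem_normalizer C.sq₁ (c1 ▸ m2) ?_ ?_ ?_
  · rw [c1]
    have : s₁ * (s₁ * intToReal ModularGroup.T * s₁⁻¹) * s₁⁻¹ = intToReal ModularGroup.T := by
      calc _ = (s₁ * s₁) * intToReal ModularGroup.T * (s₁⁻¹ * s₁⁻¹) := by group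
        _ = _ := by rw [h3]; simp [C.sq₁]
    rwa [this]
  · rw [c2]
    have : s₁ * (s₂ * intToReal ModularGroup.T * s₂⁻¹) * s₁⁻¹ = intToReal g₃ := by
      rw [c3]; group
    rwa [this]
  · rw [c3]
    have : s₁ * (s₁ * s₂ * intToReal ModularGroup.T * (s₁ * s₂)⁻¹) * s₁⁻¹ = intToReal g₂ := by
      calc _ = (s₁ * s₁) * (s₂ * intToReal ModularGroup.T * s₂⁻¹) * (s₁⁻¹ * s₁⁻¹) := by group
        _ = _ := by rw [h3, c2]; simp [C.sq₁]
    rwa [this]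

lemma s₂_mem_normalizer : s₂ ∈ realNormalizer Γ := by
  have m1 : intToReal ModularGroup.T ∈ toReal Γ := mem_toReal (C.gens_mem (by simp))
  have m2 : intToReal g₁ ∈ toReal Γ := mem_toReal (C.gens_mem (by simp))
  have m3 : intToReal g₂ ∈ toReal Γ := mem_toReal (C.gens_mem (by simp))
  have m4 : intToReal g₃ ∈ toReal Γ := mem_toReal (C.gens_mem (by simp))
  have m5 : intToReal δ ∈ toReal Γ := mem_toReal C.comm_mem
  have c1 := eq_mul_inv_of_mul_eq C.conj₁
  have c2 := eq_mul_inv_of_mul_eq C.conj₂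
  have c3 := eq_mul_inv_of_mul_eq C.conj₃
  have h3 : s₂⁻¹ = -s₂ := inv_eq_of_mul_eq_one_right (by simp [C.sq₂])
  refine C.mem_normalizer C.sq₂ (c2 ▸ m3) ?_ ?_ ?_
  · rw [c1]
    have : s₂ * (s₁ * intToReal ModularGroup.T * s₁⁻¹) * s₂⁻¹ =
        intToReal δ * intToReal g₃ * (intToReal δ)⁻¹ := by
      calc _ = (s₂ * s₁) * intToReal ModularGroup.T * (s₂ * s₁)⁻¹ := by group
        _ = _ := by rw [C.comm, c3]; group
    rw [this]
    exact mul_mem (mul_mem m5 m4) (inv_mem m5)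
  · rw [c2]
    have : s₂ * (s₂ * intToReal ModularGroup.T * s₂⁻¹) * s₂⁻¹ = intToReal ModularGroup.T := by
      calc _ = (s₂ * s₂) * intToReal ModularGroup.T * (s₂⁻¹ * s₂⁻¹) := by group
        _ = _ := by rw [h3]; simp [C.sq₂]
    rwa [this]
  · rw [c3]
    have : s₂ * (s₁ * s₂ * intToReal ModularGroup.T * (s₁ * s₂)⁻¹) * s₂⁻¹ =
        intToReal δ * intToReal g₁ * (intToReal δ)⁻¹ := by
      calc _ = (s₂ * s₁) * s₂ * intToReal ModularGroup.T * s₂⁻¹ * (s₂ * s₁)⁻¹ := by group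
        _ = intToReal δ * s₁ * (s₂ * s₂) * intToReal ModularGroup.T * (s₂⁻¹ * s₂⁻¹) * s₁⁻¹ *
            (intToReal δ)⁻¹ := by rw [C.comm]; group
        _ = _ := by rw [h3, c1]; simp [C.sq₂, mul_assoc]
    rw [this]
    exact mul_mem (mul_mem m5 m2) (inv_mem m5)

end CuspData

end Bimodular

namespace Bimodular

open Filter Asymptotics

/-! ### The action of the involutions on `f` and `t` -/

namespace FormData

variable {Γ : Subgroup SL(2, ℤ)} {e : SL(2, ℤ) → ℤ} {s₁ s₂ : SL(2, ℝ)} {g₁ g₂ g₃ δ : SL(2, ℤ)}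
  {α β κ l : ℂ} {t f φ₂ φ₃ : ℍ → ℂ}

section analytic

variable (D : FormData α β t f s₁ s₂ κ l φ₂ φ₃)
include D

lemma l_ne : l ≠ 0 := by
  rintro h
  have := D.l_sq
  rw [h] at this
  exact D.α_ne (by simpa using this.symm)

lemma κ_ne : κ ≠ 0 := by
  rintro h
  have := D.κ_sq
  rw [h] at this
  simp [D.α_ne, D.β_ne] at this

lemma φ₂_holo : MDifferentiable 𝓘(ℂ) 𝓘(ℂ) φ₂ := D.f_s₂.differentiable D.f_holo

lemma tf_holo : MDifferentiable 𝓘(ℂ) 𝓘(ℂ) (t * f) := D.t_holo.mul D.f_holo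

lemma tf_lim : Tendsto (t * f) atImInfty (𝓝 0) := by
  have := D.t_lim.mul D.f_lim
  rw [zero_mul] at this
  exact this

omit D in
lemma periodic_of_slashEq {φ : ℍ → ℂ} (h : SlashEq φ (intToReal ModularGroup.T) φ) :
    Function.Periodic (φ ∘ ofComplex) 1 := by
  have h1 (τ : ℍ) : φ ((1 : ℝ) +ᵥ τ) = φ τ := by
    rw [← modular_T_smul, ← intToReal_smul, h τ, autFactor_intToReal]
    simp [ModularGroup.T]
  intro w
  by_cases hw : 0 < w.im
  · have hw' : 0 < (w + 1).im := by simpa using hw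
    simp only [Function.comp_apply, ofComplex_apply_of_im_pos hw, ofComplex_apply_of_im_pos hw']
    rw [← h1 ⟨w, hw⟩]
    congr 1
    ext
    simp [add_comm]
  · have hw' : (w + 1).im ≤ 0 := by simpa using hw
    simp only [Function.comp_apply, ofComplex_apply_of_im_nonpos (not_lt.mp hw),
      ofComplex_apply_of_im_nonpos hw']

/-- The difference `φ₂ - l f` vanishes at `i∞`, hence to the order of `q`, like `t f`. -/
lemma sub_isBigO : (fun τ ↦ φ₂ τ - l * f τ) =O[atImInfty] (t * f) := by
  have hper : Function.Periodic ((φ₂ - l • f) ∘ ofComplex) ((1 : ℝ) : ℂ) := by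
    intro w
    have h1 := periodic_of_slashEq D.φ₂_T w
    have h2 := periodic_of_slashEq D.f_T w
    simp only [Function.comp_apply] at h1 h2
    simp [h1, h2]
  have hholo : MDifferentiable 𝓘(ℂ) 𝓘(ℂ) (φ₂ - l • f) :=
    D.φ₂_holo.sub (D.f_holo.const_smul l)
  have hzero : IsZeroAtImInfty (φ₂ - l • f) := by
    have := D.φ₂_lim.sub (D.f_lim.const_mul l)
    simpa [IsZeroAtImInfty, ZeroAtFilter, Pi.sub_def] using this
  have h := hzero.exp_decay_atImInfty one_pos hper hholo hzero.isBoundedAtImInfty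
  have hf : (fun _ : ℍ ↦ (1 : ℂ)) =O[atImInfty] f :=
    ((isEquivalent_const_iff_tendsto one_ne_zero).mpr D.f_lim).symm.isBigO
  have h2 := (h.trans (by simpa using D.t_bound)).mul hf
  simpa [Pi.mul_def] using h2

end analytic

section Automorphy

variable (C : CuspData Γ e s₁ s₂ g₁ g₂ g₃ δ) (D : FormData α β t f s₁ s₂ κ l φ₂ φ₃)
include C D

lemma tf_s₁ : SlashEq (t * f) s₁ (-κ⁻¹ • f) := by
  have h := (D.f_s₁.swap C.sq₁).smul κ⁻¹
  simpa [smul_smul, D.κ_ne] using h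

lemma φ₂_s₂ : SlashEq φ₂ s₂ (-f) := D.f_s₂.swap C.sq₂

lemma φ₃_s₂ : SlashEq φ₃ s₂ (-(t * f)) := D.tf_s₂.swap C.sq₂

omit C in
lemma f_s₁s₂ : SlashEq f (s₁ * s₂) (κ • φ₃) := D.f_s₁.mul (D.tf_s₂.smul κ)

lemma tf_s₁s₂ : SlashEq (t * f) (s₁ * s₂) (-κ⁻¹ • φ₂) :=
  (tf_s₁ C D).mul (D.f_s₂.smul (-κ⁻¹))

lemma f_slash {γ : SL(2, ℤ)} (hγ : γ ∈ Γ) : SlashEq f (intToReal γ) ((e γ : ℂ) • f) :=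
  C.slashEq_of_gens D.f_T (D.f_s₁.conj (D.tf_T.smul κ) C.conj₁) (D.f_s₂.conj D.φ₂_T C.conj₂)
    ((f_s₁s₂ D).conj (D.φ₃_T.smul κ) C.conj₃) hγ

lemma tf_slash {γ : SL(2, ℤ)} (hγ : γ ∈ Γ) :
    SlashEq (t * f) (intToReal γ) ((e γ : ℂ) • (t * f)) :=
  C.slashEq_of_gens D.tf_T ((tf_s₁ C D).conj (D.f_T.smul _) C.conj₁)
    (D.tf_s₂.conj D.φ₃_T C.conj₂) ((tf_s₁s₂ C D).conj (D.φ₂_T.smul _) C.conj₃) hγ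

lemma φ₂_s₁ : SlashEq φ₂ s₁ (((e δ : ℂ) * κ) • φ₃) := by
  have h := (f_slash C D C.comm_mem).mul ((f_s₁s₂ D).smul (e δ))
  rw [← C.comm] at h
  have h2 := D.f_s₂.inv.mul h
  rwa [inv_mul_cancel_left, smul_smul] at h2

lemma φ₂_s₁s₂ : SlashEq φ₂ (s₁ * s₂) (((e δ : ℂ) * κ) • -(t * f)) :=
  (φ₂_s₁ C D).mul ((φ₃_s₂ C D).smul _)

lemma φ₂_slash {γ : SL(2, ℤ)} (hγ : γ ∈ Γ) : SlashEq φ₂ (intToReal γ) ((e γ : ℂ) • φ₂) := by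
  have hf : SlashEq (-f) (intToReal ModularGroup.T) (-f) := by simpa using D.f_T.smul (-1)
  have htf : SlashEq (-(t * f)) (intToReal ModularGroup.T) (-(t * f)) := by
    simpa using D.tf_T.smul (-1)
  exact C.slashEq_of_gens D.φ₂_T ((φ₂_s₁ C D).conj (D.φ₃_T.smul _) C.conj₁)
    ((φ₂_s₂ C D).conj hf C.conj₂) ((φ₂_s₁s₂ C D).conj (htf.smul _) C.conj₃) hγ

omit D in
lemma e_ne {γ : SL(2, ℤ)} (hγ : γ ∈ Γ) : (e γ : ℂ) ≠ 0 := by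
  intro h
  have h0 : e γ = 0 := by exact_mod_cast h
  have := C.e_sq hγ
  simp [h0] at this

lemma t_invariant {γ : SL(2, ℤ)} (hγ : γ ∈ Γ) (τ : ℍ) : t (γ • τ) = t τ := by
  have h1 := f_slash C D hγ τ
  have h2 := tf_slash C D hγ τ
  rw [intToReal_smul] at h1 h2
  simp only [Pi.mul_apply, Pi.smul_apply, smul_eq_mul] at h1 h2
  rw [h1] at h2
  have h3 := e_ne C hγ
  have h4 := autFactor_ne_zero (intToReal γ) τ
  have h5 := D.f_ne τ
  apply mul_right_cancel₀ (mul_ne_zero h4 (mul_ne_zero h3 h5))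
  rw [h2]
  ring

/-- The quotient `(φ₂ - l f) / (t f)` is a modular function without poles, hence constant. -/
lemma exists_const : ∃ m : ℂ, ∀ τ, φ₂ τ = l * f τ + m * (t τ * f τ) := by
  have hfin : Γ.FiniteIndex := C.congruence.finiteIndex
  have htf : ∀ τ, (t * f) τ ≠ 0 := fun τ ↦ mul_ne_zero (D.t_ne τ) (D.f_ne τ)
  set R : ℍ → ℂ := (φ₂ - l • f) * (t * f)⁻¹ with hR
  have hRapp (τ : ℍ) : R τ = (φ₂ τ - l * f τ) / (t τ * f τ) := by
    simp [hR, div_eq_mul_inv]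
  have holo : MDifferentiable 𝓘(ℂ) 𝓘(ℂ) R :=
    (D.φ₂_holo.sub (D.f_holo.const_smul l)).mul (MDifferentiable.inv D.tf_holo htf)
  have hslash {s : SL(2, ℝ)} {ψ₀ ψ₁ ψ₂ : ℍ → ℂ} (h0 : SlashEq f s ψ₀)
      (h1 : SlashEq (t * f) s ψ₁) (h2 : SlashEq φ₂ s ψ₂) (τ : ℍ) :
      R (s • τ) = (ψ₂ τ - l * ψ₀ τ) / ψ₁ τ := by
    have h1' := h1 τ
    have hj := autFactor_ne_zero s τ
    rw [Pi.mul_apply] at h1'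
    rw [hRapp, h1', h0, h2, ← mul_div_mul_left _ (ψ₁ τ) hj]
    ring
  have inv : ∀ γ ∈ Γ, ∀ τ, R (γ • τ) = R τ := by
    intro γ hγ τ
    rw [← intToReal_smul, hslash (f_slash C D hγ) (tf_slash C D hγ) (φ₂_slash C D hγ), hRapp]
    have h3 := e_ne C hγ
    simp only [Pi.smul_apply, Pi.mul_apply, smul_eq_mul]
    rw [← mul_div_mul_left _ (t τ * f τ) h3]
    ring
  have hl := D.l_ne
  have hκ := D.κ_ne
  -- at each of the four cusps the quotient has a finite limit or is bounded
  have bdd0 : ∀ s, (s = 1 ∨ s = s₁ ∨ s = s₂ ∨ s = s₁ * s₂) →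
      IsBoundedAtImInfty fun τ ↦ R (s • τ) := by
    have of_lim {u v : ℍ → ℂ} {a b : ℂ} (hu : Tendsto u atImInfty (𝓝 a))
        (hv : Tendsto v atImInfty (𝓝 b)) (hb : b ≠ 0) :
        IsBoundedAtImInfty fun τ ↦ u τ / v τ := (hu.div hv hb).isBigO_one ℝ
    rintro s (rfl | rfl | rfl | rfl)
    · have : (fun τ ↦ R τ) =O[atImInfty] (1 : ℍ → ℝ) := by
        have h := D.sub_isBigO.mul (isBigO_refl (fun τ ↦ ((t * f) τ)⁻¹) atImInfty)
        refine (h.congr_left (f₂ := R) fun τ ↦ ?_).trans (isBigO_of_le _ fun τ ↦ ?_)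
        · rw [hRapp, div_eq_mul_inv]
          rfl
        · rw [mul_inv_cancel₀ (htf τ)]
          simp
      simpa [IsBoundedAtImInfty, BoundedAtFilter] using this
    · simp_rw [hslash D.f_s₁ (tf_s₁ C D) (φ₂_s₁ C D)]
      exact of_lim ((D.φ₃_lim.const_mul _).sub ((D.tf_lim.const_mul _).const_mul _))
        (D.f_lim.const_mul _) (by simpa using hκ)
    · simp_rw [hslash D.f_s₂ D.tf_s₂ (φ₂_s₂ C D)]
      exact of_lim (D.f_lim.neg.sub (D.φ₂_lim.const_mul _)) D.φ₃_lim (div_ne_zero hl D.α_ne)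
    · simp_rw [hslash (f_s₁s₂ D) (tf_s₁s₂ C D) (φ₂_s₁s₂ C D)]
      exact of_lim ((D.tf_lim.neg.const_mul _).sub ((D.φ₃_lim.const_mul _).const_mul _))
        (D.φ₂_lim.const_mul _) (by simpa [hl] using hκ)
  have bdd : ∀ A : SL(2, ℤ), IsBoundedAtImInfty fun τ ↦ R (A • τ) := by
    intro A
    obtain ⟨γ, hγ, s, hs, h10⟩ := C.cusps A
    have h1 (τ : ℍ) : R (A • τ) = R (s • (s⁻¹ * intToReal (γ * A)) • τ) := by
      rw [← mul_smul, mul_inv_cancel_left, intToReal_smul, mul_smul, inv γ hγ]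
    simp_rw [h1]
    exact (bdd0 s hs).comp_tendsto (tendsto_smul_atImInfty
      (g := ((s⁻¹ * intToReal (γ * A) : SL(2, ℝ)) : GL (Fin 2) ℝ)) h10)
  obtain ⟨m, hm⟩ := eq_const_of_bounded holo inv bdd
  refine ⟨m, fun τ ↦ ?_⟩
  have h1 := hm τ
  rw [hRapp, div_eq_iff (mul_ne_zero (D.t_ne τ) (D.f_ne τ))] at h1
  rw [← h1]
  ring

/-- The linear relation between the three forms `f|s₂`, `f` and `t f`. -/
lemma φ₂_eq (τ : ℍ) : φ₂ τ = l * (1 - β * t τ) * f τ := by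
  obtain ⟨m, hm⟩ := exists_const C D
  have hl := D.l_ne
  have hα := D.α_ne
  -- transform the relation by `s₂` and compare the limits at `i∞`
  have h1 (τ : ℍ) : -f τ = l * φ₂ τ + m * φ₃ τ := by
    have h2 := φ₂_s₂ C D τ
    have h3 := D.tf_s₂ τ
    rw [Pi.mul_apply] at h3
    rw [hm, h3, D.f_s₂ τ] at h2
    apply mul_left_cancel₀ (autFactor_ne_zero s₂ τ)
    rw [← Pi.neg_apply, ← h2]
    ring
  have h2 : Tendsto (fun τ ↦ -f τ) atImInfty (𝓝 (l * l + m * (l / α))) := by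
    simp_rw [h1]
    exact (D.φ₂_lim.const_mul l).add (D.φ₃_lim.const_mul m)
  have h3 := tendsto_nhds_unique h2 D.f_lim.neg
  have h4 : m = -(l * β) := by
    have h5 := D.l_sq
    field_simp at h3
    apply mul_left_cancel₀ hl
    linear_combination h3 + h5
  rw [hm, h4]
  ring

lemma φ₃_eq (τ : ℍ) : φ₃ τ = l / α * (1 - α * t τ) * f τ := by
  have hl := D.l_ne
  have hα := D.α_ne
  have hβ := D.β_ne
  have h2 := φ₂_s₂ C D τ
  have h3 := D.tf_s₂ τ
  rw [Pi.mul_apply] at h3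
  have h4 : φ₂ (s₂ • τ) = l * f (s₂ • τ) - l * β * (t (s₂ • τ) * f (s₂ • τ)) := by
    rw [φ₂_eq C D]
    ring
  rw [h4, h3, D.f_s₂ τ, φ₂_eq C D τ] at h2
  have h5 : -f τ = l * (l * (1 - β * t τ) * f τ) - l * β * φ₃ τ := by
    apply mul_left_cancel₀ (autFactor_ne_zero s₂ τ)
    rw [← Pi.neg_apply, ← h2]
    ring
  have h6 := D.l_sq
  field_simp
  apply mul_left_cancel₀ (mul_ne_zero hl hβ)
  linear_combination α * h5 - f τ * h6

omit C in
lemma φ₂_ne (τ : ℍ) : φ₂ τ ≠ 0 := fun h ↦ by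
  have := D.f_s₂ τ
  rw [h, mul_zero] at this
  exact D.f_ne _ this

lemma one_sub_β_ne (τ : ℍ) : 1 - β * t τ ≠ 0 := fun h ↦ by
  have := φ₂_eq C D τ
  rw [h] at this
  exact φ₂_ne D τ (by simpa using this)

lemma t_s₁ (τ : ℍ) : t (s₁ • τ) = 1 / (α * β * t τ) := by
  have h1 := D.f_s₁ τ
  have h2 := tf_s₁ C D τ
  simp only [Pi.mul_apply, Pi.smul_apply, smul_eq_mul] at h1 h2
  rw [h1] at h2
  have hκ := D.κ_ne
  have hj := autFactor_ne_zero s₁ τ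
  have ht := D.t_ne τ
  have hf := D.f_ne τ
  have hα := D.α_ne
  have hβ := D.β_ne
  have h3 : t (s₁ • τ) * (κ ^ 2 * t τ) = -1 := by
    apply mul_right_cancel₀ (mul_ne_zero (mul_ne_zero hj hf) (inv_ne_zero hκ))
    field_simp at h2 ⊢
    linear_combination h2
  rw [D.κ_sq] at h3
  field_simp
  linear_combination -h3

lemma t_s₂ (τ : ℍ) : t (s₂ • τ) = (1 - α * t τ) / (α * (1 - β * t τ)) := by
  have h1 := D.f_s₂ τ
  have h2 := D.tf_s₂ τ
  simp only [Pi.mul_apply] at h2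
  rw [φ₂_eq C D] at h1
  rw [h1, φ₃_eq C D] at h2
  have hj := autFactor_ne_zero s₂ τ
  have hf := D.f_ne τ
  have hα := D.α_ne
  have hl := D.l_ne
  have h4 := one_sub_β_ne C D τ
  rw [eq_div_iff (mul_ne_zero hα h4)]
  apply mul_right_cancel₀ (mul_ne_zero (mul_ne_zero hj hf) hl)
  field_simp at h2 ⊢
  linear_combination h2

end Automorphy

end FormData

end Bimodular

namespace Bimodular

open Filter Asymptotics

/-! ### Meromorphic functions of two variables -/

lemma analyticAt_comp_ofComplex {t : ℍ → ℂ} (ht : MDifferentiable 𝓘(ℂ) 𝓘(ℂ) t) (τ : ℍ) :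
    AnalyticAt ℂ (t ∘ ofComplex) (τ : ℂ) :=
  (UpperHalfPlane.mdifferentiable_iff.mp ht).analyticAt (isOpen_upperHalfPlaneSet.mem_nhds τ.im_pos)

/-- A quotient of analytic functions of `(t(τ₁), t(τ₂))` is meromorphic, if its denominator does not
vanish identically; here the latter is seen from the limit `t → 0` at `i∞`. -/
lemma isMeromorphic_div {t : ℍ → ℂ} (ht : MDifferentiable 𝓘(ℂ) 𝓘(ℂ) t) (hne : ∀ τ, t τ ≠ 0)
    (hlim : Tendsto t atImInfty (𝓝 0)) {N D : ℂ × ℂ → ℂ} (hN : ∀ p, AnalyticAt ℂ N p)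
    (hD : ∀ p, AnalyticAt ℂ D p) (h0 : ∀ v, v ≠ 0 → D (0, v) ≠ 0) :
    IsMeromorphic fun τ₁ τ₂ ↦ N (t τ₁, t τ₂) / D (t τ₁, t τ₂) := by
  intro τ₁ τ₂
  have hpair : AnalyticAt ℂ (fun z : ℂ × ℂ ↦ (t (ofComplex z.1), t (ofComplex z.2)))
      ((τ₁ : ℂ), (τ₂ : ℂ)) := by
    refine AnalyticAt.prod ?_ ?_
    · exact (analyticAt_comp_ofComplex ht τ₁).fun_comp_of_eq (f := Prod.fst) analyticAt_fst rfl
    · exact (analyticAt_comp_ofComplex ht τ₂).fun_comp_of_eq (f := Prod.snd) analyticAt_snd rfl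
  refine ⟨fun z ↦ N (t (ofComplex z.1), t (ofComplex z.2)),
    fun z ↦ D (t (ofComplex z.1), t (ofComplex z.2)), (hN _).comp hpair, (hD _).comp hpair, ?_,
    Eventually.of_forall fun z _ ↦ rfl⟩
  intro hzero
  have hcont : Tendsto (fun τ : ℍ ↦ ((τ : ℂ), (τ₂ : ℂ))) (𝓝 τ₁) (𝓝 ((τ₁ : ℂ), (τ₂ : ℂ))) := by
    refine Continuous.tendsto ?_ τ₁
    fun_prop
  have h1 : ∀ᶠ τ : ℍ in 𝓝 τ₁, D (t τ, t τ₂) = 0 := by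
    filter_upwards [hcont.eventually hzero] with τ hτ
    simpa using hτ
  have hholo : MDifferentiable 𝓘(ℂ) 𝓘(ℂ) (fun τ ↦ D (t τ, t τ₂)) := by
    intro τ
    rw [mdifferentiableAt_iff]
    have h2 : AnalyticAt ℂ (fun z ↦ (t (ofComplex z), t τ₂)) (τ : ℂ) :=
      (analyticAt_comp_ofComplex ht τ).prod analyticAt_const
    exact ((hD _).comp h2).differentiableAt
  have h3 : (fun τ ↦ D (t τ, t τ₂)) = 0 :=
    eq_zero_of_frequently hholo (h1.filter_mono nhdsWithin_le_nhds).frequently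
  have h4 : Tendsto (fun τ ↦ D (t τ, t τ₂)) atImInfty (𝓝 (D (0, t τ₂))) :=
    (hD _).continuousAt.tendsto.comp (hlim.prodMk_nhds tendsto_const_nhds)
  rw [h3] at h4
  exact h0 _ (hne τ₂) (tendsto_nhds_unique h4 tendsto_const_nhds)

/-! ### Bimodular forms and functions from the transformation laws -/

/-- `F` transforms under the diagonal action of `g` with weight one and multiplier `ε`. -/
def DiagonalEq (F : ℍ → ℍ → ℂ) (g : SL(2, ℝ)) (ε : ℂ) : Prop :=
  ∀ τ₁ τ₂, F (g • τ₁) (g • τ₂) = ε * autFactor g τ₁ * autFactor g τ₂ * F τ₁ τ₂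

namespace DiagonalEq

variable {F : ℍ → ℍ → ℂ} {g h : SL(2, ℝ)} {ε ε' : ℂ}

lemma one : DiagonalEq F 1 1 := fun τ₁ τ₂ ↦ by simp [autFactor]

lemma mul (h1 : DiagonalEq F g ε) (h2 : DiagonalEq F h ε') :
    DiagonalEq F (g * h) (ε * ε') := fun τ₁ τ₂ ↦ by
  rw [mul_smul, mul_smul, h1, h2, autFactor_mul, autFactor_mul]
  ring

lemma inv (h1 : DiagonalEq F g ε) (hε : ε ≠ 0) : DiagonalEq F g⁻¹ ε⁻¹ := fun τ₁ τ₂ ↦ by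
  have h2 := h1 (g⁻¹ • τ₁) (g⁻¹ • τ₂)
  have h3 (τ : ℍ) : autFactor g (g⁻¹ • τ) * autFactor g⁻¹ τ = 1 := by
    rw [← autFactor_mul, mul_inv_cancel]
    simp [autFactor]
  rw [smul_inv_smul, smul_inv_smul] at h2
  have h4 := h3 τ₁
  have h5 := h3 τ₂
  rw [h2]
  field_simp
  linear_combination (-autFactor g (g⁻¹ • τ₂) * autFactor g⁻¹ τ₂ * F (g⁻¹ • τ₁) (g⁻¹ • τ₂)) * h4 -
    F (g⁻¹ • τ₁) (g⁻¹ • τ₂) * h5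

end DiagonalEq

lemma x_of_div {B E : ℂ} (a c A C : ℂ) (hB : B ≠ 0) (hE : E ≠ 0) :
    ((A / B + C / E) * (1 + c * (A / B) * (C / E)) - 2 * a * (A / B) * (C / E)) /
      (1 - c * (A / B) * (C / E)) ^ 2 =
    ((A * E + C * B) * (B * E + c * A * C) - 2 * a * A * C * (B * E)) /
      (B * E - c * A * C) ^ 2 := by
  rw [← div_div_div_cancel_right₀ (pow_ne_zero 2 (mul_ne_zero hB hE)) _ ((B * E - c * A * C) ^ 2)]
  congr 1 <;> field_simp

lemma y_of_div {B E : ℂ} (a c A C : ℂ) (hB : B ≠ 0) (hE : E ≠ 0) :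
    (A / B * (C / E) * (1 - a * (A / B) + c * (A / B) ^ 2) * (1 - a * (C / E) + c * (C / E) ^ 2)) /
      ((A / B + C / E) * (1 + c * (A / B) * (C / E)) - 2 * a * (A / B) * (C / E)) ^ 2 =
    (A * C * (B * E) * (B ^ 2 - a * A * B + c * A ^ 2) * (E ^ 2 - a * C * E + c * C ^ 2)) /
      ((A * E + C * B) * (B * E + c * A * C) - 2 * a * A * C * (B * E)) ^ 2 := by
  rw [← div_div_div_cancel_right₀ (pow_ne_zero 4 (mul_ne_zero hB hE)) _
    (((A * E + C * B) * (B * E + c * A * C) - 2 * a * A * C * (B * E)) ^ 2)]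
  congr 1 <;> field_simp

namespace FormData

variable {s : Sporadic} {s₁ s₂ : SL(2, ℝ)} {g₁ g₂ g₃ δ : SL(2, ℤ)} {κ l : ℂ} {φ₂ φ₃ : ℍ → ℂ}

section Sporadic

variable (C : CuspData s.Γ s.chi₁Value s₁ s₂ g₁ g₂ g₃ δ)
  (D : FormData s.α s.β s.t s.f s₁ s₂ κ l φ₂ φ₃) (ha : s.a = s.α + s.β) (hc : s.c = s.α * s.β)

include D in
lemma α_sub_β_ne : s.α - s.β ≠ 0 := fun h ↦ by
  have h1 := D.l_sq
  have h2 : s.β - s.α = 0 := by linear_combination -h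
  rw [h2, mul_zero] at h1
  exact D.α_ne h1.symm

include D in
lemma isMeromorphic_x : IsMeromorphic s.x := by
  refine isMeromorphic_div D.t_holo D.t_ne D.t_lim
    (N := fun p ↦ (p.1 + p.2) * (1 + s.c * p.1 * p.2) - 2 * s.a * p.1 * p.2)
    (D := fun p ↦ (1 - s.c * p.1 * p.2) ^ 2)
    (fun p ↦ ((analyticAt_fst.add analyticAt_snd).mul (analyticAt_const.add
      ((analyticAt_const.mul analyticAt_fst).mul analyticAt_snd))).sub
      ((analyticAt_const.mul analyticAt_fst).mul analyticAt_snd))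
    (fun p ↦ (analyticAt_const.sub
      ((analyticAt_const.mul analyticAt_fst).mul analyticAt_snd)).pow 2) ?_
  intro v _
  simp

include D in
lemma isMeromorphic_y : IsMeromorphic s.y := by
  refine isMeromorphic_div D.t_holo D.t_ne D.t_lim
    (N := fun p ↦ p.1 * p.2 * (1 - s.a * p.1 + s.c * p.1 ^ 2) * (1 - s.a * p.2 + s.c * p.2 ^ 2))
    (D := fun p ↦ ((p.1 + p.2) * (1 + s.c * p.1 * p.2) - 2 * s.a * p.1 * p.2) ^ 2)
    (fun p ↦ ((analyticAt_fst.mul analyticAt_snd).mul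
      ((analyticAt_const.sub (analyticAt_const.mul analyticAt_fst)).add
      (analyticAt_const.mul (analyticAt_fst.pow 2)))).mul
      ((analyticAt_const.sub (analyticAt_const.mul analyticAt_snd)).add
      (analyticAt_const.mul (analyticAt_snd.pow 2))))
    (fun p ↦ (((analyticAt_fst.add analyticAt_snd).mul (analyticAt_const.add
      ((analyticAt_const.mul analyticAt_fst).mul analyticAt_snd))).sub
      ((analyticAt_const.mul analyticAt_fst).mul analyticAt_snd)).pow 2) ?_
  intro v hv
  simpa using hv

include C D ha hc

lemma x_s₁ (τ₁ τ₂ : ℍ) : s.x (s₁ • τ₁) (s₁ • τ₂) = s.x τ₁ τ₂ := by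
  have h1 := mul_ne_zero (mul_ne_zero D.α_ne D.β_ne) (D.t_ne τ₁)
  have h2 := mul_ne_zero (mul_ne_zero D.α_ne D.β_ne) (D.t_ne τ₂)
  have hk : (s.α * s.β) ^ 2 ≠ 0 := pow_ne_zero _ (mul_ne_zero D.α_ne D.β_ne)
  simp only [Sporadic.x, t_s₁ C D, ha, hc]
  rw [x_of_div _ _ _ _ h1 h2, ← mul_div_mul_left _ ((1 - s.α * s.β * s.t τ₁ * s.t τ₂) ^ 2) hk]
  congr 1 <;> ring

lemma x_s₂ (τ₁ τ₂ : ℍ) : s.x (s₂ • τ₁) (s₂ • τ₂) = s.x τ₁ τ₂ := by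
  have h1 := mul_ne_zero D.α_ne (one_sub_β_ne C D τ₁)
  have h2 := mul_ne_zero D.α_ne (one_sub_β_ne C D τ₂)
  have hk : (s.α * (s.α - s.β)) ^ 2 ≠ 0 := pow_ne_zero _ (mul_ne_zero D.α_ne D.α_sub_β_ne)
  simp only [Sporadic.x, t_s₂ C D, ha, hc]
  rw [x_of_div _ _ _ _ h1 h2, ← mul_div_mul_left _ ((1 - s.α * s.β * s.t τ₁ * s.t τ₂) ^ 2) hk]
  congr 1 <;> ring

lemma y_s₁ (τ₁ τ₂ : ℍ) : s.y (s₁ • τ₁) (s₁ • τ₂) = s.y τ₁ τ₂ := by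
  have h1 := mul_ne_zero (mul_ne_zero D.α_ne D.β_ne) (D.t_ne τ₁)
  have h2 := mul_ne_zero (mul_ne_zero D.α_ne D.β_ne) (D.t_ne τ₂)
  have hk : (s.α * s.β) ^ 4 ≠ 0 := pow_ne_zero _ (mul_ne_zero D.α_ne D.β_ne)
  simp only [Sporadic.y, t_s₁ C D, ha, hc]
  rw [y_of_div _ _ _ _ h1 h2, ← mul_div_mul_left _ (((s.t τ₁ + s.t τ₂) *
    (1 + s.α * s.β * s.t τ₁ * s.t τ₂) - 2 * (s.α + s.β) * s.t τ₁ * s.t τ₂) ^ 2) hk]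
  congr 1 <;> ring

lemma y_s₂ (τ₁ τ₂ : ℍ) : s.y (s₂ • τ₁) (s₂ • τ₂) = s.y τ₁ τ₂ := by
  have h1 := mul_ne_zero D.α_ne (one_sub_β_ne C D τ₁)
  have h2 := mul_ne_zero D.α_ne (one_sub_β_ne C D τ₂)
  have hk : (s.α * (s.α - s.β)) ^ 4 ≠ 0 := pow_ne_zero _ (mul_ne_zero D.α_ne D.α_sub_β_ne)
  simp only [Sporadic.y, t_s₂ C D, ha, hc]
  rw [y_of_div _ _ _ _ h1 h2, ← mul_div_mul_left _ (((s.t τ₁ + s.t τ₂) *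
    (1 + s.α * s.β * s.t τ₁ * s.t τ₂) - 2 * (s.α + s.β) * s.t τ₁ * s.t τ₂) ^ 2) hk]
  congr 1 <;> ring

omit C D ha in
lemma F_eq (τ₁ τ₂ : ℍ) : s.F τ₁ τ₂ =
    s.f τ₁ * s.f τ₂ - s.α * s.β * ((s.t * s.f) τ₁ * (s.t * s.f) τ₂) := by
  simp only [Sporadic.F, hc, Pi.mul_apply]
  ring

omit ha in
lemma F_slash {γ : SL(2, ℤ)} (hγ : γ ∈ s.Γ) : DiagonalEq s.F (intToReal γ) 1 := fun τ₁ τ₂ ↦ by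
  have h1 : (s.chi₁Value γ : ℂ) ^ 2 = 1 := by exact_mod_cast C.e_sq hγ
  rw [F_eq hc, F_eq hc, f_slash C D hγ τ₁, f_slash C D hγ τ₂, tf_slash C D hγ τ₁,
    tf_slash C D hγ τ₂]
  simp only [Pi.smul_apply, smul_eq_mul]
  linear_combination (autFactor (intToReal γ) τ₁ * autFactor (intToReal γ) τ₂ *
    (s.f τ₁ * s.f τ₂ - s.α * s.β * ((s.t * s.f) τ₁ * (s.t * s.f) τ₂))) * h1

omit ha in
lemma F_s₁ : DiagonalEq s.F s₁ 1 := fun τ₁ τ₂ ↦ by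
  have h1 := D.κ_sq
  have h2 : s.α * s.β * (κ⁻¹) ^ 2 = -1 := by
    have := D.κ_ne
    field_simp
    linear_combination h1
  rw [F_eq hc, F_eq hc, D.f_s₁ τ₁, D.f_s₁ τ₂, tf_s₁ C D τ₁, tf_s₁ C D τ₂]
  simp only [Pi.smul_apply, smul_eq_mul]
  linear_combination (autFactor s₁ τ₁ * autFactor s₁ τ₂ * ((s.t * s.f) τ₁ * (s.t * s.f) τ₂)) * h1 -
    (autFactor s₁ τ₁ * autFactor s₁ τ₂ * (s.f τ₁ * s.f τ₂)) * h2

omit ha in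
lemma F_s₂ : DiagonalEq s.F s₂ (-1) := fun τ₁ τ₂ ↦ by
  have h1 := D.l_sq
  have h2 := D.α_ne
  rw [F_eq hc, F_eq hc, D.f_s₂ τ₁, D.f_s₂ τ₂, D.tf_s₂ τ₁, D.tf_s₂ τ₂]
  simp only [φ₂_eq C D, φ₃_eq C D, Pi.mul_apply]
  field_simp
  linear_combination (autFactor s₂ τ₁ * autFactor s₂ τ₂ * s.f τ₁ * s.f τ₂ *
    (s.α * s.β * s.t τ₁ * s.t τ₂ - 1)) * h1

end Sporadic

end FormData

end Bimodular

namespace Bimodular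

open Filter Asymptotics

/-! ### Deduction of the statement from the data -/

/-- How the tabulated matrices and the group `G` of a sporadic case are expressed by `Γ` and the two
involutions `s₁`, `s₂`. -/
structure GroupData (s : Sporadic) (s₁ s₂ : SL(2, ℝ)) : Prop where
  σ₁_nonempty : (represented s.σ₁).Nonempty
  σ₁_eq : ∀ g ∈ represented s.σ₁, ∃ γ ∈ s.Γ, g = intToReal γ * s₁
  σ₂_nonempty : (represented s.σ₂).Nonempty
  σ₂_eq : ∀ g ∈ represented s.σ₂, ∃ γ ∈ s.Γ, g = intToReal γ * s₂
  toReal_le : toReal s.Γ ≤ s.G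
  s₁_mem : s₁ ∈ s.G
  s₂_mem : s₂ ∈ s.G
  le_closure : s.G ≤ Subgroup.closure ((toReal s.Γ : Set SL(2, ℝ)) ∪ {s₁, s₂})
  table : ∀ p ∈ s.chi₂Table, (represented p.1).Nonempty ∧ ∀ g ∈ represented p.1, ∃ γ ∈ s.Γ,
    (g = intToReal γ * s₁ ∧ p.2 = 1) ∨ (g = intToReal γ * s₂ ∧ p.2 = -1) ∨
      (g = intToReal γ * (s₁ * s₂) ∧ p.2 = -1)

namespace FormData

variable {s : Sporadic} {s₁ s₂ : SL(2, ℝ)} {g₁ g₂ g₃ δ : SL(2, ℤ)} {κ l : ℂ} {φ₂ φ₃ : ℍ → ℂ}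
  (C : CuspData s.Γ s.chi₁Value s₁ s₂ g₁ g₂ g₃ δ)
  (D : FormData s.α s.β s.t s.f s₁ s₂ κ l φ₂ φ₃) (K : GroupData s s₁ s₂)

lemma toReal_le_normalizer : toReal s.Γ ≤ realNormalizer s.Γ := Subgroup.le_normalizer

include C K in
lemma admissible : IsAdmissiblePair s.Γ s.G where
  congruence := C.congruence
  contains := K.toReal_le
  normalizes := by
    refine K.le_closure.trans ((Subgroup.closure_le _).mpr ?_)
    rintro g (hg | rfl | rfl)
    · exact toReal_le_normalizer hg
    · exact C.s₁_mem_normalizer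
    · exact C.s₂_mem_normalizer

include C K in
/-- A function that is invariant under `Γ` in each variable and under the two involutions is a
bimodular function. -/
lemma isBimodularFunction {φ : ℍ → ℍ → ℂ} (mero : IsMeromorphic φ)
    (left : ∀ γ ∈ s.Γ, ∀ τ₁ τ₂ : ℍ, φ (γ • τ₁) τ₂ = φ τ₁ τ₂)
    (right : ∀ γ ∈ s.Γ, ∀ τ₁ τ₂ : ℍ, φ τ₁ (γ • τ₂) = φ τ₁ τ₂)
    (h₁ : ∀ τ₁ τ₂ : ℍ, φ (s₁ • τ₁) (s₁ • τ₂) = φ τ₁ τ₂)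
    (h₂ : ∀ τ₁ τ₂ : ℍ, φ (s₂ • τ₁) (s₂ • τ₂) = φ τ₁ τ₂) :
    IsBimodularFunction s.Γ s.G φ where
  pair := admissible C K
  meromorphic := mero
  invariant_left := left
  invariant_right := right
  invariant_diagonal := by
    intro g hg
    replace hg := K.le_closure hg
    induction hg using Subgroup.closure_induction with
    | mem x hx =>
      rcases hx with ⟨γ, hγ, rfl⟩ | rfl | rfl
      · intro τ₁ τ₂
        change φ (intToReal γ • τ₁) (intToReal γ • τ₂) = _
        rw [intToReal_smul, intToReal_smul, left γ hγ, right γ hγ]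
      · exact h₁
      · exact h₂
    | one => simp
    | mul x y _ _ ihx ihy => intro τ₁ τ₂; rw [mul_smul, mul_smul, ihx, ihy]
    | inv x _ ih =>
      intro τ₁ τ₂
      rw [← ih, smul_inv_smul, smul_inv_smul]

include C in
lemma bounded_slash {φ : ℍ → ℂ}
    (hΓ : ∀ γ ∈ s.Γ, SlashEq φ (intToReal γ) ((s.chi₁Value γ : ℂ) • φ))
    (hs : ∀ g, (g = 1 ∨ g = s₁ ∨ g = s₂ ∨ g = s₁ * s₂) →
      ∃ ψ, SlashEq φ g ψ ∧ IsBoundedAtImInfty ψ) (A : SL(2, ℤ)) :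
    IsBoundedAtImInfty (SlashAction.map (1 : ℤ) A φ) := by
  obtain ⟨γ, hγ, g, hg, h10⟩ := C.cusps A
  obtain ⟨ψ, hψ, hb⟩ := hs g hg
  set b : SL(2, ℝ) := g⁻¹ * intToReal (γ * A) with hbdef
  have h1 : intToReal A = intToReal γ⁻¹ * (g * b) := by
    rw [hbdef, mul_inv_cancel_left, ← map_mul, inv_mul_cancel_left]
  have hid (τ : ℍ) : SlashAction.map (1 : ℤ) A φ τ =
      (s.chi₁Value γ⁻¹ : ℂ) * SlashAction.map (1 : ℤ) (b : GL (Fin 2) ℝ) ψ τ := by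
    have h2 : SlashEq ψ b (SlashAction.map (1 : ℤ) (b : GL (Fin 2) ℝ) ψ) := by
      intro τ
      have h3 := denom_ne_zero (b : GL (Fin 2) ℝ) τ
      rw [ModularForm.slash_apply]
      have h4 : autFactor b τ = denom (b : GL (Fin 2) ℝ) τ := rfl
      have h5 : b • τ = (b : GL (Fin 2) ℝ) • τ := rfl
      rw [h4, h5]
      simp [σ]
      field_simp
    have h3 : SlashEq φ (intToReal A) (SlashAction.map (1 : ℤ) A φ) := by
      intro τ
      rw [intToReal_smul, autFactor_intToReal, ModularForm.SL_slash_apply]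
      have h4 : denom A τ = (A 1 0 : ℂ) * τ + (A 1 1 : ℂ) := by
        simp [denom]
      have h5 := denom_ne_zero A τ
      rw [← h4, zpow_neg, zpow_one]
      field_simp
    have h6 := (hΓ _ (inv_mem hγ)).mul ((hψ.mul h2).smul (s.chi₁Value γ⁻¹ : ℂ))
    rw [← h1] at h6
    exact congrFun (h3.unique h6) τ
  have h7 : IsBoundedAtImInfty (SlashAction.map (1 : ℤ) (b : GL (Fin 2) ℝ) ψ) := hb.slash 1 h10
  rw [funext hid]
  exact IsBigO.const_mul_left h7 _

include C D in
lemma f_bounded (A : SL(2, ℤ)) : IsBoundedAtImInfty (SlashAction.map (1 : ℤ) A s.f) := by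
  refine bounded_slash C (fun γ hγ ↦ f_slash C D hγ) ?_ A
  rintro g (rfl | rfl | rfl | rfl)
  · exact ⟨_, SlashEq.one _, D.f_lim.isBigO_one ℝ⟩
  · exact ⟨_, D.f_s₁, (D.tf_lim.const_smul κ).isBigO_one ℝ⟩
  · exact ⟨_, D.f_s₂, D.φ₂_lim.isBigO_one ℝ⟩
  · exact ⟨_, f_s₁s₂ D, (D.φ₃_lim.const_smul κ).isBigO_one ℝ⟩

include C D in
lemma tf_bounded (A : SL(2, ℤ)) : IsBoundedAtImInfty (SlashAction.map (1 : ℤ) A (s.t * s.f)) := by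
  refine bounded_slash C (fun γ hγ ↦ tf_slash C D hγ) ?_ A
  rintro g (rfl | rfl | rfl | rfl)
  · exact ⟨_, SlashEq.one _, D.tf_lim.isBigO_one ℝ⟩
  · exact ⟨_, tf_s₁ C D, (D.f_lim.const_smul (-κ⁻¹)).isBigO_one ℝ⟩
  · exact ⟨_, D.tf_s₂, D.φ₃_lim.isBigO_one ℝ⟩
  · exact ⟨_, tf_s₁s₂ C D, (D.φ₂_lim.const_smul (-κ⁻¹)).isBigO_one ℝ⟩

include C D in
/-- Linear combinations of `f` and `t f` are modular forms of weight one. -/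
lemma isModularForm (u v : ℂ) : IsModularForm 1 s.Γ C.chi (u • s.f + v • (s.t * s.f)) where
  holo := (D.f_holo.const_smul u).add (D.tf_holo.const_smul v)
  transform γ τ := by
    have h1 := f_slash C D γ.2 τ
    have h2 := tf_slash C D γ.2 τ
    rw [intToReal_smul, autFactor_intToReal] at h1 h2
    rw [C.coe_chi, zpow_one]
    simp only [Pi.add_apply, Pi.smul_apply, smul_eq_mul] at h1 h2 ⊢
    rw [h1, h2]
    ring
  bounded_at_cusps A := by
    rw [SlashAction.add_slash, ModularForm.SL_smul_slash, ModularForm.SL_smul_slash]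
    exact ((f_bounded C D A).const_mul_left u).add ((tf_bounded C D A).const_mul_left v)

include D in
lemma exists_F_ne : ∃ τ₁ τ₂, s.F τ₁ τ₂ ≠ 0 := by
  by_contra! h
  have h1 (τ : ℍ) : 1 - s.c * s.t τ * s.t I = 0 := by
    have h2 := h τ I
    simpa [Sporadic.F, D.f_ne] using h2
  have h2 : Tendsto (fun τ ↦ 1 - s.c * s.t τ * s.t I) atImInfty (𝓝 (1 - s.c * 0 * s.t I)) :=
    ((D.t_lim.const_mul _).mul_const _).const_sub 1
  simp_rw [h1] at h2
  simpa using tendsto_nhds_unique h2 tendsto_const_nhds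

include C D K in
lemma exists_diagonalEq (hc : s.c = s.α * s.β) (g : SL(2, ℝ)) (hg : g ∈ s.G) :
    ∃ ε : ℂˣ, DiagonalEq s.F g ε := by
  replace hg := K.le_closure hg
  induction hg using Subgroup.closure_induction with
  | mem x hx =>
    rcases hx with ⟨γ, hγ, rfl⟩ | rfl | rfl
    · exact ⟨1, F_slash C D hc hγ⟩
    · exact ⟨1, F_s₁ C D hc⟩
    · exact ⟨-1, by simpa using F_s₂ C D hc⟩
  | one => exact ⟨1, DiagonalEq.one⟩
  | mul x y _ _ ihx ihy =>
    obtain ⟨ε, h⟩ := ihx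
    obtain ⟨ε', h'⟩ := ihy
    exact ⟨ε * ε', by simpa using h.mul h'⟩
  | inv x _ ih =>
    obtain ⟨ε, h⟩ := ih
    exact ⟨ε⁻¹, by simpa using h.inv ε.ne_zero⟩

include D in
lemma multiplier_unique {g : SL(2, ℝ)} {ε ε' : ℂˣ} (h : DiagonalEq s.F g ε)
    (h' : DiagonalEq s.F g ε') : ε = ε' := by
  obtain ⟨τ₁, τ₂, hF⟩ := exists_F_ne D
  ext
  have h1 := (h τ₁ τ₂).symm.trans (h' τ₁ τ₂)
  have h2 := autFactor_ne_zero g τ₁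
  have h3 := autFactor_ne_zero g τ₂
  apply mul_right_cancel₀ (mul_ne_zero (mul_ne_zero h2 h3) hF)
  linear_combination h1

include C D K in
/-- The multiplier of `F` under the diagonal action is a character of `G`. -/
lemma exists_chi₂ (hc : s.c = s.α * s.β) :
    ∃ χ₂ : s.G →* ℂˣ, ∀ g : s.G, DiagonalEq s.F g (χ₂ g) := by
  choose ε hε using fun g : s.G ↦ exists_diagonalEq C D K hc g g.2
  refine ⟨{ toFun := ε, map_one' := ?_, map_mul' := ?_ }, hε⟩
  · exact multiplier_unique D (hε 1) DiagonalEq.one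
  · intro g h
    exact multiplier_unique D (hε (g * h)) (by simpa using (hε g).mul (hε h))

include C D K in
lemma isBimodularForm (hc : s.c = s.α * s.β) (χ₂ : s.G →* ℂˣ)
    (hχ₂ : ∀ g : s.G, DiagonalEq s.F g (χ₂ g)) :
    IsBimodularForm 1 s.Γ s.G C.chi χ₂ s.F where
  pair := admissible C K
  characters γ g hg := by
    rw [C.chi_sq]
    refine multiplier_unique D (hχ₂ g) ?_
    rw [hg]
    exact F_slash C D hc γ.2
  modular_left τ₂ := by
    convert isModularForm C D (s.f τ₂) (-(s.c * s.t τ₂ * s.f τ₂)) using 1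
    ext τ₁
    simp only [Sporadic.F, Pi.add_apply, Pi.smul_apply, Pi.mul_apply, smul_eq_mul]
    ring
  modular_right τ₁ := by
    convert isModularForm C D (s.f τ₁) (-(s.c * s.t τ₁ * s.f τ₁)) using 1
    ext τ₂
    simp only [Sporadic.F, Pi.add_apply, Pi.smul_apply, Pi.mul_apply, smul_eq_mul]
    ring
  diagonal g τ₁ τ₂ := by
    rw [zpow_one, zpow_one]
    exact hχ₂ g τ₁ τ₂

end FormData

/-- The full statement for one sporadic case follows from its group-theoretic and analytic data. -/
theorem statement_of_data {s : Sporadic} {s₁ s₂ : SL(2, ℝ)} {g₁ g₂ g₃ δ : SL(2, ℤ)} {κ l : ℂ}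
    {φ₂ φ₃ : ℍ → ℂ} (C : CuspData s.Γ s.chi₁Value s₁ s₂ g₁ g₂ g₃ δ)
    (D : FormData s.α s.β s.t s.f s₁ s₂ κ l φ₂ φ₃) (K : GroupData s s₁ s₂)
    (ha : s.a = s.α + s.β) (hc : s.c = s.α * s.β) :
    (∀ X : ℂ, 1 - s.a * X + s.c * X ^ 2 = (1 - s.α * X) * (1 - s.β * X)) ∧
    ((represented s.σ₁).Nonempty ∧
      ∀ g ∈ represented s.σ₁, g ∈ realNormalizer s.Γ ∧
        ∀ τ : UpperHalfPlane, s.c * s.t τ ≠ 0 ∧ s.t (g • τ) = 1 / (s.c * s.t τ)) ∧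
    ((represented s.σ₂).Nonempty ∧
      ∀ g ∈ represented s.σ₂, g ∈ realNormalizer s.Γ ∧
        ∀ τ : UpperHalfPlane, s.α * (1 - s.β * s.t τ) ≠ 0 ∧
          s.t (g • τ) = (1 - s.α * s.t τ) / (s.α * (1 - s.β * s.t τ))) ∧
    IsBimodularFunction s.Γ s.G s.x ∧
    IsBimodularFunction s.Γ s.G s.y ∧
    ∃ (χ₁ : s.Γ →* ℂˣ) (χ₂ : s.G →* ℂˣ),
      (∀ γ : s.Γ, (χ₁ γ : ℂ) = (s.chi₁Value γ : ℂ)) ∧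
      (∀ p ∈ s.chi₂Table, (represented p.1).Nonempty ∧
        ∀ g ∈ represented p.1, ∃ hg : g ∈ s.G, χ₂ ⟨g, hg⟩ = p.2) ∧
      IsBimodularForm 1 s.Γ s.G χ₁ χ₂ s.F := by
  have hΓG {γ : SL(2, ℤ)} (hγ : γ ∈ s.Γ) : intToReal γ ∈ s.G := K.toReal_le ⟨γ, hγ, rfl⟩
  have hΓN {γ : SL(2, ℤ)} (hγ : γ ∈ s.Γ) : intToReal γ ∈ realNormalizer s.Γ :=
    FormData.toReal_le_normalizer ⟨γ, hγ, rfl⟩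
  have hinv {γ : SL(2, ℤ)} (hγ : γ ∈ s.Γ) (τ : ℍ) : s.t (γ • τ) = s.t τ :=
    FormData.t_invariant C D hγ τ
  refine ⟨fun X ↦ by rw [ha, hc]; ring, ⟨K.σ₁_nonempty, fun g hg ↦ ?_⟩,
    ⟨K.σ₂_nonempty, fun g hg ↦ ?_⟩, ?_, ?_, ?_⟩
  · obtain ⟨γ, hγ, rfl⟩ := K.σ₁_eq g hg
    refine ⟨mul_mem (hΓN hγ) C.s₁_mem_normalizer, fun τ ↦ ⟨?_, ?_⟩⟩
    · rw [hc]
      exact mul_ne_zero (mul_ne_zero D.α_ne D.β_ne) (D.t_ne τ)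
    · rw [mul_smul, intToReal_smul, hinv hγ, FormData.t_s₁ C D, hc]
  · obtain ⟨γ, hγ, rfl⟩ := K.σ₂_eq g hg
    refine ⟨mul_mem (hΓN hγ) C.s₂_mem_normalizer, fun τ ↦ ⟨?_, ?_⟩⟩
    · exact mul_ne_zero D.α_ne (FormData.one_sub_β_ne C D τ)
    · rw [mul_smul, intToReal_smul, hinv hγ, FormData.t_s₂ C D]
  · refine FormData.isBimodularFunction C K D.isMeromorphic_x ?_ ?_
      (FormData.x_s₁ C D ha hc) (FormData.x_s₂ C D ha hc)
    · intro γ hγ τ₁ τ₂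
      simp only [Sporadic.x, hinv hγ]
    · intro γ hγ τ₁ τ₂
      simp only [Sporadic.x, hinv hγ]
  · refine FormData.isBimodularFunction C K D.isMeromorphic_y ?_ ?_
      (FormData.y_s₁ C D ha hc) (FormData.y_s₂ C D ha hc)
    · intro γ hγ τ₁ τ₂
      simp only [Sporadic.y, hinv hγ]
    · intro γ hγ τ₁ τ₂
      simp only [Sporadic.y, hinv hγ]
  · obtain ⟨χ₂, hχ₂⟩ := FormData.exists_chi₂ C D K hc
    refine ⟨C.chi, χ₂, C.coe_chi, fun p hp ↦ ⟨(K.table p hp).1, fun g hg ↦ ?_⟩,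
      FormData.isBimodularForm C D K hc χ₂ hχ₂⟩
    have h₁ := FormData.F_s₁ C D hc
    have h₂ := FormData.F_s₂ C D hc
    obtain ⟨γ, hγ, ⟨rfl, h⟩ | ⟨rfl, h⟩ | ⟨rfl, h⟩⟩ := (K.table p hp).2 g hg
    · refine ⟨mul_mem (hΓG hγ) K.s₁_mem, FormData.multiplier_unique D (hχ₂ _) ?_⟩
      simpa [h] using (FormData.F_slash C D hc hγ).mul h₁
    · refine ⟨mul_mem (hΓG hγ) K.s₂_mem, FormData.multiplier_unique D (hχ₂ _) ?_⟩
      simpa [h] using (FormData.F_slash C D hc hγ).mul h₂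
    · refine ⟨mul_mem (hΓG hγ) (mul_mem K.s₁_mem K.s₂_mem),
        FormData.multiplier_unique D (hχ₂ _) ?_⟩
      simpa [h] using (FormData.F_slash C D hc hγ).mul (h₁.mul h₂)

end Bimodular

namespace Bimodular

open ModularGroup

/-! ### Coset decompositions of `SL(2, ℤ)` -/

/-- The matrix `(a, b; c, d)` of determinant one. -/
abbrev ofEntries (a b c d : ℤ) (h : a * d - b * c = 1) : SL(2, ℤ) :=
  ⟨!![a, b; c, d], by rw [Matrix.det_fin_two_of, h]⟩

/-- A subgroup `H` of `SL(2, ℤ)` containing `-1` and the unipotent elements `rₖ T^{wₖ} rₖ⁻¹`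
satisfies `SL(2, ℤ) = ⋃ₖ H rₖ ⟨T⟩`, if the right-hand side is stable under right multiplication
by `S`, which is a finite check. -/
lemma exists_coset_decomposition {n : ℕ} [NeZero n] {H : Subgroup SL(2, ℤ)} (r : Fin n → SL(2, ℤ))
    (w : Fin n → ℕ) (hw : ∀ k, 0 < w k) (hneg : -1 ∈ H) (h0 : r 0 = 1)
    (hT : ∀ k, ∃ g ∈ H, g * r k = r k * T ^ w k)
    (hS : ∀ k, ∀ i < w k, ∃ h ∈ H, ∃ k', ∃ j : ℤ, r k * T ^ i * S = h * r k' * T ^ j)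
    (A : SL(2, ℤ)) : ∃ h ∈ H, ∃ k, ∃ j : ℤ, A = h * r k * T ^ j := by
  have hA : A ∈ Subgroup.closure {S, T} := by simp [SpecialLinearGroup.SL2Z_generators]
  have stepS {A : SL(2, ℤ)} (hA : ∃ h ∈ H, ∃ k, ∃ j : ℤ, A = h * r k * T ^ j) :
      ∃ h ∈ H, ∃ k, ∃ j : ℤ, A * S = h * r k * T ^ j := by
    obtain ⟨h, hh, k, j, rfl⟩ := hA
    obtain ⟨g, hg, hgk⟩ := hT k
    have hpow (m : ℤ) : g ^ m * r k = r k * (T ^ w k) ^ m := by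
      have hconj : g = r k * T ^ w k * (r k)⁻¹ := eq_mul_inv_of_mul_eq hgk
      rw [hconj, conj_zpow, inv_mul_cancel_right]
    have hj : j = w k * (j / w k) + (j % w k).toNat := by
      rw [Int.toNat_of_nonneg (Int.emod_nonneg _ (by have := hw k; omega)), Int.mul_ediv_add_emod]
    obtain ⟨h', hh', k', j', h1⟩ := hS k (j % w k).toNat (by
      have := Int.emod_lt_of_pos j (show (0 : ℤ) < w k by exact_mod_cast hw k)
      have := hw k
      omega)
    refine ⟨h * g ^ (j / w k) * h', mul_mem (mul_mem hh (zpow_mem hg _)) hh', k', j', ?_⟩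
    calc h * r k * T ^ j * S
        = h * (r k * (T ^ w k) ^ (j / w k)) * T ^ (j % w k).toNat * S := by
          nth_rw 1 [hj]
          rw [zpow_add, zpow_mul, zpow_natCast, zpow_natCast]
          simp only [mul_assoc]
      _ = h * g ^ (j / w k) * (r k * T ^ (j % w k).toNat * S) := by
          rw [← hpow]
          simp only [mul_assoc]
      _ = _ := by
          rw [h1]
          simp only [mul_assoc]
  induction hA using Subgroup.closure_induction_right with
  | one => exact ⟨1, one_mem _, 0, 0, by simp [h0]⟩
  | mul_right x y _ hy ih =>
    rcases hy with rfl | rfl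
    · exact stepS ih
    · obtain ⟨h, hh, k, j, rfl⟩ := ih
      exact ⟨h, hh, k, j + 1, by rw [zpow_add_one, mul_assoc]⟩
  | mul_inv_cancel x y _ hy ih =>
    rcases hy with rfl | rfl
    · obtain ⟨h, hh, k, j, h1⟩ := stepS ih
      refine ⟨-1 * h, mul_mem hneg hh, k, j, ?_⟩
      have hSinv : S⁻¹ = S * -1 := by decide
      rw [hSinv, ← mul_assoc, h1]
      simp
    · obtain ⟨h, hh, k, j, rfl⟩ := ih
      exact ⟨h, hh, k, j - 1, by rw [zpow_sub_one, mul_assoc]⟩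

/-! ### Integral representatives of elements of `SL(2, ℝ)` -/

/-- `g` is represented by the integral matrix `M`, i.e. it is a positive multiple of `M`. -/
def Rep (g : SL(2, ℝ)) (M : Matrix (Fin 2) (Fin 2) ℤ) : Prop :=
  ∃ r : ℝ, 0 < r ∧ (g : Matrix (Fin 2) (Fin 2) ℝ) = r • M.map (Int.cast : ℤ → ℝ)

lemma mem_represented {S : Set (Matrix (Fin 2) (Fin 2) ℤ)} {g : SL(2, ℝ)} :
    g ∈ represented S ↔ ∃ M ∈ S, Rep g M := Iff.rfl

namespace Rep

variable {g h : SL(2, ℝ)} {M N : Matrix (Fin 2) (Fin 2) ℤ}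

lemma intCast (γ : SL(2, ℤ)) : Rep (intToReal γ) (γ : Matrix (Fin 2) (Fin 2) ℤ) :=
  ⟨1, one_pos, by ext i j; simp⟩

lemma mul (hg : Rep g M) (hh : Rep h N) : Rep (g * h) (M * N) := by
  obtain ⟨r, hr, h1⟩ := hg
  obtain ⟨r', hr', h2⟩ := hh
  refine ⟨r * r', mul_pos hr hr', ?_⟩
  rw [Matrix.SpecialLinearGroup.coe_mul, h1, h2, Matrix.smul_mul, Matrix.mul_smul, smul_smul]
  congr 1
  exact (Matrix.map_mul (f := Int.castRingHom ℝ)).symm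

lemma neg (hg : Rep g M) : Rep (-g) (-M) := by
  obtain ⟨r, hr, h1⟩ := hg
  refine ⟨r, hr, ?_⟩
  rw [Matrix.SpecialLinearGroup.coe_neg, h1]
  ext i j
  simp

lemma one : Rep 1 1 := by simpa [intToReal] using intCast 1

lemma inv (hg : Rep g M) : Rep g⁻¹ M.adjugate := by
  obtain ⟨r, hr, h1⟩ := hg
  refine ⟨r, hr, ?_⟩
  rw [Matrix.SpecialLinearGroup.coe_inv, h1, Matrix.adjugate_fin_two, Matrix.adjugate_fin_two]
  ext i j
  fin_cases i <;> fin_cases j <;> simp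

lemma det_eq {r : ℝ} (hr : (g : Matrix (Fin 2) (Fin 2) ℝ) = r • M.map (Int.cast : ℤ → ℝ)) :
    r ^ 2 * (M.det : ℝ) = 1 := by
  have h1 := g.det_coe
  rw [hr, Matrix.det_fin_two] at h1
  rw [Matrix.det_fin_two]
  simp only [Matrix.smul_apply, Matrix.map_apply, smul_eq_mul] at h1
  push_cast
  linear_combination h1

/-- An element of `SL(2, ℝ)` is determined by any integral matrix that represents it. -/
lemma eq_of_smul (hg : Rep g M) (hh : Rep h N) (k l : ℤ) (hk : 0 < k) (hl : 0 < l)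
    (hMN : k • M = l • N) : g = h := by
  obtain ⟨r, hr, h1⟩ := hg
  obtain ⟨r', hr', h2⟩ := hh
  have d1 := det_eq h1
  have d2 := det_eq h2
  have hk' : (0 : ℝ) < k := by exact_mod_cast hk
  have hl' : (0 : ℝ) < l := by exact_mod_cast hl
  have hij (i j : Fin 2) : (k : ℝ) * (M i j : ℝ) = l * (N i j : ℝ) := by
    have := congrFun (congrFun hMN i) j
    simp only [Matrix.smul_apply, smul_eq_mul] at this
    exact_mod_cast this
  have hdet : (k : ℝ) ^ 2 * (M.det : ℝ) = l ^ 2 * (N.det : ℝ) := by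
    have a := hij 0 0
    have b := hij 0 1
    have c := hij 1 0
    have d := hij 1 1
    rw [Matrix.det_fin_two, Matrix.det_fin_two]
    push_cast
    linear_combination (k * (M 1 1 : ℝ)) * a + l * (N 0 0 : ℝ) * d - (k * (M 1 0 : ℝ)) * b -
      l * (N 0 1 : ℝ) * c
  have hrr : r * l = r' * k := by
    have hsq : (r * l) ^ 2 = (r' * k) ^ 2 := by
      have hM : (M.det : ℝ) ≠ 0 := fun h0 ↦ by simp [h0] at d1
      apply mul_right_cancel₀ hM
      linear_combination (l : ℝ) ^ 2 * d1 - (l : ℝ) ^ 2 * d2 - r' ^ 2 * hdet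
    nlinarith [mul_pos hr hl', mul_pos hr' hk', sq_nonneg (r * l - r' * k)]
  ext i j
  have e1 := congrFun (congrFun h1 i) j
  have e2 := congrFun (congrFun h2 i) j
  simp only [Matrix.smul_apply, Matrix.map_apply, smul_eq_mul] at e1 e2
  rw [e1, e2]
  apply mul_left_cancel₀ hl'.ne'
  linear_combination (M i j : ℝ) * hrr + r' * hij i j

lemma eq (hg : Rep g M) (hh : Rep h N) (hMN : M = N) : g = h :=
  hg.eq_of_smul hh 1 1 one_pos one_pos (by rw [hMN])

lemma apply_one_zero (hg : Rep g M) (h0 : M 1 0 = 0) : g 1 0 = 0 := by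
  obtain ⟨r, hr, h1⟩ := hg
  rw [h1]
  simp [h0]

end Rep

/-- The element of `SL(2, ℝ)` represented by an integral matrix of positive determinant. -/
noncomputable def realOf (M : Matrix (Fin 2) (Fin 2) ℤ) (hM : 0 < M.det) : SL(2, ℝ) :=
  ⟨(√(M.det : ℝ))⁻¹ • M.map (Int.cast : ℤ → ℝ), by
    have h1 : (0 : ℝ) < (M.det : ℝ) := by exact_mod_cast hM
    have h2 := Real.sq_sqrt h1.le
    have h3 : √(M.det : ℝ) ≠ 0 := (Real.sqrt_pos.mpr h1).ne'
    rw [Matrix.det_fin_two] at h2 h3 ⊢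
    rw [Matrix.det_fin_two]
    simp only [Matrix.smul_apply, Matrix.map_apply, smul_eq_mul]
    field_simp
    rw [h2]
    push_cast
    ring⟩

lemma rep_realOf (M : Matrix (Fin 2) (Fin 2) ℤ) (hM : 0 < M.det) : Rep (realOf M hM) M :=
  ⟨(√(M.det : ℝ))⁻¹, inv_pos.mpr (Real.sqrt_pos.mpr (by exact_mod_cast hM)), rfl⟩

lemma autFactor_realOf (M : Matrix (Fin 2) (Fin 2) ℤ) (hM : 0 < M.det) (τ : ℍ) :
    autFactor (realOf M hM) τ =
      ((M 1 0 : ℂ) * τ + (M 1 1 : ℂ)) / ((√(M.det : ℝ) : ℝ) : ℂ) := by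
  simp [autFactor, realOf]
  ring

lemma coe_realOf_smul (M : Matrix (Fin 2) (Fin 2) ℤ) (hM : 0 < M.det) (τ : ℍ) :
    ((realOf M hM • τ : ℍ) : ℂ) =
      ((M 0 0 : ℂ) * τ + (M 0 1 : ℂ)) / ((M 1 0 : ℂ) * τ + (M 1 1 : ℂ)) := by
  have h1 : ((√(M.det : ℝ) : ℝ) : ℂ) ≠ 0 := by
    exact_mod_cast (Real.sqrt_pos.mpr (by exact_mod_cast hM)).ne'
  rw [coe_smul_eq, autFactor_realOf]
  simp only [realOf, Matrix.smul_apply, Matrix.map_apply, smul_eq_mul, Complex.ofReal_mul,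
    Complex.ofReal_inv, Complex.ofReal_intCast]
  rw [← mul_div_mul_left _ ((M 1 0 : ℂ) * τ + (M 1 1 : ℂ)) (inv_ne_zero h1)]
  congr 1
  · ring
  · ring

end Bimodular

namespace Bimodular

open ModularGroup

set_option maxRecDepth 4000

/-! ### Generators and cusps of the groups of levels 5, 6, 8 and 9 -/

/-- Representatives of the double cosets `Γ \ SL(2, ℤ) / ⟨T⟩`, i.e. of the cusps, for the group of
level six. -/
abbrev cosetRep_six : Fin 4 → SL(2, ℤ) :=
  ![1, ofEntries 1 0 3 1 (by norm_num), ofEntries 1 0 2 1 (by norm_num), S]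

lemma decomposition_six {H : Subgroup SL(2, ℤ)} (hneg : -1 ∈ H) (hT : T ∈ H)
    (h₁ : ofEntries (-5) 2 (-18) 7 (by norm_num) ∈ H)
    (h₂ : ofEntries (-5) 3 (-12) 7 (by norm_num) ∈ H)
    (h₃ : ofEntries 1 0 (-6) 1 (by norm_num) ∈ H) (A : SL(2, ℤ)) :
    ∃ h ∈ H, ∃ k, ∃ j : ℤ, A = h * cosetRep_six k * T ^ j := by
  refine exists_coset_decomposition _ ![1, 2, 3, 6] (by decide) hneg rfl ?_ ?_ A
  · intro k
    fin_cases k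
    exacts [⟨_, hT, by decide⟩, ⟨_, h₁, by decide⟩, ⟨_, h₂, by decide⟩, ⟨_, h₃, by decide⟩]
  · intro k i hi
    fin_cases k <;>
      simp only [Fin.reduceFinMk, Fin.zero_eta, Fin.mk_one, Matrix.cons_val] at hi <;>
      interval_cases i
    exacts [⟨_, one_mem _, 3, 0, by decide⟩,
      ⟨_, one_mem _, 3, -3, by decide⟩,
      ⟨_, mul_mem hneg h₁, 2, 1, by decide⟩,
      ⟨_, one_mem _, 3, -2, by decide⟩,
      ⟨_, one_mem _, 1, -1, by decide⟩,
      ⟨_, mul_mem hneg (inv_mem h₁), 3, -4, by decide⟩,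
      ⟨_, hneg, 0, 0, by decide⟩,
      ⟨_, inv_mem hT, 3, -1, by decide⟩,
      ⟨_, inv_mem hT, 2, -1, by decide⟩,
      ⟨_, mul_mem hneg h₃, 1, 0, by decide⟩,
      ⟨_, mul_mem hneg h₃, 2, 0, by decide⟩,
      ⟨_, mul_mem (mul_mem hneg h₃) hT, 3, 1, by decide⟩]

/-- Representatives of the double cosets `Γ \ SL(2, ℤ) / ⟨T⟩`, i.e. of the cusps, for the group of
level eight. -/
abbrev cosetRep_eight : Fin 4 → SL(2, ℤ) :=
  ![1, ofEntries 1 0 2 1 (by norm_num), ofEntries 1 0 4 1 (by norm_num),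
    ofEntries 1 0 1 1 (by norm_num)]

lemma decomposition_eight {H : Subgroup SL(2, ℤ)} (hneg : -1 ∈ H) (hT : T ∈ H)
    (h₁ : ofEntries (-3) 2 (-8) 5 (by norm_num) ∈ H)
    (h₂ : ofEntries (-3) 1 (-16) 5 (by norm_num) ∈ H)
    (h₃ : ofEntries (-7) 8 (-8) 9 (by norm_num) ∈ H) (A : SL(2, ℤ)) :
    ∃ h ∈ H, ∃ k, ∃ j : ℤ, A = h * cosetRep_eight k * T ^ j := by
  refine exists_coset_decomposition _ ![1, 2, 1, 8] (by decide) hneg rfl ?_ ?_ A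
  · intro k
    fin_cases k
    exacts [⟨_, hT, by decide⟩, ⟨_, h₁, by decide⟩, ⟨_, h₂, by decide⟩, ⟨_, h₃, by decide⟩]
  · intro k i hi
    fin_cases k <;>
      simp only [Fin.reduceFinMk, Fin.zero_eta, Fin.mk_one, Matrix.cons_val] at hi <;>
      interval_cases i
    exacts [⟨_, inv_mem hT, 3, -1, by decide⟩,
      ⟨_, inv_mem hT, 3, -3, by decide⟩,
      ⟨_, mul_mem hneg h₁, 3, 1, by decide⟩,
      ⟨_, inv_mem hT, 3, -5, by decide⟩,
      ⟨_, inv_mem hT, 3, -2, by decide⟩,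
      ⟨_, one_mem _, 1, -1, by decide⟩,
      ⟨_, mul_mem (mul_mem hneg (inv_mem h₁)) (inv_mem hT), 3, -4, by decide⟩,
      ⟨_, mul_mem hneg (inv_mem h₁), 2, -1, by decide⟩,
      ⟨_, mul_mem (mul_mem (inv_mem h₁) (inv_mem h₂)) h₁, 3, 2, by decide⟩,
      ⟨_, mul_mem (mul_mem hneg (inv_mem h₁)) (inv_mem h₂), 1, 0, by decide⟩,
      ⟨_, mul_mem (mul_mem hneg (inv_mem h₁)) (inv_mem h₂), 3, 0, by decide⟩,
      ⟨_, mul_mem hneg h₃, 0, 1, by decide⟩]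

/-- Representatives of the double cosets `Γ \ SL(2, ℤ) / ⟨T⟩`, i.e. of the cusps, for the group of
level nine. -/
abbrev cosetRep_nine : Fin 4 → SL(2, ℤ) :=
  ![1, S, ofEntries 1 0 (-3) 1 (by norm_num), ofEntries 1 0 3 1 (by norm_num)]

lemma decomposition_nine {H : Subgroup SL(2, ℤ)} (hneg : -1 ∈ H) (hT : T ∈ H)
    (h₁ : ofEntries 1 0 (-9) 1 (by norm_num) ∈ H)
    (h₂ : ofEntries 4 1 (-9) (-2) (by norm_num) ∈ H)
    (h₃ : ofEntries (-2) 1 (-9) 4 (by norm_num) ∈ H) (A : SL(2, ℤ)) :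
    ∃ h ∈ H, ∃ k, ∃ j : ℤ, A = h * cosetRep_nine k * T ^ j := by
  refine exists_coset_decomposition _ ![1, 9, 1, 1] (by decide) hneg rfl ?_ ?_ A
  · intro k
    fin_cases k
    exacts [⟨_, hT, by decide⟩, ⟨_, h₁, by decide⟩, ⟨_, h₂, by decide⟩, ⟨_, h₃, by decide⟩]
  · intro k i hi
    fin_cases k <;>
      simp only [Fin.reduceFinMk, Fin.zero_eta, Fin.mk_one, Matrix.cons_val] at hi <;>
      interval_cases i
    exacts [⟨_, one_mem _, 1, 0, by decide⟩,
      ⟨_, hneg, 0, 0, by decide⟩,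
      ⟨_, inv_mem hT, 1, -1, by decide⟩,
      ⟨_, mul_mem hneg h₂, 1, 4, by decide⟩,
      ⟨_, hneg, 2, 0, by decide⟩,
      ⟨_, inv_mem h₂, 1, 2, by decide⟩,
      ⟨_, mul_mem (mul_mem hneg h₁) h₃, 1, -2, by decide⟩,
      ⟨_, mul_mem hneg h₁, 3, 0, by decide⟩,
      ⟨_, mul_mem h₁ (inv_mem h₃), 1, -4, by decide⟩,
      ⟨_, mul_mem (mul_mem hneg h₁) hT, 1, 1, by decide⟩,
      ⟨_, one_mem _, 1, 3, by decide⟩,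
      ⟨_, one_mem _, 1, -3, by decide⟩]

/-- Representatives of the double cosets `Γ \ SL(2, ℤ) / ⟨T⟩`, i.e. of the cusps, for the group of
level five. -/
abbrev cosetRep_five : Fin 4 → SL(2, ℤ) :=
  ![1, ofEntries 2 (-1) 5 (-2) (by norm_num), S, ofEntries 1 0 2 1 (by norm_num)]

lemma decomposition_five {H : Subgroup SL(2, ℤ)} (hneg : -1 ∈ H) (hT : T ∈ H)
    (h₁ : ofEntries (-9) 4 (-25) 11 (by norm_num) ∈ H)
    (h₂ : ofEntries 1 0 (-5) 1 (by norm_num) ∈ H)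
    (h₃ : ofEntries (-9) 5 (-20) 11 (by norm_num) ∈ H) (A : SL(2, ℤ)) :
    ∃ h ∈ H, ∃ k, ∃ j : ℤ, A = h * cosetRep_five k * T ^ j := by
  refine exists_coset_decomposition _ ![1, 1, 5, 5] (by decide) hneg rfl ?_ ?_ A
  · intro k
    fin_cases k
    exacts [⟨_, hT, by decide⟩, ⟨_, h₁, by decide⟩, ⟨_, h₂, by decide⟩, ⟨_, h₃, by decide⟩]
  · intro k i hi
    fin_cases k <;>
      simp only [Fin.reduceFinMk, Fin.zero_eta, Fin.mk_one, Matrix.cons_val] at hi <;>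
      interval_cases i
    exacts [⟨_, one_mem _, 2, 0, by decide⟩,
      ⟨_, hneg, 3, 2, by decide⟩,
      ⟨_, hneg, 0, 0, by decide⟩,
      ⟨_, inv_mem hT, 2, -1, by decide⟩,
      ⟨_, inv_mem hT, 3, -1, by decide⟩,
      ⟨_, mul_mem hneg h₂, 3, 0, by decide⟩,
      ⟨_, mul_mem (mul_mem hneg h₂) hT, 2, 1, by decide⟩,
      ⟨_, one_mem _, 2, -2, by decide⟩,
      ⟨_, mul_mem hneg h₁, 3, 3, by decide⟩,
      ⟨_, one_mem _, 1, 0, by decide⟩,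
      ⟨_, inv_mem h₁, 3, 1, by decide⟩,
      ⟨_, mul_mem hneg (inv_mem h₁), 2, -3, by decide⟩]

/-- A group with the given generators is recognized by a coset decomposition all of whose nontrivial
representatives lie outside the group. -/
lemma eq_closure_of_decomposition {Γ : Subgroup SL(2, ℤ)} {X : Set SL(2, ℤ)} (hX : X ⊆ Γ)
    (hT : T ∈ X) {r : Fin 4 → SL(2, ℤ)} (h0 : r 0 = 1) (hr : ∀ k ≠ 0, r k ∉ Γ)
    (h : ∀ A, ∃ h ∈ Subgroup.closure X, ∃ k, ∃ j : ℤ, A = h * r k * T ^ j) :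
    Γ = Subgroup.closure X := by
  apply le_antisymm _ ((Subgroup.closure_le _).mpr hX)
  intro A hA
  obtain ⟨γ, hγ, k, j, rfl⟩ := h A
  have hγ' : γ ∈ Γ := (Subgroup.closure_le _).mpr hX hγ
  rw [mul_assoc, Γ.mul_mem_cancel_left hγ', Γ.mul_mem_cancel_right (zpow_mem (hX hT) j)] at hA
  have hk : k = 0 := by
    by_contra hk
    exact hr k hk hA
  rw [hk, h0, mul_one]
  exact mul_mem hγ (zpow_mem (Subgroup.subset_closure hT) j)

/-- The data of a group and its cusps, for two elements represented by integral matrices. -/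
theorem CuspData.of_matrices {Γ : Subgroup SL(2, ℤ)} {e : SL(2, ℤ) → ℤ}
    {M₁ M₂ : Matrix (Fin 2) (Fin 2) ℤ} (hM₁ : 0 < M₁.det) (hM₂ : 0 < M₂.det)
    {g₁ g₂ g₃ δ : SL(2, ℤ)} {r : Fin 4 → SL(2, ℤ)}
    (congruence : IsCongruenceSubgroup Γ)
    (generated : Γ = Subgroup.closure {-1, T, g₁, g₂, g₃})
    (sq₁ : M₁ * M₁ = M₁.det • (-1)) (sq₂ : M₂ * M₂ = M₂.det • (-1))
    (conj₁ : g₁.1 * M₁ = M₁ * T.1) (conj₂ : g₂.1 * M₂ = M₂ * T.1)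
    (conj₃ : g₃.1 * (M₁ * M₂) = M₁ * M₂ * T.1)
    (comm_mem : δ ∈ Γ) (comm : M₂ * M₁ = δ.1 * (M₁ * M₂))
    (decomposition : ∀ A, ∃ h ∈ Γ, ∃ k, ∃ j : ℤ, A = h * r k * T ^ j)
    (cusps : ∀ k, ∃ γ ∈ Γ, ∃ M, (M = 1 ∨ M = M₁ ∨ M = M₂ ∨ M = M₁ * M₂) ∧
      (M.adjugate * (γ * r k).1) 1 0 = 0)
    (e_mul : ∀ γ ∈ Γ, ∀ γ' ∈ Γ, e (γ * γ') = e γ * e γ')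
    (e_neg_one : e (-1) = -1) (e_T : e T = 1) (e_g₁ : e g₁ = 1) (e_g₂ : e g₂ = 1)
    (e_g₃ : e g₃ = 1) :
    CuspData Γ e (realOf M₁ hM₁) (realOf M₂ hM₂) g₁ g₂ g₃ δ := by
  have r₁ := rep_realOf M₁ hM₁
  have r₂ := rep_realOf M₂ hM₂
  have hsq {M : Matrix (Fin 2) (Fin 2) ℤ} (hM : 0 < M.det) (h : M * M = M.det • (-1)) :
      realOf M hM * realOf M hM = -1 :=
    ((rep_realOf M hM).mul (rep_realOf M hM)).eq_of_smul Rep.one.neg 1 _ one_pos hM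
      (by rw [one_smul, h])
  have cusp (A : SL(2, ℤ)) : ∃ γ ∈ Γ, ∃ s, (s = 1 ∨ s = realOf M₁ hM₁ ∨ s = realOf M₂ hM₂ ∨
      s = realOf M₁ hM₁ * realOf M₂ hM₂) ∧ (s⁻¹ * intToReal (γ * A)) 1 0 = 0 := by
    obtain ⟨h, hh, k, j, rfl⟩ := decomposition A
    obtain ⟨γ, hγ, M, hM, h0⟩ := cusps k
    have hs : ∃ s : SL(2, ℝ), (s = 1 ∨ s = realOf M₁ hM₁ ∨ s = realOf M₂ hM₂ ∨
        s = realOf M₁ hM₁ * realOf M₂ hM₂) ∧ Rep s M := by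
      rcases hM with rfl | rfl | rfl | rfl
      · exact ⟨1, by simp, Rep.one⟩
      · exact ⟨_, by simp, r₁⟩
      · exact ⟨_, by simp, r₂⟩
      · exact ⟨_, by simp, r₁.mul r₂⟩
    obtain ⟨s, hs, hsM⟩ := hs
    refine ⟨γ * h⁻¹, mul_mem hγ (inv_mem hh), s, hs, ?_⟩
    have h1 : γ * h⁻¹ * (h * r k * T ^ j) = γ * r k * T ^ j := by group
    rw [h1]
    apply (hsM.inv.mul (Rep.intCast _)).apply_one_zero
    rw [Matrix.SpecialLinearGroup.coe_mul, coe_T_zpow, ← Matrix.mul_assoc, Matrix.mul_apply,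
      Fin.sum_univ_two, h0]
    simp
  exact {
    congruence, generated, comm_mem, e_mul, e_neg_one, e_T, e_g₁, e_g₂, e_g₃
    sq₁ := hsq hM₁ sq₁
    sq₂ := hsq hM₂ sq₂
    conj₁ := ((Rep.intCast _).mul r₁).eq (r₁.mul (Rep.intCast _)) conj₁
    conj₂ := ((Rep.intCast _).mul r₂).eq (r₂.mul (Rep.intCast _)) conj₂
    conj₃ := ((Rep.intCast _).mul (r₁.mul r₂)).eq ((r₁.mul r₂).mul (Rep.intCast _)) conj₃
    comm := (r₂.mul r₁).eq ((Rep.intCast _).mul (r₁.mul r₂)) comm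
    cusps := cusp }

lemma exists_cusp {Γ : Subgroup SL(2, ℤ)} {P : SL(2, ℤ) → Matrix (Fin 2) (Fin 2) ℤ → Prop}
    {M₁ M₂ M : Matrix (Fin 2) (Fin 2) ℤ} (γ : SL(2, ℤ)) (hγ : γ ∈ Γ)
    (hM : M = 1 ∨ M = M₁ ∨ M = M₂ ∨ M = M₁ * M₂) (h : P γ M) :
    ∃ γ ∈ Γ, ∃ M, (M = 1 ∨ M = M₁ ∨ M = M₂ ∨ M = M₁ * M₂) ∧ P γ M :=
  ⟨γ, hγ, M, hM, h⟩

/-! ### The quadratic characters -/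

lemma jacobiSym_three_mul {N : ℕ} (hN : 3 ∣ N) {γ γ' : SL(2, ℤ)} (hγ : γ ∈ Gamma0 N) :
    jacobiSym ((γ * γ') 1 1) 3 = jacobiSym (γ 1 1) 3 * jacobiSym (γ' 1 1) 3 := by
  rw [← jacobiSym.mul_left]
  apply jacobiSym.mod_left'
  rw [Gamma0_mem, ZMod.intCast_zmod_eq_zero_iff_dvd] at hγ
  have h3 : (3 : ℤ) ∣ γ 1 0 := dvd_trans (by exact_mod_cast hN) hγ
  obtain ⟨m, hm⟩ := h3
  rw [Matrix.SpecialLinearGroup.coe_mul, Matrix.mul_apply, Fin.sum_univ_two, hm]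
  push_cast
  rw [mul_assoc, Int.add_emod, Int.mul_emod_right, zero_add, Int.emod_emod]

lemma chi_four_mul {N : ℕ} (hN : 4 ∣ N) {γ γ' : SL(2, ℤ)} (hγ : γ ∈ Gamma0 N) :
    ZMod.χ₄ ((γ * γ') 1 1 : ZMod 4) = ZMod.χ₄ (γ 1 1 : ZMod 4) * ZMod.χ₄ (γ' 1 1 : ZMod 4) := by
  rw [← map_mul]
  congr 1
  rw [Gamma0_mem, ZMod.intCast_zmod_eq_zero_iff_dvd] at hγ
  have h4 : (γ 1 0 : ZMod 4) = 0 := by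
    rw [ZMod.intCast_zmod_eq_zero_iff_dvd]
    exact dvd_trans (by exact_mod_cast hN) hγ
  rw [Matrix.SpecialLinearGroup.coe_mul, Matrix.mul_apply, Fin.sum_univ_two]
  push_cast
  rw [h4]
  ring

lemma mem_pmGamma1_five {γ : SL(2, ℤ)} : γ ∈ pmGamma1 5 ↔
    ((γ 1 0 : ZMod 5) = 0 ∧ ((γ 1 1 : ZMod 5) = 1 ∨ (γ 1 1 : ZMod 5) = -1)) := by
  have hdet : (γ 0 0 : ZMod 5) * (γ 1 1 : ZMod 5) - (γ 0 1 : ZMod 5) * (γ 1 0 : ZMod 5) = 1 := by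
    have := Matrix.det_fin_two γ.1
    rw [γ.det_coe] at this
    exact_mod_cast (congrArg (Int.cast : ℤ → ZMod 5) this).symm
  change (γ ∈ Gamma1 5 ∨ -γ ∈ Gamma1 5) ↔ _
  rw [Gamma1_mem, Gamma1_mem]
  simp only [Matrix.SpecialLinearGroup.coe_neg, Matrix.neg_apply, Int.cast_neg]
  generalize (γ 0 0 : ZMod 5) = a at *
  generalize (γ 0 1 : ZMod 5) = b at *
  generalize (γ 1 0 : ZMod 5) = c at *
  generalize (γ 1 1 : ZMod 5) = d at *
  revert a b c d
  decide

lemma pmGamma1_five_chi_mul {γ γ' : SL(2, ℤ)} (hγ : γ ∈ pmGamma1 5) (hγ' : γ' ∈ pmGamma1 5) :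
    (if ((γ * γ') 1 1 : ZMod 5) = 1 then 1 else -1 : ℤ) =
      (if (γ 1 1 : ZMod 5) = 1 then 1 else -1) * (if (γ' 1 1 : ZMod 5) = 1 then 1 else -1) := by
  rw [mem_pmGamma1_five] at hγ hγ'
  rw [Matrix.SpecialLinearGroup.coe_mul, Matrix.mul_apply, Fin.sum_univ_two]
  push_cast
  rw [hγ.1, zero_mul, zero_add]
  rcases hγ.2 with h | h <;> rcases hγ'.2 with h' | h' <;> rw [h, h'] <;> decide

instance (γ : SL(2, ℤ)) : Decidable (γ ∈ pmGamma1 5) :=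
  decidable_of_iff _ mem_pmGamma1_five.symm

instance (N : ℕ) (γ : SL(2, ℤ)) : Decidable (γ ∈ Gamma0 N) :=
  decidable_of_iff _ Gamma0_mem.symm

lemma pmGamma1_five_congruence : IsCongruenceSubgroup (pmGamma1 5) :=
  isCongruenceSubgroup_trans _ _ (fun _ h ↦ Or.inl h) (Gamma1_is_congruence 5)

/-! ### The cusp data of the six cases -/

lemma cuspData_case7 : CuspData (Gamma0 6) Sporadic.case7.chi₁Value
    (realOf !![2, -1; 6, -2] (by decide)) (realOf !![3, -2; 6, -3] (by decide))
    (ofEntries (-5) 2 (-18) 7 (by norm_num))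
    (ofEntries (-5) 3 (-12) 7 (by norm_num))
    (ofEntries 1 0 (-6) 1 (by norm_num))
    (ofEntries 5 (-1) 6 (-1) (by norm_num)) := by
  have hdec {H : Subgroup SL(2, ℤ)} (sub : {-1, T, ofEntries (-5) 2 (-18) 7 (by norm_num),
      ofEntries (-5) 3 (-12) 7 (by norm_num),
      ofEntries 1 0 (-6) 1 (by norm_num)} ⊆ (H : Set SL(2, ℤ))) (A : SL(2, ℤ)) :
      ∃ h ∈ H, ∃ k, ∃ j : ℤ, A = h * cosetRep_six k * T ^ j := by
    simp only [Set.insert_subset_iff, Set.singleton_subset_iff, SetLike.mem_coe] at sub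
    obtain ⟨hneg, hT, h₁, h₂, h₃⟩ := sub
    exact decomposition_six hneg hT h₁ h₂ h₃ A
  have sub : {-1, T, ofEntries (-5) 2 (-18) 7 (by norm_num),
      ofEntries (-5) 3 (-12) 7 (by norm_num),
      ofEntries 1 0 (-6) 1 (by norm_num)} ⊆
        ((Gamma0 6 : Subgroup SL(2, ℤ)) : Set SL(2, ℤ)) := by
    simp only [Set.insert_subset_iff, Set.singleton_subset_iff, SetLike.mem_coe]
    decide
  refine CuspData.of_matrices (by decide) (by decide) (Gamma0_is_congruence 6)
    (eq_closure_of_decomposition sub (by simp) rfl (by decide) (hdec Subgroup.subset_closure))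
    (by decide) (by decide) (by decide) (by decide) (by decide) (by decide) (by decide) (hdec sub)
    ?_ (fun γ hγ γ' hγ' ↦ jacobiSym_three_mul (by norm_num) hγ) ?_ ?_ ?_ ?_ ?_
  · intro k
    fin_cases k
    exacts [exists_cusp 1 (by decide) (Or.inl rfl) (by decide),
        exists_cusp 1 (by decide) (Or.inr (Or.inl rfl)) (by decide),
        exists_cusp 1 (by decide) (Or.inr (Or.inr (Or.inl rfl))) (by decide),
        exists_cusp 1 (by decide) (Or.inr (Or.inr (Or.inr rfl))) (by decide)]
  · change jacobiSym (-1) 3 = -1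
    norm_num
  · change jacobiSym 1 3 = 1
    norm_num
  · change jacobiSym 7 3 = 1
    norm_num
  · change jacobiSym 7 3 = 1
    norm_num
  · change jacobiSym 1 3 = 1
    norm_num

lemma cuspData_case10 : CuspData (Gamma0 6) Sporadic.case10.chi₁Value
    (realOf !![3, -2; 6, -3] (by decide)) (realOf !![2, -1; 6, -2] (by decide))
    (ofEntries (-5) 3 (-12) 7 (by norm_num))
    (ofEntries (-5) 2 (-18) 7 (by norm_num))
    (ofEntries (-5) 6 (-6) 7 (by norm_num))
    (ofEntries (-1) 1 (-6) 5 (by norm_num)) := by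
  have hdec {H : Subgroup SL(2, ℤ)} (sub : {-1, T, ofEntries (-5) 3 (-12) 7 (by norm_num),
      ofEntries (-5) 2 (-18) 7 (by norm_num),
      ofEntries (-5) 6 (-6) 7 (by norm_num)} ⊆ (H : Set SL(2, ℤ))) (A : SL(2, ℤ)) :
      ∃ h ∈ H, ∃ k, ∃ j : ℤ, A = h * cosetRep_six k * T ^ j := by
    simp only [Set.insert_subset_iff, Set.singleton_subset_iff, SetLike.mem_coe] at sub
    obtain ⟨hneg, hT, h₁, h₂, h₃⟩ := sub
    have h₃' := mul_mem (mul_mem (inv_mem hT) h₃) hT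
    exact decomposition_six hneg hT h₂ h₁ (by convert h₃' using 1; decide) A
  have sub : {-1, T, ofEntries (-5) 3 (-12) 7 (by norm_num),
      ofEntries (-5) 2 (-18) 7 (by norm_num),
      ofEntries (-5) 6 (-6) 7 (by norm_num)} ⊆
        ((Gamma0 6 : Subgroup SL(2, ℤ)) : Set SL(2, ℤ)) := by
    simp only [Set.insert_subset_iff, Set.singleton_subset_iff, SetLike.mem_coe]
    decide
  refine CuspData.of_matrices (by decide) (by decide) (Gamma0_is_congruence 6)
    (eq_closure_of_decomposition sub (by simp) rfl (by decide) (hdec Subgroup.subset_closure))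
    (by decide) (by decide) (by decide) (by decide) (by decide) (by decide) (by decide) (hdec sub)
    ?_ (fun γ hγ γ' hγ' ↦ jacobiSym_three_mul (by norm_num) hγ) ?_ ?_ ?_ ?_ ?_
  · intro k
    fin_cases k
    exacts [exists_cusp 1 (by decide) (Or.inl rfl) (by decide),
        exists_cusp 1 (by decide) (Or.inr (Or.inr (Or.inl rfl))) (by decide),
        exists_cusp 1 (by decide) (Or.inr (Or.inl rfl)) (by decide),
        exists_cusp (-T) (by decide) (Or.inr (Or.inr (Or.inr rfl))) (by decide)]
  · change jacobiSym (-1) 3 = -1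
    norm_num
  · change jacobiSym 1 3 = 1
    norm_num
  · change jacobiSym 7 3 = 1
    norm_num
  · change jacobiSym 7 3 = 1
    norm_num
  · change jacobiSym 7 3 = 1
    norm_num

lemma cuspData_caseNeg17 : CuspData (Gamma0 6) Sporadic.caseNeg17.chi₁Value
    (realOf !![0, -1; 6, 0] (by decide)) (realOf !![2, -1; 6, -2] (by decide))
    (ofEntries 1 0 (-6) 1 (by norm_num))
    (ofEntries (-5) 2 (-18) 7 (by norm_num))
    (ofEntries 7 3 (-12) (-5) (by norm_num))
    (ofEntries 5 2 12 5 (by norm_num)) := by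
  have hdec {H : Subgroup SL(2, ℤ)} (sub : {-1, T, ofEntries 1 0 (-6) 1 (by norm_num),
      ofEntries (-5) 2 (-18) 7 (by norm_num),
      ofEntries 7 3 (-12) (-5) (by norm_num)} ⊆ (H : Set SL(2, ℤ))) (A : SL(2, ℤ)) :
      ∃ h ∈ H, ∃ k, ∃ j : ℤ, A = h * cosetRep_six k * T ^ j := by
    simp only [Set.insert_subset_iff, Set.singleton_subset_iff, SetLike.mem_coe] at sub
    obtain ⟨hneg, hT, h₁, h₂, h₃⟩ := sub
    have h₃' := mul_mem (mul_mem hT h₃) (inv_mem hT)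
    exact decomposition_six hneg hT h₂ (by convert h₃' using 1; decide) h₁ A
  have sub : {-1, T, ofEntries 1 0 (-6) 1 (by norm_num),
      ofEntries (-5) 2 (-18) 7 (by norm_num),
      ofEntries 7 3 (-12) (-5) (by norm_num)} ⊆
        ((Gamma0 6 : Subgroup SL(2, ℤ)) : Set SL(2, ℤ)) := by
    simp only [Set.insert_subset_iff, Set.singleton_subset_iff, SetLike.mem_coe]
    decide
  refine CuspData.of_matrices (by decide) (by decide) (Gamma0_is_congruence 6)
    (eq_closure_of_decomposition sub (by simp) rfl (by decide) (hdec Subgroup.subset_closure))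
    (by decide) (by decide) (by decide) (by decide) (by decide) (by decide) (by decide) (hdec sub)
    ?_ (fun γ hγ γ' hγ' ↦ jacobiSym_three_mul (by norm_num) hγ) ?_ ?_ ?_ ?_ ?_
  · intro k
    fin_cases k
    exacts [exists_cusp 1 (by decide) (Or.inl rfl) (by decide),
        exists_cusp 1 (by decide) (Or.inr (Or.inr (Or.inl rfl))) (by decide),
        exists_cusp T⁻¹ (by decide) (Or.inr (Or.inr (Or.inr rfl))) (by decide),
        exists_cusp 1 (by decide) (Or.inr (Or.inl rfl)) (by decide)]
  · change jacobiSym (-1) 3 = -1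
    norm_num
  · change jacobiSym 1 3 = 1
    norm_num
  · change jacobiSym 1 3 = 1
    norm_num
  · change jacobiSym 7 3 = 1
    norm_num
  · change jacobiSym (-5) 3 = 1
    norm_num

lemma cuspData_case12 : CuspData (Gamma0 8) Sporadic.case12.chi₁Value
    (realOf !![4, -3; 8, -4] (by decide)) (realOf !![2, -1; 8, -2] (by decide))
    (ofEntries (-3) 2 (-8) 5 (by norm_num))
    (ofEntries (-3) 1 (-16) 5 (by norm_num))
    (ofEntries (-7) 8 (-8) 9 (by norm_num))
    (ofEntries (-1) 1 (-8) 7 (by norm_num)) := by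
  have hdec {H : Subgroup SL(2, ℤ)} (sub : {-1, T, ofEntries (-3) 2 (-8) 5 (by norm_num),
      ofEntries (-3) 1 (-16) 5 (by norm_num),
      ofEntries (-7) 8 (-8) 9 (by norm_num)} ⊆ (H : Set SL(2, ℤ))) (A : SL(2, ℤ)) :
      ∃ h ∈ H, ∃ k, ∃ j : ℤ, A = h * cosetRep_eight k * T ^ j := by
    simp only [Set.insert_subset_iff, Set.singleton_subset_iff, SetLike.mem_coe] at sub
    obtain ⟨hneg, hT, h₁, h₂, h₃⟩ := sub
    exact decomposition_eight hneg hT h₁ h₂ h₃ A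
  have sub : {-1, T, ofEntries (-3) 2 (-8) 5 (by norm_num),
      ofEntries (-3) 1 (-16) 5 (by norm_num),
      ofEntries (-7) 8 (-8) 9 (by norm_num)} ⊆
        ((Gamma0 8 : Subgroup SL(2, ℤ)) : Set SL(2, ℤ)) := by
    simp only [Set.insert_subset_iff, Set.singleton_subset_iff, SetLike.mem_coe]
    decide
  refine CuspData.of_matrices (by decide) (by decide) (Gamma0_is_congruence 8)
    (eq_closure_of_decomposition sub (by simp) rfl (by decide) (hdec Subgroup.subset_closure))
    (by decide) (by decide) (by decide) (by decide) (by decide) (by decide) (by decide) (hdec sub)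
    ?_ (fun γ hγ γ' hγ' ↦ chi_four_mul (by norm_num) hγ) ?_ ?_ ?_ ?_ ?_
  · intro k
    fin_cases k
    exacts [exists_cusp 1 (by decide) (Or.inl rfl) (by decide),
        exists_cusp 1 (by decide) (Or.inr (Or.inl rfl)) (by decide),
        exists_cusp 1 (by decide) (Or.inr (Or.inr (Or.inl rfl))) (by decide),
        exists_cusp (-1) (by decide) (Or.inr (Or.inr (Or.inr rfl))) (by decide)]
  all_goals decide

lemma cuspData_caseNeg9 : CuspData (Gamma0 9) Sporadic.caseNeg9.chi₁Value
    (realOf !![0, -1; 9, 0] (by decide)) (realOf !![-3, -2; 9, 3] (by decide))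
    (ofEntries 1 0 (-9) 1 (by norm_num))
    (ofEntries 4 1 (-9) (-2) (by norm_num))
    (ofEntries (-2) 1 (-9) 4 (by norm_num))
    (ofEntries 5 (-1) (-9) 2 (by norm_num)) := by
  have hdec {H : Subgroup SL(2, ℤ)} (sub : {-1, T, ofEntries 1 0 (-9) 1 (by norm_num),
      ofEntries 4 1 (-9) (-2) (by norm_num),
      ofEntries (-2) 1 (-9) 4 (by norm_num)} ⊆ (H : Set SL(2, ℤ))) (A : SL(2, ℤ)) :
      ∃ h ∈ H, ∃ k, ∃ j : ℤ, A = h * cosetRep_nine k * T ^ j := by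
    simp only [Set.insert_subset_iff, Set.singleton_subset_iff, SetLike.mem_coe] at sub
    obtain ⟨hneg, hT, h₁, h₂, h₃⟩ := sub
    exact decomposition_nine hneg hT h₁ h₂ h₃ A
  have sub : {-1, T, ofEntries 1 0 (-9) 1 (by norm_num),
      ofEntries 4 1 (-9) (-2) (by norm_num),
      ofEntries (-2) 1 (-9) 4 (by norm_num)} ⊆
        ((Gamma0 9 : Subgroup SL(2, ℤ)) : Set SL(2, ℤ)) := by
    simp only [Set.insert_subset_iff, Set.singleton_subset_iff, SetLike.mem_coe]
    decide
  refine CuspData.of_matrices (by decide) (by decide) (Gamma0_is_congruence 9)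
    (eq_closure_of_decomposition sub (by simp) rfl (by decide) (hdec Subgroup.subset_closure))
    (by decide) (by decide) (by decide) (by decide) (by decide) (by decide) (by decide) (hdec sub)
    ?_ (fun γ hγ γ' hγ' ↦ jacobiSym_three_mul (by norm_num) hγ) ?_ ?_ ?_ ?_ ?_
  · intro k
    fin_cases k
    exacts [exists_cusp 1 (by decide) (Or.inl rfl) (by decide),
        exists_cusp 1 (by decide) (Or.inr (Or.inl rfl)) (by decide),
        exists_cusp (-1) (by decide) (Or.inr (Or.inr (Or.inl rfl))) (by decide),
        exists_cusp (-1) (by decide) (Or.inr (Or.inr (Or.inr rfl))) (by decide)]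
  · change jacobiSym (-1) 3 = -1
    norm_num
  · change jacobiSym 1 3 = 1
    norm_num
  · change jacobiSym 1 3 = 1
    norm_num
  · change jacobiSym (-2) 3 = 1
    norm_num
  · change jacobiSym 4 3 = 1
    norm_num

lemma cuspData_case11 : CuspData (pmGamma1 5) Sporadic.case11.chi₁Value
    (realOf !![2, -1; 5, -2] (by decide)) (realOf !![0, -1; 5, 0] (by decide))
    (ofEntries (-9) 4 (-25) 11 (by norm_num))
    (ofEntries 1 0 (-5) 1 (by norm_num))
    (ofEntries (-9) 5 (-20) 11 (by norm_num))
    (ofEntries 9 (-4) (-20) 9 (by norm_num)) := by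
  have hdec {H : Subgroup SL(2, ℤ)} (sub : {-1, T, ofEntries (-9) 4 (-25) 11 (by norm_num),
      ofEntries 1 0 (-5) 1 (by norm_num),
      ofEntries (-9) 5 (-20) 11 (by norm_num)} ⊆ (H : Set SL(2, ℤ))) (A : SL(2, ℤ)) :
      ∃ h ∈ H, ∃ k, ∃ j : ℤ, A = h * cosetRep_five k * T ^ j := by
    simp only [Set.insert_subset_iff, Set.singleton_subset_iff, SetLike.mem_coe] at sub
    obtain ⟨hneg, hT, h₁, h₂, h₃⟩ := sub
    exact decomposition_five hneg hT h₁ h₂ h₃ A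
  have sub : {-1, T, ofEntries (-9) 4 (-25) 11 (by norm_num),
      ofEntries 1 0 (-5) 1 (by norm_num),
      ofEntries (-9) 5 (-20) 11 (by norm_num)} ⊆
        ((pmGamma1 5 : Subgroup SL(2, ℤ)) : Set SL(2, ℤ)) := by
    simp only [Set.insert_subset_iff, Set.singleton_subset_iff, SetLike.mem_coe]
    decide
  refine CuspData.of_matrices (by decide) (by decide) pmGamma1_five_congruence
    (eq_closure_of_decomposition sub (by simp) rfl (by decide) (hdec Subgroup.subset_closure))
    (by decide) (by decide) (by decide) (by decide) (by decide) (by decide) (by decide) (hdec sub)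
    ?_ (fun γ hγ γ' hγ' ↦ pmGamma1_five_chi_mul hγ hγ') ?_ ?_ ?_ ?_ ?_
  · intro k
    fin_cases k
    exacts [exists_cusp 1 (by decide) (Or.inl rfl) (by decide),
        exists_cusp 1 (by decide) (Or.inr (Or.inl rfl)) (by decide),
        exists_cusp 1 (by decide) (Or.inr (Or.inr (Or.inl rfl))) (by decide),
        exists_cusp (-1) (by decide) (Or.inr (Or.inr (Or.inr rfl))) (by decide)]
  all_goals decide

end Bimodular

namespace Bimodular

open ModularGroup

set_option maxRecDepth 4000

/-! ### The tabulated matrices -/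

lemma exists_eq_intToReal_mul {Γ : Subgroup SL(2, ℤ)} {g s : SL(2, ℝ)}
    {M P : Matrix (Fin 2) (Fin 2) ℤ} (hg : Rep g M) (hs : Rep s P) (a b c d : ℤ)
    (h : a * d - b * c = 1) (hmem : ofEntries a b c d h ∈ Γ) (k : ℤ) (hk : 0 < k)
    (hM : k • M = !![a, b; c, d] * P) : ∃ γ ∈ Γ, g = intToReal γ * s :=
  ⟨_, hmem, hg.eq_of_smul ((Rep.intCast _).mul hs) k 1 hk one_pos (by rw [hM, one_smul])⟩

lemma ofEntries_mem_Gamma0 {N : ℕ} {a b c d : ℤ} (h : a * d - b * c = 1) (hc : (N : ℤ) ∣ c) :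
    ofEntries a b c d h ∈ Gamma0 N := by
  rw [Gamma0_mem, ZMod.intCast_zmod_eq_zero_iff_dvd]
  exact hc

lemma det_atkinLehner {N m a b c d : ℤ} (hm : m ≠ 0)
    (h : (!![m * a, b; N * m * c, m * d] : Matrix (Fin 2) (Fin 2) ℤ).det = m) :
    m * a * d - N * b * c = 1 := by
  rw [Matrix.det_fin_two_of] at h
  apply mul_left_cancel₀ hm
  linear_combination h

lemma represented_atkinLehner {N m : ℤ} (hm : m ≠ 0) {g : SL(2, ℝ)}
    (hg : g ∈ represented (atkinLehner (N * m) m)) : ∃ a b c d : ℤ,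
    Rep g !![m * a, b; N * m * c, m * d] ∧ m * a * d - N * b * c = 1 := by
  obtain ⟨M, ⟨a, b, c, d, rfl, hdet⟩, hg⟩ := hg
  exact ⟨a, b, c, d, hg, det_atkinLehner hm hdet⟩

lemma atkinLehner_six_two {g : SL(2, ℝ)} (hg : g ∈ represented (atkinLehner 6 2)) :
    ∃ γ ∈ Gamma0 6, g = intToReal γ * realOf !![2, -1; 6, -2] (by decide) := by
  obtain ⟨a, b, c, d, h, hd⟩ := represented_atkinLehner (N := 3) (m := 2) (by norm_num) hg
  have hd' : (-2 * a - 3 * b) * (3 * c + 2 * d) - (a + b) * (-6 * c - 6 * d) = 1 := by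
    linear_combination hd
  refine exists_eq_intToReal_mul h (rep_realOf _ _) _ _ _ _ hd'
    (ofEntries_mem_Gamma0 _ ⟨-c - d, by push_cast; ring⟩) 1 one_pos ?_
  simp only [Matrix.mul_fin_two, one_smul]
  congr! 3 <;> ring_nf

lemma atkinLehner_six_three {g : SL(2, ℝ)} (hg : g ∈ represented (atkinLehner 6 3)) :
    ∃ γ ∈ Gamma0 6, g = intToReal γ * realOf !![3, -2; 6, -3] (by decide) := by
  obtain ⟨a, b, c, d, h, hd⟩ := represented_atkinLehner (N := 2) (m := 3) (by norm_num) hg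
  have hd' : (-3 * a - 2 * b) * (4 * c + 3 * d) - (2 * a + b) * (-6 * c - 6 * d) = 1 := by
    linear_combination hd
  refine exists_eq_intToReal_mul h (rep_realOf _ _) _ _ _ _ hd'
    (ofEntries_mem_Gamma0 _ ⟨-c - d, by push_cast; ring⟩) 1 one_pos ?_
  simp only [Matrix.mul_fin_two, one_smul]
  congr! 3 <;> ring_nf

lemma atkinLehner_six_three_eq_mul {g : SL(2, ℝ)} (hg : g ∈ represented (atkinLehner 6 3)) :
    ∃ γ ∈ Gamma0 6, g = intToReal γ *
      (realOf !![0, -1; 6, 0] (by decide) * realOf !![2, -1; 6, -2] (by decide)) := by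
  obtain ⟨a, b, c, d, h, hd⟩ := represented_atkinLehner (N := 2) (m := 3) (by norm_num) hg
  have hd' : (-3 * a - 2 * b) * (-2 * c - 3 * d) - (-a - b) * (-6 * c - 6 * d) = 1 := by
    linear_combination hd
  refine exists_eq_intToReal_mul h ((rep_realOf _ _).mul (rep_realOf _ _)) _ _ _ _ hd'
    (ofEntries_mem_Gamma0 _ ⟨-c - d, by push_cast; ring⟩) 2 two_pos ?_
  simp only [Matrix.mul_fin_two, Matrix.smul_of, Matrix.smul_cons, smul_eq_mul, Matrix.smul_empty]
  congr! 3 <;> ring_nf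

/-- For the Fricke involution, `m = N`. -/
lemma atkinLehner_fricke {N : ℕ} (hN : 0 < N) (hM : 0 < (!![0, -1; (N : ℤ), 0]).det) {g : SL(2, ℝ)}
    (hg : g ∈ represented (atkinLehner N N)) :
    ∃ γ ∈ Gamma0 N, g = intToReal γ * realOf !![0, -1; (N : ℤ), 0] hM := by
  rw [← one_mul (N : ℤ), show atkinLehner (1 * N) (1 * N) = atkinLehner (1 * N) N by
    rw [one_mul]] at hg
  obtain ⟨a, b, c, d, h, hd⟩ := represented_atkinLehner (by exact_mod_cast hN.ne') hg
  have hd' : -b * c - a * (-N * d) = 1 := by linear_combination hd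
  refine exists_eq_intToReal_mul h (rep_realOf _ _) _ _ _ _ hd'
    (ofEntries_mem_Gamma0 _ ⟨-d, by ring⟩) 1 one_pos ?_
  simp only [Matrix.mul_fin_two, one_smul]
  congr! 3 <;> ring_nf

lemma atkinLehner_eight_eight {g : SL(2, ℝ)} (hg : g ∈ represented (atkinLehner 8 8)) :
    ∃ γ ∈ Gamma0 8, g = intToReal γ *
      (realOf !![4, -3; 8, -4] (by decide) * realOf !![2, -1; 8, -2] (by decide)) := by
  obtain ⟨a, b, c, d, h, hd⟩ := represented_atkinLehner (N := 1) (m := 8) (by norm_num) hg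
  have hd' : b * (-c - 8 * d) - (-a - b) * (8 * d) = 1 := by
    linear_combination hd
  refine exists_eq_intToReal_mul h ((rep_realOf _ _).mul (rep_realOf _ _)) _ _ _ _ hd'
    (ofEntries_mem_Gamma0 _ ⟨d, by push_cast; ring⟩) 2 two_pos ?_
  simp only [Matrix.mul_fin_two, Matrix.smul_of, Matrix.smul_cons, smul_eq_mul, Matrix.smul_empty]
  congr! 3 <;> ring_nf

lemma exists_rep_singleton {Γ : Subgroup SL(2, ℤ)} {M P : Matrix (Fin 2) (Fin 2) ℤ} (hP : 0 < P.det)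
    (γ : SL(2, ℤ)) (hγ : γ ∈ Γ) (hM : M = γ.1 * P) {g : SL(2, ℝ)} (hg : g ∈ represented {M}) :
    ∃ γ ∈ Γ, g = intToReal γ * realOf P hP := by
  obtain ⟨_, rfl, hg⟩ := hg
  exact ⟨γ, hγ, Rep.eq hg ((Rep.intCast _).mul (rep_realOf _ _)) hM⟩

lemma realOf_mem_represented {S : Set (Matrix (Fin 2) (Fin 2) ℤ)} {M : Matrix (Fin 2) (Fin 2) ℤ}
    (hM : 0 < M.det) (h : M ∈ S) : realOf M hM ∈ represented S :=
  ⟨M, h, rep_realOf M hM⟩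

lemma represented_nonempty {S : Set (Matrix (Fin 2) (Fin 2) ℤ)} (M : Matrix (Fin 2) (Fin 2) ℤ)
    (hM : 0 < M.det) (h : M ∈ S) : (represented S).Nonempty :=
  ⟨_, realOf_mem_represented hM h⟩

lemma represented_mono {S S' : Set (Matrix (Fin 2) (Fin 2) ℤ)} (h : S ⊆ S') :
    represented S ⊆ represented S' := fun _ ⟨M, hM, hg⟩ ↦ ⟨M, h hM, hg⟩

lemma represented_subset_adjoin {Γ : Subgroup SL(2, ℤ)} {S S' : Set (Matrix (Fin 2) (Fin 2) ℤ)}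
    (h : S ⊆ S') : represented S ⊆ adjoin Γ S' :=
  (represented_mono h).trans (Set.subset_union_right.trans Subgroup.subset_closure)

lemma toReal_le_adjoin (Γ : Subgroup SL(2, ℤ)) (S : Set (Matrix (Fin 2) (Fin 2) ℤ)) :
    toReal Γ ≤ adjoin Γ S :=
  fun _ h ↦ Subgroup.subset_closure (Or.inl h)

lemma intToReal_mem_toReal {Γ : Subgroup SL(2, ℤ)} {γ : SL(2, ℤ)} (h : γ ∈ Γ) :
    intToReal γ ∈ toReal Γ := ⟨γ, h, rfl⟩

/-- The group `G` is generated by `Γ`, `s₁` and `s₂` if each of its generators is a product of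
these. -/
lemma adjoin_le_closure {Γ Γ' : Subgroup SL(2, ℤ)} {S : Set (Matrix (Fin 2) (Fin 2) ℤ)}
    {s₁ s₂ : SL(2, ℝ)}
    (hΓ : ∀ γ ∈ Γ', ∃ γ' ∈ Γ, intToReal γ = intToReal γ' ∨ intToReal γ = intToReal γ' * s₁)
    (hS : ∀ g ∈ represented S, ∃ γ ∈ Γ, g = intToReal γ * s₁ ∨ g = intToReal γ * s₂ ∨
      g = intToReal γ * (s₁ * s₂)) :
    adjoin Γ' S ≤ Subgroup.closure ((toReal Γ : Set SL(2, ℝ)) ∪ {s₁, s₂}) := by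
  have m₁ : s₁ ∈ Subgroup.closure ((toReal Γ : Set SL(2, ℝ)) ∪ {s₁, s₂}) :=
    Subgroup.subset_closure (by simp)
  have m₂ : s₂ ∈ Subgroup.closure ((toReal Γ : Set SL(2, ℝ)) ∪ {s₁, s₂}) :=
    Subgroup.subset_closure (by simp)
  have m {γ : SL(2, ℤ)} (h : γ ∈ Γ) :
      intToReal γ ∈ Subgroup.closure ((toReal Γ : Set SL(2, ℝ)) ∪ {s₁, s₂}) :=
    Subgroup.subset_closure (Or.inl (intToReal_mem_toReal h))
  refine (Subgroup.closure_le _).mpr ?_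
  rintro g (⟨γ, hγ, rfl⟩ | hg)
  · obtain ⟨γ', hγ', h | h⟩ := hΓ γ hγ
    · exact h ▸ m hγ'
    · exact h ▸ mul_mem (m hγ') m₁
  · obtain ⟨γ, hγ, rfl | rfl | rfl⟩ := hS g hg
    · exact mul_mem (m hγ) m₁
    · exact mul_mem (m hγ) m₂
    · exact mul_mem (m hγ) (mul_mem m₁ m₂)

lemma represented_union {S S' : Set (Matrix (Fin 2) (Fin 2) ℤ)} {g : SL(2, ℝ)} :
    g ∈ represented (S ∪ S') ↔ g ∈ represented S ∨ g ∈ represented S' := by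
  simp only [mem_represented, Set.mem_union, or_and_right, exists_or]

lemma mem_six_two : !![2, -1; 6, -2] ∈ atkinLehner 6 2 :=
  ⟨1, -1, 1, -1, by decide, by decide⟩

lemma mem_six_three : !![3, -2; 6, -3] ∈ atkinLehner 6 3 :=
  ⟨1, -2, 1, -1, by decide, by decide⟩

lemma mem_fricke (N : ℤ) : !![0, -1; N, 0] ∈ atkinLehner N N :=
  ⟨0, -1, 1, 0, by simp, by simp⟩

/-! ### The group data of the six cases -/

lemma groupData_case7 : GroupData Sporadic.case7 (realOf !![2, -1; 6, -2] (by decide))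
    (realOf !![3, -2; 6, -3] (by decide)) where
  σ₁_nonempty := represented_nonempty _ (by decide) mem_six_two
  σ₁_eq _ hg := atkinLehner_six_two hg
  σ₂_nonempty := represented_nonempty _ (by decide) mem_six_three
  σ₂_eq _ hg := atkinLehner_six_three hg
  toReal_le := toReal_le_adjoin _ _
  s₁_mem := represented_subset_adjoin Set.subset_union_left (realOf_mem_represented _ mem_six_two)
  s₂_mem := represented_subset_adjoin Set.subset_union_right
    (realOf_mem_represented _ mem_six_three)
  le_closure := by
    refine adjoin_le_closure (fun γ hγ ↦ ⟨γ, hγ, Or.inl rfl⟩) fun g hg ↦ ?_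
    rcases represented_union.mp hg with h | h
    · obtain ⟨γ, hγ, h⟩ := atkinLehner_six_two h
      exact ⟨γ, hγ, Or.inl h⟩
    · obtain ⟨γ, hγ, h⟩ := atkinLehner_six_three h
      exact ⟨γ, hγ, Or.inr (Or.inl h)⟩
  table := by
    simp only [Sporadic.chi₂Table, List.forall_mem_cons, List.not_mem_nil, false_imp_iff,
      implies_true, and_true]
    refine ⟨⟨represented_nonempty _ (by decide) mem_six_two, fun g hg ↦ ?_⟩,
      represented_nonempty _ (by decide) mem_six_three, fun g hg ↦ ?_⟩
    · obtain ⟨γ, hγ, h⟩ := atkinLehner_six_two hg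
      exact ⟨γ, hγ, Or.inl h⟩
    · obtain ⟨γ, hγ, h⟩ := atkinLehner_six_three hg
      exact ⟨γ, hγ, Or.inr (Or.inl h)⟩

lemma groupData_case10 : GroupData Sporadic.case10 (realOf !![3, -2; 6, -3] (by decide))
    (realOf !![2, -1; 6, -2] (by decide)) where
  σ₁_nonempty := represented_nonempty _ (by decide) mem_six_three
  σ₁_eq _ hg := atkinLehner_six_three hg
  σ₂_nonempty := represented_nonempty _ (by decide) mem_six_two
  σ₂_eq _ hg := atkinLehner_six_two hg
  toReal_le := toReal_le_adjoin _ _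
  s₁_mem := represented_subset_adjoin Set.subset_union_right
    (realOf_mem_represented _ mem_six_three)
  s₂_mem := represented_subset_adjoin Set.subset_union_left (realOf_mem_represented _ mem_six_two)
  le_closure := by
    refine adjoin_le_closure (fun γ hγ ↦ ⟨γ, hγ, Or.inl rfl⟩) fun g hg ↦ ?_
    rcases represented_union.mp hg with h | h
    · obtain ⟨γ, hγ, h⟩ := atkinLehner_six_two h
      exact ⟨γ, hγ, Or.inr (Or.inl h)⟩
    · obtain ⟨γ, hγ, h⟩ := atkinLehner_six_three h
      exact ⟨γ, hγ, Or.inl h⟩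
  table := by
    simp only [Sporadic.chi₂Table, List.forall_mem_cons, List.not_mem_nil, false_imp_iff,
      implies_true, and_true]
    refine ⟨⟨represented_nonempty _ (by decide) mem_six_two, fun g hg ↦ ?_⟩,
      represented_nonempty _ (by decide) mem_six_three, fun g hg ↦ ?_⟩
    · obtain ⟨γ, hγ, h⟩ := atkinLehner_six_two hg
      exact ⟨γ, hγ, Or.inr (Or.inl h)⟩
    · obtain ⟨γ, hγ, h⟩ := atkinLehner_six_three hg
      exact ⟨γ, hγ, Or.inl h⟩

lemma groupData_caseNeg17 : GroupData Sporadic.caseNeg17 (realOf !![0, -1; 6, 0] (by decide))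
    (realOf !![2, -1; 6, -2] (by decide)) where
  σ₁_nonempty := represented_nonempty _ (by decide) (mem_fricke 6)
  σ₁_eq _ hg := atkinLehner_fricke (N := 6) (by norm_num) (by decide) hg
  σ₂_nonempty := represented_nonempty _ (by decide) mem_six_two
  σ₂_eq _ hg := atkinLehner_six_two hg
  toReal_le := toReal_le_adjoin _ _
  s₁_mem := by
    have h2 : realOf !![2, -1; 6, -2] (by decide) ∈ Sporadic.caseNeg17.G :=
      represented_subset_adjoin Set.subset_union_left (realOf_mem_represented _ mem_six_two)
    have hmem := realOf_mem_represented (by decide) mem_six_three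
    obtain ⟨γ, hγ, h⟩ := atkinLehner_six_three_eq_mul hmem
    have h3 : realOf !![3, -2; 6, -3] (by decide) ∈ Sporadic.caseNeg17.G :=
      represented_subset_adjoin Set.subset_union_right hmem
    rw [h, ← mul_assoc, Subgroup.mul_mem_cancel_right _ h2, Subgroup.mul_mem_cancel_left] at h3
    · exact h3
    · exact toReal_le_adjoin _ _ (intToReal_mem_toReal hγ)
  s₂_mem := represented_subset_adjoin Set.subset_union_left (realOf_mem_represented _ mem_six_two)
  le_closure := by
    refine adjoin_le_closure (fun γ hγ ↦ ⟨γ, hγ, Or.inl rfl⟩) fun g hg ↦ ?_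
    rcases represented_union.mp hg with h | h
    · obtain ⟨γ, hγ, h⟩ := atkinLehner_six_two h
      exact ⟨γ, hγ, Or.inr (Or.inl h)⟩
    · obtain ⟨γ, hγ, h⟩ := atkinLehner_six_three_eq_mul h
      exact ⟨γ, hγ, Or.inr (Or.inr h)⟩
  table := by
    simp only [Sporadic.chi₂Table, List.forall_mem_cons, List.not_mem_nil, false_imp_iff,
      implies_true, and_true]
    refine ⟨⟨represented_nonempty _ (by decide) mem_six_two, fun g hg ↦ ?_⟩,
      represented_nonempty _ (by decide) mem_six_three, fun g hg ↦ ?_⟩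
    · obtain ⟨γ, hγ, h⟩ := atkinLehner_six_two hg
      exact ⟨γ, hγ, Or.inr (Or.inl h)⟩
    · obtain ⟨γ, hγ, h⟩ := atkinLehner_six_three_eq_mul hg
      exact ⟨γ, hγ, Or.inr (Or.inr h)⟩

lemma eight_σ₁ {g : SL(2, ℝ)} (hg : g ∈ represented {!![4, 1; 8, 4]}) :
    ∃ γ ∈ Gamma0 8, g = intToReal γ * realOf !![4, -3; 8, -4] (by decide) :=
  exists_rep_singleton _ (ofEntries (-3) 2 (-8) 5 (by norm_num)) (by decide) (by decide) hg

lemma groupData_case12 : GroupData Sporadic.case12 (realOf !![4, -3; 8, -4] (by decide))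
    (realOf !![2, -1; 8, -2] (by decide)) := by
  have s₁_mem : realOf !![4, -3; 8, -4] (by decide) ∈ Sporadic.case12.G := by
    have hmem := realOf_mem_represented (by decide) (Set.mem_singleton !![4, 1; 8, 4])
    obtain ⟨γ, hγ, h⟩ := eight_σ₁ hmem
    have h1 : realOf !![4, 1; 8, 4] (by decide) ∈ Sporadic.case12.G :=
      represented_subset_adjoin Set.subset_union_left hmem
    rw [h, Subgroup.mul_mem_cancel_left] at h1
    · exact h1
    · exact toReal_le_adjoin _ _ (intToReal_mem_toReal hγ)
  refine { s₁_mem, σ₁_eq := fun _ hg ↦ eight_σ₁ hg, toReal_le := toReal_le_adjoin _ _,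
           σ₁_nonempty := represented_nonempty _ (by decide) rfl
           σ₂_nonempty := represented_nonempty _ (by decide) rfl
           σ₂_eq := fun _ hg ↦ exists_rep_singleton _ 1 (one_mem _) (by decide) hg
           s₂_mem := ?_, le_closure := ?_, table := ?_ }
  · have hmem := realOf_mem_represented (by decide) (mem_fricke 8)
    obtain ⟨γ, hγ, h⟩ := atkinLehner_eight_eight hmem
    have h1 : realOf !![0, -1; 8, 0] (by decide) ∈ Sporadic.case12.G :=
      represented_subset_adjoin Set.subset_union_right hmem
    rw [h, Subgroup.mul_mem_cancel_left, Subgroup.mul_mem_cancel_left _ s₁_mem] at h1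
    · exact h1
    · exact toReal_le_adjoin _ _ (intToReal_mem_toReal hγ)
  · refine adjoin_le_closure (fun γ hγ ↦ ⟨γ, hγ, Or.inl rfl⟩) fun g hg ↦ ?_
    rcases represented_union.mp hg with h | h
    · obtain ⟨γ, hγ, h⟩ := eight_σ₁ h
      exact ⟨γ, hγ, Or.inl h⟩
    · obtain ⟨γ, hγ, h⟩ := atkinLehner_eight_eight h
      exact ⟨γ, hγ, Or.inr (Or.inr h)⟩
  · simp only [Sporadic.chi₂Table, List.forall_mem_cons, List.not_mem_nil, false_imp_iff,
      implies_true, and_true]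
    refine ⟨⟨represented_nonempty _ (by decide) rfl, fun g hg ↦ ?_⟩,
      represented_nonempty _ (by decide) (mem_fricke 8), fun g hg ↦ ?_⟩
    · obtain ⟨γ, hγ, h⟩ := eight_σ₁ hg
      exact ⟨γ, hγ, Or.inl h⟩
    · obtain ⟨γ, hγ, h⟩ := atkinLehner_eight_eight hg
      exact ⟨γ, hγ, Or.inr (Or.inr h)⟩

lemma atkinLehner_nine_nine {g : SL(2, ℝ)} (hg : g ∈ represented (atkinLehner 9 9)) :
    ∃ γ ∈ Gamma0 9, g = intToReal γ * realOf !![0, -1; 9, 0] (by decide) :=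
  atkinLehner_fricke (N := 9) (by norm_num) (by decide) hg

lemma nine_σ₂ {g : SL(2, ℝ)} (hg : g ∈ represented {!![-3, -2; 9, 3]}) :
    ∃ γ ∈ Gamma0 9, g = intToReal γ * realOf !![-3, -2; 9, 3] (by decide) :=
  exists_rep_singleton _ 1 (one_mem _) (by decide) hg

lemma groupData_caseNeg9 : GroupData Sporadic.caseNeg9 (realOf !![0, -1; 9, 0] (by decide))
    (realOf !![-3, -2; 9, 3] (by decide)) where
  σ₁_nonempty := represented_nonempty _ (by decide) (mem_fricke 9)
  σ₁_eq _ hg := atkinLehner_nine_nine hg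
  σ₂_nonempty := represented_nonempty _ (by decide) rfl
  σ₂_eq _ hg := nine_σ₂ hg
  toReal_le := toReal_le_adjoin _ _
  s₁_mem := represented_subset_adjoin Set.subset_union_right
    (realOf_mem_represented _ (mem_fricke 9))
  s₂_mem := represented_subset_adjoin Set.subset_union_left (realOf_mem_represented _ rfl)
  le_closure := by
    refine adjoin_le_closure (fun γ hγ ↦ ⟨γ, hγ, Or.inl rfl⟩) fun g hg ↦ ?_
    rcases represented_union.mp hg with h | h
    · obtain ⟨γ, hγ, h⟩ := nine_σ₂ h
      exact ⟨γ, hγ, Or.inr (Or.inl h)⟩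
    · obtain ⟨γ, hγ, h⟩ := atkinLehner_nine_nine h
      exact ⟨γ, hγ, Or.inl h⟩
  table := by
    simp only [Sporadic.chi₂Table, List.forall_mem_cons, List.not_mem_nil, false_imp_iff,
      implies_true, and_true]
    refine ⟨⟨represented_nonempty _ (by decide) rfl, fun g hg ↦ ?_⟩,
      represented_nonempty _ (by decide) (mem_fricke 9), fun g hg ↦ ?_⟩
    · obtain ⟨γ, hγ, h⟩ := nine_σ₂ hg
      exact ⟨γ, hγ, Or.inr (Or.inl h)⟩
    · obtain ⟨γ, hγ, h⟩ := atkinLehner_nine_nine hg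
      exact ⟨γ, hγ, Or.inl h⟩

/-- `Γ₀(5)` is the union of `±Γ₁(5)` and its coset of the matrix `(2, -1; 5, -2)`. -/
lemma Gamma0_five_cases {γ : SL(2, ℤ)} (hγ : γ ∈ Gamma0 5) : ∃ γ' ∈ pmGamma1 5,
    intToReal γ = intToReal γ' ∨
      intToReal γ = intToReal γ' * realOf !![2, -1; 5, -2] (by decide) := by
  by_cases h : γ ∈ pmGamma1 5
  · exact ⟨γ, h, Or.inl rfl⟩
  refine ⟨γ * (ofEntries 2 (-1) 5 (-2) (by norm_num))⁻¹, ?_, Or.inr ?_⟩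
  · rw [mem_pmGamma1_five] at h ⊢
    rw [Gamma0_mem] at hγ
    have hdet : (γ 0 0 : ZMod 5) * (γ 1 1 : ZMod 5) - (γ 0 1 : ZMod 5) * (γ 1 0 : ZMod 5) = 1 := by
      have := Matrix.det_fin_two γ.1
      rw [γ.det_coe] at this
      exact_mod_cast (congrArg (Int.cast : ℤ → ZMod 5) this).symm
    rw [Matrix.SpecialLinearGroup.coe_mul, Matrix.SpecialLinearGroup.coe_inv,
      Matrix.adjugate_fin_two_of, Matrix.mul_apply, Matrix.mul_apply, Fin.sum_univ_two,
      Fin.sum_univ_two]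
    simp only [Matrix.of_apply, Matrix.cons_val', Matrix.cons_val_zero, Matrix.cons_val_one,
      Matrix.cons_val_fin_one]
    push_cast
    generalize (γ 0 0 : ZMod 5) = a at *
    generalize (γ 0 1 : ZMod 5) = b at *
    generalize (γ 1 0 : ZMod 5) = c at *
    generalize (γ 1 1 : ZMod 5) = d at *
    subst hγ
    revert a b d
    decide
  · have h1 : intToReal (ofEntries 2 (-1) 5 (-2) (by norm_num)) =
        realOf !![2, -1; 5, -2] (by decide) := Rep.eq (Rep.intCast _) (rep_realOf _ _) rfl
    rw [← h1, ← map_mul, inv_mul_cancel_right]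

lemma five_σ₁ {g : SL(2, ℝ)} (hg : g ∈ represented {!![2, -1; 5, -2]}) :
    ∃ γ ∈ pmGamma1 5, g = intToReal γ * realOf !![2, -1; 5, -2] (by decide) :=
  exists_rep_singleton _ 1 (one_mem _) (by decide) hg

lemma atkinLehner_five_five {g : SL(2, ℝ)} (hg : g ∈ represented (atkinLehner 5 5)) :
    ∃ γ ∈ pmGamma1 5, g = intToReal γ * realOf !![0, -1; 5, 0] (by decide) ∨
      g = intToReal γ *
        (realOf !![2, -1; 5, -2] (by decide) * realOf !![0, -1; 5, 0] (by decide)) := by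
  obtain ⟨γ, hγ, rfl⟩ := atkinLehner_fricke (N := 5) (by norm_num) (by decide) hg
  obtain ⟨γ', hγ', h | h⟩ := Gamma0_five_cases hγ
  · exact ⟨γ', hγ', Or.inl (by rw [h]; rfl)⟩
  · exact ⟨γ', hγ', Or.inr (by rw [h, mul_assoc]; rfl)⟩

lemma groupData_case11 : GroupData Sporadic.case11 (realOf !![2, -1; 5, -2] (by decide))
    (realOf !![0, -1; 5, 0] (by decide)) where
  σ₁_nonempty := represented_nonempty _ (by decide) rfl
  σ₁_eq _ hg := five_σ₁ hg
  σ₂_nonempty := represented_nonempty _ (by decide) rfl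
  σ₂_eq _ hg := exists_rep_singleton _ 1 (one_mem _) (by decide) hg
  toReal_le := by
    refine le_trans (Subgroup.map_mono fun γ hγ ↦ ?_) (toReal_le_adjoin _ _)
    rw [Gamma0_mem]
    exact (mem_pmGamma1_five.mp hγ).1
  s₁_mem := by
    have h1 : intToReal (ofEntries 2 (-1) 5 (-2) (by norm_num)) =
        realOf !![2, -1; 5, -2] (by decide) := Rep.eq (Rep.intCast _) (rep_realOf _ _) rfl
    rw [← h1]
    exact toReal_le_adjoin _ _ (intToReal_mem_toReal (by decide))
  s₂_mem := represented_subset_adjoin subset_rfl (realOf_mem_represented _ (mem_fricke 5))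
  le_closure := by
    refine adjoin_le_closure (fun γ hγ ↦ Gamma0_five_cases hγ) fun g hg ↦ ?_
    obtain ⟨γ, hγ, h⟩ := atkinLehner_five_five hg
    exact ⟨γ, hγ, Or.inr h⟩
  table := by
    simp only [Sporadic.chi₂Table, List.forall_mem_cons, List.not_mem_nil, false_imp_iff,
      implies_true, and_true]
    refine ⟨⟨represented_nonempty _ (by decide) rfl, fun g hg ↦ ?_⟩,
      represented_nonempty _ (by decide) (mem_fricke 5), fun g hg ↦ ?_⟩
    · obtain ⟨γ, hγ, h⟩ := five_σ₁ hg
      exact ⟨γ, hγ, Or.inl h⟩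
    · obtain ⟨γ, hγ, h | h⟩ := atkinLehner_five_five hg
      · exact ⟨γ, hγ, Or.inr (Or.inl h)⟩
      · exact ⟨γ, hγ, Or.inr (Or.inr h)⟩

end Bimodular

namespace Bimodular

open Filter Asymptotics Real

/-! ### The transformation of the eta function under `SL(2, ℤ)` -/

/-- The root of unity `exp(2πi / 24)`. -/
noncomputable def ζ₂₄ : ℂ := Complex.exp (2 * π * Complex.I / 24)

/-- The principal branch of the square root of `-i w`, for `w` in the upper half-plane. -/
noncomputable def rootI (w : ℂ) : ℂ := Complex.exp (Complex.log (-Complex.I * w) / 2)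

lemma ζ₂₄_ne_zero : ζ₂₄ ≠ 0 := Complex.exp_ne_zero _

lemma ζ₂₄_zpow (k : ℤ) : ζ₂₄ ^ k = Complex.exp (2 * π * Complex.I * k / 24) := by
  rw [ζ₂₄, ← Complex.exp_int_mul]
  ring_nf

lemma ζ₂₄_pow_six : ζ₂₄ ^ (6 : ℤ) = Complex.I := by
  rw [ζ₂₄_zpow]
  refine Eq.trans (congrArg _ ?_) Complex.exp_pi_div_two_mul_I
  push_cast
  ring

lemma ζ₂₄_pow_three : ζ₂₄ ^ (3 : ℤ) = Complex.exp (Complex.log Complex.I / 2) := by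
  rw [ζ₂₄_zpow, Complex.log_I]
  congr 1
  push_cast
  ring

lemma ζ₂₄_pow_neg_three : ζ₂₄ ^ (-3 : ℤ) = Complex.exp (Complex.log (-Complex.I) / 2) := by
  rw [ζ₂₄_zpow, Complex.log_neg_I]
  congr 1
  push_cast
  ring

lemma eta_add_int (z : ℂ) (k : ℤ) : ModularForm.eta (z + k) = ζ₂₄ ^ k * ModularForm.eta z := by
  have h1 (n : ℕ) : ModularForm.eta_q n (z + k) = ModularForm.eta_q n z := by
    rw [ModularForm.eta_q_eq_cexp, ModularForm.eta_q_eq_cexp, mul_add, Complex.exp_add]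
    have := Complex.exp_int_mul_two_pi_mul_I ((n + 1) * k)
    push_cast at this
    rw [show 2 * (π : ℂ) * Complex.I * (n + 1) * k = (n + 1) * k * (2 * π * Complex.I) by ring,
      this, mul_one]
  simp only [ModularForm.eta, h1]
  rw [← mul_assoc, ζ₂₄_zpow]
  congr 1
  simp only [Function.Periodic.qParam]
  rw [← Complex.exp_add]
  congr 1
  push_cast
  ring

lemma rootI_sq {w : ℂ} (hw : w ≠ 0) : rootI w ^ 2 = -Complex.I * w := by
  rw [rootI, ← Complex.exp_nat_mul]
  push_cast
  rw [mul_div_cancel₀ _ two_ne_zero, Complex.exp_log (by simpa using hw)]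

lemma arg_neg_I_mul {w : ℂ} (hw : 0 < w.im) : |(-Complex.I * w).arg| < π / 2 := by
  rw [Complex.abs_arg_lt_pi_div_two_iff]
  left
  simpa using hw

lemma im_ne_zero_of_pos {w : ℂ} (hw : 0 < w.im) : w ≠ 0 := by
  rintro rfl
  simp at hw

/-- The square root of `w` itself, in terms of that of `-i w`. -/
lemma exp_log_div_two {w : ℂ} (hw : 0 < w.im) :
    Complex.exp (Complex.log w / 2) = ζ₂₄ ^ (3 : ℤ) * rootI w := by
  have h := abs_lt.mp (arg_neg_I_mul hw)
  have h0 := im_ne_zero_of_pos hw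
  have h1 : Complex.log w = Complex.log Complex.I + Complex.log (-Complex.I * w) := by
    rw [← Complex.log_mul_eq_add_log_iff Complex.I_ne_zero (by simpa using h0) |>.mpr]
    · rw [← mul_assoc, mul_neg, Complex.I_mul_I, neg_neg, one_mul]
    · rw [Complex.arg_I]
      constructor <;> linarith [Real.pi_pos]
  rw [h1, add_div, Complex.exp_add, ζ₂₄_pow_three, rootI]

/-- The square root of `-w`, in terms of that of `-i w`. -/
lemma exp_log_neg_div_two {w : ℂ} (hw : 0 < w.im) :
    Complex.exp (Complex.log (-w) / 2) = ζ₂₄ ^ (-3 : ℤ) * rootI w := by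
  have h := abs_lt.mp (arg_neg_I_mul hw)
  have h0 := im_ne_zero_of_pos hw
  have h1 : Complex.log (-w) = Complex.log (-Complex.I) + Complex.log (-Complex.I * w) := by
    rw [← Complex.log_mul_eq_add_log_iff (by simp) (by simpa using h0) |>.mpr]
    · rw [← mul_assoc, neg_mul_neg, Complex.I_mul_I, neg_one_mul]
    · rw [Complex.arg_neg_I]
      constructor <;> linarith [Real.pi_pos]
  rw [h1, add_div, Complex.exp_add, ζ₂₄_pow_neg_three, rootI]

lemma rootI_mul {w w' : ℂ} (hw : 0 < w.im) (hw' : 0 < w'.im) :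
    rootI w * rootI w' = Complex.exp (Complex.log (-(w * w')) / 2) := by
  have h := abs_lt.mp (arg_neg_I_mul hw)
  have h' := abs_lt.mp (arg_neg_I_mul hw')
  have h0 := im_ne_zero_of_pos hw
  have h0' := im_ne_zero_of_pos hw'
  have h1 : -(w * w') = (-Complex.I * w) * (-Complex.I * w') := by
    linear_combination (-(w * w')) * Complex.I_mul_I
  rw [h1, Complex.log_mul_eq_add_log_iff (by simpa using h0) (by simpa using h0') |>.mpr, add_div,
    Complex.exp_add, rootI, rootI]
  constructor <;> linarith

lemma rootI_sq_mul {x : ℝ} (hx : 0 < x) {w : ℂ} (hw : w ≠ 0) :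
    rootI ((x : ℂ) ^ 2 * w) = x * rootI w := by
  have h1 : -Complex.I * ((x : ℂ) ^ 2 * w) = ((x ^ 2 : ℝ) : ℂ) * (-Complex.I * w) := by
    push_cast
    ring
  have h2 : ((x : ℝ) : ℂ) = Complex.exp (Real.log x) := by
    rw [← Complex.ofReal_exp, Real.exp_log hx]
  rw [rootI, h1, Complex.log_ofReal_mul (by positivity) (by simpa using hw), Real.log_pow, add_div,
    Complex.exp_add, rootI, h2]
  congr 2
  push_cast
  ring

lemma inv_im_pos {w : ℂ} (hw : 0 < w.im) : 0 < (-1 / w).im := by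
  rw [neg_div, one_div, Complex.neg_im, Complex.inv_im, neg_div, neg_neg]
  exact div_pos hw (Complex.normSq_pos.mpr (im_ne_zero_of_pos hw))

lemma eta_neg_one_div {w : ℂ} (hw : 0 < w.im) :
    ModularForm.eta (-1 / w) = rootI w * ModularForm.eta w := by
  have h1 := ModularForm.eta_comp_eq_csqrt_I_inv hw
  simp only [Function.comp_apply, Pi.smul_apply, Pi.mul_apply, smul_eq_mul, Complex.sqrt] at h1
  rw [h1, Complex.cpow_def_of_ne_zero Complex.I_ne_zero,
    Complex.cpow_def_of_ne_zero (im_ne_zero_of_pos hw), ← div_eq_mul_inv, ← div_eq_mul_inv,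
    exp_log_div_two hw, ← ζ₂₄_pow_three]
  have h3 := zpow_ne_zero 3 ζ₂₄_ne_zero
  generalize ζ₂₄ ^ (3 : ℤ) = u at h3
  field_simp

lemma im_add_int_pos {z : ℂ} (hz : 0 < z.im) (d : ℤ) : 0 < (z + d).im := by simpa using hz

/-- The transformation of `η` under the matrix `(a, ad - 1; 1, d)`. -/
lemma eta_of_lower_one (a d : ℤ) {z : ℂ} (hz : 0 < z.im) :
    ModularForm.eta (a - 1 / (z + d)) = ζ₂₄ ^ (a + d) * rootI (z + d) * ModularForm.eta z := by
  rw [show a - 1 / (z + d) = -1 / (z + d) + a by ring, eta_add_int,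
    eta_neg_one_div (im_add_int_pos hz d), eta_add_int, zpow_add₀ ζ₂₄_ne_zero]
  ring

lemma eta_div_add_one (n : ℕ) {z : ℂ} (hz : 0 < z.im) (hn : 0 < n) :
    ModularForm.eta (1 / (n + 1 / z)) = ζ₂₄ ^ (3 - n : ℤ) * rootI (n * z + 1) *
      ModularForm.eta z := by
  have h0 := im_ne_zero_of_pos hz
  have h1 := inv_im_pos hz
  have h2 : 0 < (n * z + 1 : ℂ).im := by simpa using mul_pos (by exact_mod_cast hn) hz
  have h3 := im_add_int_pos h1 (-n)
  rw [show 1 / (n + 1 / z) = -1 / (-1 / z + ((-n : ℤ) : ℂ)) by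
    rw [← neg_div_neg_eq]; congr 1; push_cast; ring, eta_neg_one_div h3, eta_add_int,
    eta_neg_one_div hz]
  have h4 : rootI (-1 / z + ((-n : ℤ) : ℂ)) * rootI z = ζ₂₄ ^ (3 : ℤ) * rootI (n * z + 1) := by
    rw [rootI_mul h3 hz, ← exp_log_div_two h2]
    congr 3
    push_cast
    field_simp
    ring
  rw [sub_eq_add_neg, zpow_add₀ ζ₂₄_ne_zero]
  linear_combination (ζ₂₄ ^ (-n : ℤ) * ModularForm.eta z) * h4

lemma eta_neg_div_sub_one (n : ℕ) {z : ℂ} (hz : 0 < z.im) (hn : 0 < n) :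
    ModularForm.eta (-1 / (n - 1 / z)) = ζ₂₄ ^ (n - 3 : ℤ) * rootI (n * z - 1) *
      ModularForm.eta z := by
  have h0 := im_ne_zero_of_pos hz
  have h1 := inv_im_pos hz
  have h2 : 0 < (n * z - 1 : ℂ).im := by simpa using mul_pos (by exact_mod_cast hn) hz
  have h3 := im_add_int_pos h1 n
  rw [show -1 / (n - 1 / z) = -1 / (-1 / z + ((n : ℤ) : ℂ)) by
    congr 1; push_cast; ring, eta_neg_one_div h3, eta_add_int, eta_neg_one_div hz]
  have h4 : rootI (-1 / z + ((n : ℤ) : ℂ)) * rootI z = ζ₂₄ ^ (-3 : ℤ) * rootI (n * z - 1) := by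
    rw [rootI_mul h3 hz, ← exp_log_neg_div_two h2]
    congr 3
    push_cast
    field_simp
    ring
  rw [sub_eq_add_neg, zpow_add₀ ζ₂₄_ne_zero]
  linear_combination (ζ₂₄ ^ (n : ℤ) * ModularForm.eta z) * h4

/-- The transformation of `η` under matrices `(*, *; n, *)` whose first column is `(an + 1, n)`. -/
lemma eta_of_lower_pos (a d : ℤ) (n : ℕ) {z : ℂ} (hz : 0 < z.im) (hn : 0 < n) :
    ModularForm.eta (a + 1 / (n + 1 / (z + d))) =
      ζ₂₄ ^ (a + d + 3 - n) * rootI (n * (z + d) + 1) * ModularForm.eta z := by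
  rw [add_comm (a : ℂ), eta_add_int, eta_div_add_one n (im_add_int_pos hz d) hn, eta_add_int,
    show a + d + 3 - n = a + d + (3 - n) by ring, zpow_add₀ ζ₂₄_ne_zero, zpow_add₀ ζ₂₄_ne_zero]
  ring

/-- The transformation of `η` under matrices `(*, *; n, *)` whose first column is `(an - 1, n)`. -/
lemma eta_of_lower_neg (a d : ℤ) (n : ℕ) {z : ℂ} (hz : 0 < z.im) (hn : 0 < n) :
    ModularForm.eta (a - 1 / (n - 1 / (z + d))) =
      ζ₂₄ ^ (a + d + n - 3) * rootI (n * (z + d) - 1) * ModularForm.eta z := by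
  rw [show a - 1 / (n - 1 / (z + d)) = -1 / (n - 1 / (z + d)) + (a : ℂ) by ring, eta_add_int,
    eta_neg_div_sub_one n (im_add_int_pos hz d) hn, eta_add_int,
    show a + d + n - 3 = a + d + (n - 3) by ring, zpow_add₀ ζ₂₄_ne_zero, zpow_add₀ ζ₂₄_ne_zero]
  ring

/-! ### Eta quotients -/

/-- The eta quotient `∏ η(m(n) τ + b(n)) ^ r`, where `(n, r)` runs through the list `L`. -/
noncomputable def etaQuot (L : List (ℕ × ℤ)) (m : ℕ → ℕ) (b : ℕ → ℝ) (τ : ℍ) : ℂ :=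
  (L.map fun p ↦ ModularForm.eta ((m p.1 : ℂ) * τ + (b p.1 : ℂ)) ^ p.2).prod

/-- The weighted sum of the exponents, i.e. 24 times the order of the eta quotient at `i∞`. -/
def expSum (L : List (ℕ × ℤ)) (m : ℕ → ℕ) : ℤ := (L.map fun p ↦ (m p.1 : ℤ) * p.2).sum

variable {L : List (ℕ × ℤ)} {m : ℕ → ℕ} {b : ℕ → ℝ}

lemma im_linear_pos {k : ℕ} (hk : 0 < k) (x : ℝ) (τ : ℍ) : 0 < ((k : ℂ) * τ + (x : ℂ)).im := by
  simpa using mul_pos (by exact_mod_cast hk) τ.im_pos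

lemma etaQuot_ne_zero (hm : ∀ p ∈ L, 0 < m p.1) (τ : ℍ) : etaQuot L m b τ ≠ 0 := by
  rw [etaQuot, Ne, List.prod_eq_zero_iff, List.mem_map]
  rintro ⟨p, hp, h⟩
  exact zpow_ne_zero _ (ModularForm.eta_ne_zero (im_linear_pos (hm p hp) _ τ)) h

lemma mdifferentiable_etaQuot (hm : ∀ p ∈ L, 0 < m p.1) :
    MDifferentiable 𝓘(ℂ) 𝓘(ℂ) (etaQuot L m b) := by
  rw [UpperHalfPlane.mdifferentiable_iff]
  induction L with
  | nil => exact (differentiableOn_const 1).congr fun z _ ↦ by simp [etaQuot]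
  | cons p L ih =>
    have h1 : DifferentiableOn ℂ
        (fun z ↦ ModularForm.eta ((m p.1 : ℂ) * z + (b p.1 : ℂ)) ^ p.2) {z | 0 < z.im} := by
      intro z hz
      have hpos := im_linear_pos (hm p (by simp)) (b p.1) ⟨z, hz⟩
      refine ((DifferentiableAt.comp z
        (ModularForm.differentiableAt_eta_of_mem_upperHalfPlaneSet hpos) (by fun_prop)).zpow
        (Or.inl (ModularForm.eta_ne_zero hpos))).differentiableWithinAt
    refine (h1.mul (ih fun p hp ↦ hm p (by simp [hp]))).congr fun z hz ↦ ?_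
    simp [etaQuot, ofComplex_apply_of_im_pos hz]

lemma tendsto_eta_tprod {k : ℕ} (hk : 0 < k) (x : ℝ) :
    Tendsto (fun τ : ℍ ↦ ∏' n, (1 - ModularForm.eta_q n ((k : ℂ) * τ + (x : ℂ)))) atImInfty
      (𝓝 1) := by
  have htprod : Tendsto (fun q : ℂ ↦ ∏' (n : ℕ), (1 - q ^ (n + 1))) (𝓝 0) (𝓝 1) := by
    have h1 := (ModularForm.differentiableOn_tprod_one_sub_pow.differentiableAt
      (Metric.ball_mem_nhds (0 : ℂ) one_pos)).continuousAt.tendsto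
    simpa using h1
  have hq : Tendsto (fun τ : ℍ ↦ Function.Periodic.qParam 1 ((k : ℂ) * τ + (x : ℂ))) atImInfty
      (𝓝 0) := by
    rw [tendsto_zero_iff_norm_tendsto_zero]
    have h2 (τ : ℍ) : ‖Function.Periodic.qParam 1 ((k : ℂ) * τ + (x : ℂ))‖ =
        Real.exp (-(2 * π * k) * τ.im) := by
      rw [Function.Periodic.norm_qParam]
      congr 1
      simp
      ring
    simp only [h2]
    refine Real.tendsto_exp_atBot.comp ?_
    refine Tendsto.const_mul_atTop_of_neg ?_ tendsto_comap
    nlinarith [mul_pos Real.pi_pos (show (0 : ℝ) < k by exact_mod_cast hk)]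
  exact htprod.comp hq

/-- The leading term of an eta quotient at `i∞`. -/
lemma etaQuot_eq (hm : ∀ p ∈ L, 0 < m p.1) : ∃ P : ℍ → ℂ, Tendsto P atImInfty (𝓝 1) ∧
    ∀ τ, etaQuot L m b τ = Complex.exp (2 * π * Complex.I / 24 *
      (expSum L m * τ + ((L.map fun p ↦ b p.1 * p.2).sum : ℝ))) * P τ := by
  induction L with
  | nil => exact ⟨fun _ ↦ 1, tendsto_const_nhds, fun τ ↦ by simp [etaQuot, expSum]⟩
  | cons p L ih =>
    obtain ⟨P, hP, h⟩ := ih fun p hp ↦ hm p (by simp [hp])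
    have h1 := ((tendsto_eta_tprod (hm p (by simp)) (b p.1)).zpow₀ p.2 (Or.inl one_ne_zero)).mul hP
    rw [one_zpow, one_mul] at h1
    refine ⟨_, h1, fun τ ↦ ?_⟩
    have h2 : etaQuot (p :: L) m b τ =
        ModularForm.eta ((m p.1 : ℂ) * τ + (b p.1 : ℂ)) ^ p.2 * etaQuot L m b τ := by
      simp [etaQuot]
    rw [h2, h, ModularForm.eta, mul_zpow, Function.Periodic.qParam, ← Complex.exp_int_mul,
      mul_mul_mul_comm, ← Complex.exp_add]
    congr 2
    simp only [expSum, List.map_cons, List.sum_cons]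
    push_cast
    ring

lemma coe_T_smul (τ : ℍ) : ((intToReal ModularGroup.T • τ : ℍ) : ℂ) = τ + 1 := by
  rw [intToReal_smul, modular_T_smul, coe_vadd]
  push_cast
  ring

lemma slashEq_T_iff {φ : ℍ → ℂ} :
    SlashEq φ (intToReal ModularGroup.T) φ ↔ ∀ τ, φ (intToReal ModularGroup.T • τ) = φ τ := by
  simp only [SlashEq, autFactor_intToReal]
  simp [ModularGroup.T]

lemma etaQuot_T {k : ℤ} (h : expSum L m = 24 * k) :
    SlashEq (etaQuot L m b) (intToReal ModularGroup.T) (etaQuot L m b) := by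
  have key (τ : ℍ) : etaQuot L m b (intToReal ModularGroup.T • τ) =
      ζ₂₄ ^ expSum L m * etaQuot L m b τ := by
    clear h
    induction L with
    | nil => simp [etaQuot, expSum]
    | cons p L ih =>
      have h2 (τ : ℍ) : etaQuot (p :: L) m b τ =
          ModularForm.eta ((m p.1 : ℂ) * τ + (b p.1 : ℂ)) ^ p.2 * etaQuot L m b τ := by
        simp [etaQuot]
      have h3 : expSum (p :: L) m = m p.1 * p.2 + expSum L m := by simp [expSum]
      rw [h2, h2, ih, coe_T_smul, h3, zpow_add₀ ζ₂₄_ne_zero, zpow_mul,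
        show (m p.1 : ℂ) * (τ + 1) + (b p.1 : ℂ) =
          (m p.1 : ℂ) * τ + (b p.1 : ℂ) + ((m p.1 : ℤ) : ℂ) by push_cast; ring,
        eta_add_int, mul_zpow]
      ring
  rw [slashEq_T_iff]
  intro τ
  rw [key, h, ζ₂₄_zpow]
  have := Complex.exp_int_mul_two_pi_mul_I k
  rw [show 2 * π * Complex.I * ((24 * k : ℤ) : ℂ) / 24 = k * (2 * π * Complex.I) by
    push_cast; ring, this, one_mul]

lemma tendsto_etaQuot (hm : ∀ p ∈ L, 0 < m p.1) (h : expSum L m = 0) {k : ℤ}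
    (hb : (L.map fun p ↦ b p.1 * p.2).sum = k) :
    Tendsto (etaQuot L m b) atImInfty (𝓝 (ζ₂₄ ^ k)) := by
  obtain ⟨P, hP, h1⟩ := etaQuot_eq (b := b) hm
  have h2 : etaQuot L m b = fun τ ↦ ζ₂₄ ^ k * P τ := by
    ext τ
    rw [h1, h, hb, ζ₂₄_zpow]
    congr 2
    push_cast
    ring
  rw [h2]
  simpa using hP.const_mul (ζ₂₄ ^ k)

/-- The transformation behaviour of the functions `η(n τ)` under an element `s` that is represented
by a matrix of determinant `D`: `η(n sτ) = ζ₂₄ ^ k(n) √(√D / q(n)) √(-i J) η(m(n) τ + b(n))`, where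
`J` is the automorphy factor. -/
def EtaAction (s : SL(2, ℝ)) (D : ℝ) (k : ℕ → ℤ) (q m : ℕ → ℕ) (b : ℕ → ℝ) (n : ℕ) : Prop :=
  0 < q n ∧ 0 < m n ∧ ∀ τ : ℍ, ModularForm.eta ((n : ℂ) * (s • τ : ℍ)) =
    ζ₂₄ ^ k n * √(√D / q n) * rootI (autFactor s τ) *
      ModularForm.eta ((m n : ℂ) * τ + (b n : ℂ))

/-- The product of the constants in `EtaAction`. -/
noncomputable def qProd (L : List (ℕ × ℤ)) (q : ℕ → ℕ) : ℝ :=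
  (L.map fun p ↦ (q p.1 : ℝ) ^ p.2).prod

lemma qProd_pos {q : ℕ → ℕ} (h : ∀ p ∈ L, 0 < q p.1) : 0 < qProd L q := by
  refine List.prod_pos fun x hx ↦ ?_
  obtain ⟨p, hp, rfl⟩ := List.mem_map.mp hx
  exact zpow_pos (by exact_mod_cast h p hp) _

lemma etaQuot_slash {s : SL(2, ℝ)} {D : ℝ} (hD : 0 < D) {k : ℕ → ℤ} {q : ℕ → ℕ}
    (h : ∀ p ∈ L, EtaAction s D k q m b p.1) (hL : (L.map Prod.snd).sum = 2) :
    SlashEq (etaQuot L id 0) s ((ζ₂₄ ^ ((L.map fun p ↦ k p.1 * p.2).sum - 6) *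
      (√(D / qProd L q) : ℝ)) • etaQuot L m b) := by
  have key (τ : ℍ) : etaQuot L id 0 (s • τ) = ζ₂₄ ^ (L.map fun p ↦ k p.1 * p.2).sum *
      (√(√D ^ (L.map Prod.snd).sum / qProd L q) : ℝ) *
      rootI (autFactor s τ) ^ (L.map Prod.snd).sum * etaQuot L m b τ := by
    clear hL
    have hr : rootI (autFactor s τ) ≠ 0 := Complex.exp_ne_zero _
    have hD' : √D ≠ 0 := (Real.sqrt_pos.mpr hD).ne'
    induction L with
    | nil => simp [etaQuot, qProd]
    | cons p L ih =>
      have h2 (m : ℕ → ℕ) (b : ℕ → ℝ) (τ : ℍ) : etaQuot (p :: L) m b τ =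
          ModularForm.eta ((m p.1 : ℂ) * τ + (b p.1 : ℂ)) ^ p.2 * etaQuot L m b τ := by
        simp [etaQuot]
      have h3 := (h p (by simp)).2.2 τ
      have h4 : qProd (p :: L) q = (q p.1 : ℝ) ^ p.2 * qProd L q := by simp [qProd]
      have h5 : √(√D ^ ((p :: L).map Prod.snd).sum / qProd (p :: L) q) =
          √(√D / q p.1) ^ p.2 * √(√D ^ (L.map Prod.snd).sum / qProd L q) := by
        have h6 : (0 : ℝ) ≤ √D / q p.1 := by positivity
        have h7 : √(√D / q p.1) ^ p.2 = √((√D / q p.1) ^ p.2) := by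
          rw [← Real.sqrt_sq (zpow_nonneg (Real.sqrt_nonneg _) p.2), ← zpow_natCast, ← zpow_mul,
            mul_comm, zpow_mul, zpow_natCast, Real.sq_sqrt h6]
        rw [h7, ← Real.sqrt_mul (zpow_nonneg h6 _), h4, List.map_cons, List.sum_cons,
          zpow_add₀ hD', div_zpow, mul_div_mul_comm]
      rw [h2, h2, ih fun p hp ↦ h p (by simp [hp]), h5]
      simp only [id_eq, Pi.zero_apply, Complex.ofReal_zero, add_zero, List.map_cons, List.sum_cons,
        zpow_add₀ ζ₂₄_ne_zero, zpow_add₀ hr, zpow_mul, h3, mul_zpow]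
      push_cast
      ring
  intro τ
  have h0 := autFactor_ne_zero s τ
  rw [key, hL, Pi.smul_apply, smul_eq_mul, zpow_ofNat, zpow_ofNat, rootI_sq h0,
    zpow_sub₀ ζ₂₄_ne_zero, ζ₂₄_pow_six, Complex.div_I, Real.sq_sqrt hD.le]
  ring

end Bimodular

namespace Bimodular

open Filter Asymptotics Real

/-! ### The analytic data of an eta quotient -/

lemma ζ₂₄_pow_twelve : ζ₂₄ ^ (12 : ℤ) = -1 := by
  rw [show (12 : ℤ) = 6 + 6 by norm_num, zpow_add₀ ζ₂₄_ne_zero, ζ₂₄_pow_six, Complex.I_mul_I]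

/-- The analytic data in the cases where `t` and `f` are eta quotients. The lists `Lt`, `Lf`, `Lg`
hold the exponents of `t`, `f` and `t f`; the numbers `Dᵢ`, `kᵢ`, `qᵢ`, `mᵢ`, `bᵢ` describe the
action of `sᵢ`. The multipliers `κ`, `l` and `l / α` are `ζ₂₄ ^ K √v` for `(K, v) = (K₁, v₁)`,
`(K₂, v₂)` and `(K₃, v₃)`. The eta quotients into which `s₂` takes `f` and `t f` have leading
coefficients `ζ₂₄ ^ Bf` and `ζ₂₄ ^ Bg`, and `s₁` takes `f` into `ζ₂₄ ^ c t f`, up to the constants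
in `EtaAction`. -/
theorem FormData.of_eta {α β : ℂ} {t f : ℍ → ℂ} {s₁ s₂ : SL(2, ℝ)}
    (Lt Lf Lg : List (ℕ × ℤ)) {D₁ D₂ : ℝ} {k₁ k₂ : ℕ → ℤ} {q₁ m₁ q₂ m₂ : ℕ → ℕ} {b₁ b₂ : ℕ → ℝ}
    (S₁ S₂ : List ℕ)
    (hα : α ≠ 0) (hβ : β ≠ 0)
    (ht : t = etaQuot Lt id 0) (hf : f = etaQuot Lf id 0) (hg : t * f = etaQuot Lg id 0)
    (pt : ∀ p ∈ Lt, 0 < p.1) (pf : ∀ p ∈ Lf, 0 < p.1)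
    (et : expSum Lt id = 24) (ef : expSum Lf id = 0) (eg : expSum Lg id = 24)
    (ef₂ : expSum Lf m₂ = 0) (eg₂ : expSum Lg m₂ = 0)
    (wf : (Lf.map Prod.snd).sum = 2) (wg : (Lg.map Prod.snd).sum = 2)
    (hD₁ : 0 < D₁) (hD₂ : 0 < D₂)
    (h₁ : ∀ n ∈ S₁, EtaAction s₁ D₁ k₁ q₁ m₁ b₁ n)
    (h₂ : ∀ n ∈ S₂, EtaAction s₂ D₂ k₂ q₂ m₂ b₂ n)
    (hf₁ : ∀ p ∈ Lf, p.1 ∈ S₁) (hf₂ : ∀ p ∈ Lf, p.1 ∈ S₂) (hg₂ : ∀ p ∈ Lg, p.1 ∈ S₂)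
    {c : ℤ} (hs₁ : etaQuot Lf m₁ b₁ = ζ₂₄ ^ c • etaQuot Lg id 0)
    {Bf Bg : ℤ} (hBf : (Lf.map fun p ↦ b₂ p.1 * p.2).sum = Bf)
    (hBg : (Lg.map fun p ↦ b₂ p.1 * p.2).sum = Bg)
    {K₁ K₂ K₃ : ℤ} (hK₁ : (Lf.map fun p ↦ k₁ p.1 * p.2).sum - 6 + c = K₁)
    (hK₂ : (Lf.map fun p ↦ k₂ p.1 * p.2).sum - 6 + Bf = K₂)
    (hK₃ : (Lg.map fun p ↦ k₂ p.1 * p.2).sum - 6 + Bg = K₃)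
    {v₁ v₂ v₃ : ℝ} (hv₁ : D₁ / qProd Lf q₁ = v₁) (hv₂ : D₂ / qProd Lf q₂ = v₂)
    (hv₃ : D₂ / qProd Lg q₂ = v₃)
    (κ_sq : (ζ₂₄ ^ K₁) ^ 2 * v₁ = -(α * β)) (l_sq : (ζ₂₄ ^ K₂) ^ 2 * v₂ * (β - α) = α)
    (l_div : ζ₂₄ ^ K₃ * (√v₃ : ℝ) = ζ₂₄ ^ K₂ * (√v₂ : ℝ) / α) :
    ∃ κ l φ₂ φ₃, FormData α β t f s₁ s₂ κ l φ₂ φ₃ := by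
  have sl₁ := etaQuot_slash hD₁ (fun p hp ↦ h₁ p.1 (hf₁ p hp)) wf
  have sl₂ := etaQuot_slash hD₂ (fun p hp ↦ h₂ p.1 (hf₂ p hp)) wf
  have sl₃ := etaQuot_slash hD₂ (fun p hp ↦ h₂ p.1 (hg₂ p hp)) wg
  have pf₂ : ∀ p ∈ Lf, 0 < m₂ p.1 := fun p hp ↦ (h₂ p.1 (hf₂ p hp)).2.1
  have pg₂ : ∀ p ∈ Lg, 0 < m₂ p.1 := fun p hp ↦ (h₂ p.1 (hg₂ p hp)).2.1
  have v₁_nonneg : 0 ≤ v₁ := by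
    rw [← hv₁]
    exact (div_pos hD₁ (qProd_pos fun p hp ↦ (h₁ p.1 (hf₁ p hp)).1)).le
  have v₂_nonneg : 0 ≤ v₂ := by
    rw [← hv₂]
    exact (div_pos hD₂ (qProd_pos fun p hp ↦ (h₂ p.1 (hf₂ p hp)).1)).le
  rw [hs₁, smul_smul, hv₁] at sl₁
  rw [hv₂] at sl₂
  rw [hv₃] at sl₃
  obtain ⟨P, hP, htP⟩ := etaQuot_eq (m := id) (b := 0) pt
  have norm_t (τ : ℍ) : ‖t τ‖ = Real.exp (-2 * π * τ.im) * ‖P τ‖ := by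
    rw [ht, htP, norm_mul, Complex.norm_exp, et]
    congr 2
    simp
    ring
  refine ⟨ζ₂₄ ^ K₁ * (√v₁ : ℝ), ζ₂₄ ^ K₂ * (√v₂ : ℝ), _, _,
    { α_ne := hα, β_ne := hβ, f_s₂ := hf ▸ sl₂, tf_s₂ := hg ▸ sl₃,
      t_holo := ?_, f_holo := ?_, t_ne := ?_, f_ne := ?_, f_T := ?_, tf_T := ?_,
      φ₂_T := ?_, φ₃_T := ?_, f_s₁ := ?_, t_lim := ?_, t_bound := ?_,
      f_lim := ?_, φ₂_lim := ?_, φ₃_lim := ?_,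
      κ_sq := ?_, l_sq := ?_ }⟩
  · rw [ht]
    exact mdifferentiable_etaQuot pt
  · rw [hf]
    exact mdifferentiable_etaQuot pf
  · rw [ht]
    exact etaQuot_ne_zero pt
  · rw [hf]
    exact etaQuot_ne_zero pf
  · rw [hf]
    exact etaQuot_T (k := 0) (by rw [ef, mul_zero])
  · rw [hg]
    exact etaQuot_T (k := 1) (by rw [eg, mul_one])
  · exact (etaQuot_T (k := 0) (by rw [ef₂, mul_zero])).smul _
  · exact (etaQuot_T (k := 0) (by rw [eg₂, mul_zero])).smul _
  · rw [hg, ← hK₁, zpow_add₀ ζ₂₄_ne_zero, hf]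
    convert sl₁ using 2
    ring
  · rw [tendsto_zero_iff_norm_tendsto_zero]
    simp only [norm_t]
    rw [← zero_mul ‖(1 : ℂ)‖]
    refine Tendsto.mul (Real.tendsto_exp_atBot.comp ?_) hP.norm
    refine Tendsto.const_mul_atTop_of_neg ?_ tendsto_comap
    linarith [Real.pi_pos]
  · refine .of_bound 2 ?_
    filter_upwards [hP.norm.eventually_const_lt (show (1 / 2 : ℝ) < ‖(1 : ℂ)‖ by norm_num)]
      with τ hτ
    rw [norm_t, Real.norm_of_nonneg (Real.exp_pos _).le]
    nlinarith [Real.exp_pos (-2 * π * τ.im)]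
  · rw [hf]
    have := tendsto_etaQuot (m := id) (b := 0) pf ef (k := 0) (by simp)
    simpa using this
  · rw [← hK₂, zpow_add₀ ζ₂₄_ne_zero, mul_right_comm]
    exact (tendsto_etaQuot pf₂ ef₂ hBf).const_mul _
  · rw [← l_div, ← hK₃, zpow_add₀ ζ₂₄_ne_zero, mul_right_comm]
    exact (tendsto_etaQuot pg₂ eg₂ hBg).const_mul _
  · rw [mul_pow, ← κ_sq, ← Complex.ofReal_pow, Real.sq_sqrt v₁_nonneg]
  · rw [mul_pow, ← Complex.ofReal_pow, Real.sq_sqrt v₂_nonneg, l_sq]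

/-! ### The action of the involutions on the functions `η(n τ)` -/

section action

variable {M : Matrix (Fin 2) (Fin 2) ℤ} {hM : 0 < M.det} {D : ℝ} {k : ℕ → ℤ} {q m : ℕ → ℕ}
  {b : ℕ → ℝ} {n : ℕ}

/-- The action on `η(n τ)` from a transformation law `η(V(z)/W(z)) = ζ₂₄ ^ k √(-i W(z)) η(z)`, where
`V` and `W` at `z = m τ + b` are the numerator and the denominator of `n (M τ)`, divided by `q`. -/
lemma EtaAction.of_eq (hD : (M.det : ℝ) = D) (hq : 0 < q n) (hm : 0 < m n) (V W : ℂ → ℂ)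
    (hη : ∀ z : ℂ, 0 < z.im → ModularForm.eta (V z / W z) =
      ζ₂₄ ^ k n * rootI (W z) * ModularForm.eta z)
    (hW : ∀ τ : ℂ, (M 1 0 : ℂ) * τ + M 1 1 = q n * W ((m n : ℂ) * τ + (b n : ℂ)))
    (hV : ∀ τ : ℂ, n * ((M 0 0 : ℂ) * τ + M 0 1) = q n * V ((m n : ℂ) * τ + (b n : ℂ))) :
    EtaAction (realOf M hM) D k q m b n := by
  refine ⟨hq, hm, fun τ ↦ ?_⟩
  have hq' : (q n : ℂ) ≠ 0 := by exact_mod_cast hq.ne'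
  have hq'' : (0 : ℝ) < q n := by exact_mod_cast hq
  have hD0 : 0 < D := by
    rw [← hD]
    exact_mod_cast hM
  have hsD := Real.sqrt_pos.mpr hD0
  have hX : 0 < √(√D / q n) := Real.sqrt_pos.mpr (by positivity)
  have hJ0 := autFactor_ne_zero (realOf M hM) τ
  have hJ : W ((m n : ℂ) * τ + (b n : ℂ)) =
      ((√(√D / q n) : ℝ) : ℂ) ^ 2 * autFactor (realOf M hM) τ := by
    rw [← Complex.ofReal_pow, Real.sq_sqrt (by positivity), autFactor_realOf, hW, hD]
    have : ((√D : ℝ) : ℂ) ≠ 0 := by exact_mod_cast hsD.ne'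
    push_cast
    field_simp
  rw [coe_realOf_smul, mul_div_assoc', hV, hW, mul_div_mul_left _ _ hq',
    hη _ (im_linear_pos hm _ τ), hJ, rootI_sq_mul hX hJ0]
  ring

/-- The case of the matrix `(a, a d - 1; 1, d)` acting on `m τ + b`. -/
lemma EtaAction.of_one (a d : ℤ) (hD : (M.det : ℝ) = D) (hq : 0 < q n) (hm : 0 < m n)
    (hk : k n = a + d) (hW : ∀ τ : ℂ, (M 1 0 : ℂ) * τ + M 1 1 = q n * ((m n * τ + b n) + d))
    (hV : ∀ τ : ℂ, n * ((M 0 0 : ℂ) * τ + M 0 1) = q n * (a * ((m n * τ + b n) + d) - 1)) :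
    EtaAction (realOf M hM) D k q m b n := by
  refine .of_eq hD hq hm (fun z ↦ a * (z + d) - 1) (fun z ↦ z + d) (fun z hz ↦ ?_) hW hV
  have h0 := im_ne_zero_of_pos (im_add_int_pos hz d)
  rw [hk, ← eta_of_lower_one a d hz]
  congr 1
  field_simp

/-- The case of the matrix `(a p + 1, *; p, p d + 1)` acting on `m τ + b`, with `0 < p`. -/
lemma EtaAction.of_pos (a d : ℤ) (p : ℕ) (hp : 0 < p) (hD : (M.det : ℝ) = D) (hq : 0 < q n)
    (hm : 0 < m n) (hk : k n = a + d + 3 - p)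
    (hW : ∀ τ : ℂ, (M 1 0 : ℂ) * τ + M 1 1 = q n * (p * ((m n * τ + b n) + d) + 1))
    (hV : ∀ τ : ℂ, n * ((M 0 0 : ℂ) * τ + M 0 1) =
      q n * (a * (p * ((m n * τ + b n) + d) + 1) + ((m n * τ + b n) + d))) :
    EtaAction (realOf M hM) D k q m b n := by
  refine .of_eq hD hq hm (fun z ↦ a * (p * (z + d) + 1) + (z + d)) (fun z ↦ p * (z + d) + 1)
    (fun z hz ↦ ?_) hW hV
  have hp' : (0 : ℝ) < p := by exact_mod_cast hp
  have h1 := im_add_int_pos hz d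
  have h0 := im_ne_zero_of_pos h1
  have h2 : (p * (z + d) + 1 : ℂ) ≠ 0 :=
    im_ne_zero_of_pos (by simpa using mul_pos hp' (by simpa using h1))
  rw [hk, ← eta_of_lower_pos a d p hz hp]
  congr 1
  rw [add_div, mul_div_cancel_right₀ _ h2]
  congr 1
  rw [div_eq_div_iff h2 (by rw [add_div' _ _ _ h0]; exact div_ne_zero h2 h0)]
  field_simp

/-- The case of the matrix `(a p - 1, *; p, p d - 1)` acting on `m τ + b`, with `0 < p`. -/
lemma EtaAction.of_neg (a d : ℤ) (p : ℕ) (hp : 0 < p) (hD : (M.det : ℝ) = D) (hq : 0 < q n)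
    (hm : 0 < m n) (hk : k n = a + d + p - 3)
    (hW : ∀ τ : ℂ, (M 1 0 : ℂ) * τ + M 1 1 = q n * (p * ((m n * τ + b n) + d) - 1))
    (hV : ∀ τ : ℂ, n * ((M 0 0 : ℂ) * τ + M 0 1) =
      q n * (a * (p * ((m n * τ + b n) + d) - 1) - ((m n * τ + b n) + d))) :
    EtaAction (realOf M hM) D k q m b n := by
  refine .of_eq hD hq hm (fun z ↦ a * (p * (z + d) - 1) - (z + d)) (fun z ↦ p * (z + d) - 1)
    (fun z hz ↦ ?_) hW hV
  have hp' : (0 : ℝ) < p := by exact_mod_cast hp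
  have h1 := im_add_int_pos hz d
  have h0 := im_ne_zero_of_pos h1
  have h2 : (p * (z + d) - 1 : ℂ) ≠ 0 :=
    im_ne_zero_of_pos (by simpa using mul_pos hp' (by simpa using h1))
  rw [hk, ← eta_of_lower_neg a d p hz hp]
  congr 1
  rw [sub_div, mul_div_cancel_right₀ _ h2]
  congr 1
  rw [div_eq_div_iff h2 (by rw [sub_div' h0]; exact div_ne_zero h2 h0)]
  field_simp

end action

lemma etaAction_six_two : ∀ n ∈ [1, 2, 3, 6],
    EtaAction (realOf !![2, -1; 6, -2] (by decide)) 2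
      (fun n ↦ if n = 2 ∨ n = 6 then 1 else -1)
      (fun n ↦ if n = 2 ∨ n = 6 then 2 else 1)
      (fun n ↦ if n = 2 then 1 else if n = 3 then 6 else if n = 6 then 3 else 2)
      (fun _ ↦ 0) n := by
  simp only [List.forall_mem_cons, List.not_mem_nil, false_imp_iff, implies_true, and_true]
  refine ⟨.of_pos 0 (-1) 3 (by norm_num) ?_ ?_ ?_ ?_ ?_ ?_,
    .of_neg 1 0 3 (by norm_num) ?_ ?_ ?_ ?_ ?_ ?_,
    .of_one 1 (-2) ?_ ?_ ?_ ?_ ?_ ?_,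
    .of_one 2 (-1) ?_ ?_ ?_ ?_ ?_ ?_⟩
  all_goals norm_num [Matrix.det_fin_two]
  all_goals (intro τ; ring)

lemma etaAction_six_three : ∀ n ∈ [1, 2, 3, 6],
    EtaAction (realOf !![3, -2; 6, -3] (by decide)) 3
      (fun n ↦ if n = 2 then -2 else if n = 3 then 1 else if n = 6 then 2 else -1)
      (fun n ↦ if n = 3 ∨ n = 6 then 3 else 1)
      (fun n ↦ if n = 2 then 6 else if n = 3 then 1 else if n = 6 then 2 else 3)
      (fun _ ↦ 0) n := by
  simp only [List.forall_mem_cons, List.not_mem_nil, false_imp_iff, implies_true, and_true]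
  refine ⟨.of_pos 0 (-2) 2 (by norm_num) ?_ ?_ ?_ ?_ ?_ ?_,
    .of_one 1 (-3) ?_ ?_ ?_ ?_ ?_ ?_,
    .of_pos 1 (-1) 2 (by norm_num) ?_ ?_ ?_ ?_ ?_ ?_,
    .of_one 3 (-1) ?_ ?_ ?_ ?_ ?_ ?_⟩
  all_goals norm_num [Matrix.det_fin_two]
  all_goals (intro τ; ring)

lemma etaAction_six_six : ∀ n ∈ [1, 2, 3, 6],
    EtaAction (realOf !![0, -1; 6, 0] (by decide)) 6
      (fun _ ↦ 0)
      (fun n ↦ if n = 2 then 2 else if n = 3 then 3 else if n = 6 then 6 else 1)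
      (fun n ↦ if n = 2 then 3 else if n = 3 then 2 else if n = 6 then 1 else 6)
      (fun _ ↦ 0) n := by
  simp only [List.forall_mem_cons, List.not_mem_nil, false_imp_iff, implies_true, and_true]
  refine ⟨.of_one 0 0 ?_ ?_ ?_ ?_ ?_ ?_,
    .of_one 0 0 ?_ ?_ ?_ ?_ ?_ ?_,
    .of_one 0 0 ?_ ?_ ?_ ?_ ?_ ?_,
    .of_one 0 0 ?_ ?_ ?_ ?_ ?_ ?_⟩
  all_goals norm_num [Matrix.det_fin_two]
  all_goals (intro τ; ring)

lemma etaAction_eight_one : ∀ n ∈ [1, 2, 4],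
    EtaAction (realOf !![4, -3; 8, -4] (by decide)) 8
      (fun n ↦ if n = 4 then 1 else -1)
      (fun n ↦ if n = 4 then 4 else 2)
      (fun n ↦ if n = 2 then 4 else 2)
      (fun n ↦ if n = 1 then 1 / 2 else 0) n := by
  simp only [List.forall_mem_cons, List.not_mem_nil, false_imp_iff, implies_true, and_true]
  refine ⟨.of_pos 0 (-2) 2 (by norm_num) ?_ ?_ ?_ ?_ ?_ ?_,
    .of_one 1 (-2) ?_ ?_ ?_ ?_ ?_ ?_,
    .of_one 2 (-1) ?_ ?_ ?_ ?_ ?_ ?_⟩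
  all_goals norm_num [Matrix.det_fin_two]
  all_goals (intro τ; ring)

lemma etaAction_eight_two : ∀ n ∈ [1, 2, 4, 8],
    EtaAction (realOf !![2, -1; 8, -2] (by decide)) 4
      (fun n ↦ if n = 1 then -2 else if n = 8 then 1 else 0)
      (fun n ↦ if n = 8 then 4 else 2)
      (fun n ↦ if n = 1 then 1 else if n = 4 then 4 else 2)
      (fun n ↦ if n = 2 ∨ n = 4 then 0 else 1 / 2) n := by
  simp only [List.forall_mem_cons, List.not_mem_nil, false_imp_iff, implies_true, and_true]
  refine ⟨.of_pos 0 (-1) 4 (by norm_num) ?_ ?_ ?_ ?_ ?_ ?_,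
    .of_pos 0 (-1) 2 (by norm_num) ?_ ?_ ?_ ?_ ?_ ?_,
    .of_one 1 (-1) ?_ ?_ ?_ ?_ ?_ ?_,
    .of_one 2 (-1) ?_ ?_ ?_ ?_ ?_ ?_⟩
  all_goals norm_num [Matrix.det_fin_two]
  all_goals (intro τ; ring)

lemma etaAction_nine_one : ∀ n ∈ [1, 3, 9],
    EtaAction (realOf !![0, -1; 9, 0] (by decide)) 9
      (fun _ ↦ 0)
      (fun n ↦ if n = 3 then 3 else if n = 9 then 9 else 1)
      (fun n ↦ if n = 3 then 3 else if n = 9 then 1 else 9)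
      (fun _ ↦ 0) n := by
  simp only [List.forall_mem_cons, List.not_mem_nil, false_imp_iff, implies_true, and_true]
  refine ⟨.of_one 0 0 ?_ ?_ ?_ ?_ ?_ ?_,
    .of_one 0 0 ?_ ?_ ?_ ?_ ?_ ?_,
    .of_one 0 0 ?_ ?_ ?_ ?_ ?_ ?_⟩
  all_goals norm_num [Matrix.det_fin_two]
  all_goals (intro τ; ring)

lemma etaAction_nine_two : ∀ n ∈ [1, 3, 9],
    EtaAction (realOf !![-3, -2; 9, 3] (by decide)) 9
      (fun n ↦ if n = 3 then 0 else if n = 9 then -3 else 1)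
      (fun n ↦ if n = 9 then 9 else 3)
      (fun n ↦ if n = 3 then 3 else 1)
      (fun n ↦ if n = 3 then 0 else if n = 9 then 1 / 3 else -(1 / 3)) n := by
  simp only [List.forall_mem_cons, List.not_mem_nil, false_imp_iff, implies_true, and_true]
  refine ⟨.of_neg 0 1 3 (by norm_num) ?_ ?_ ?_ ?_ ?_ ?_,
    .of_one (-1) 1 ?_ ?_ ?_ ?_ ?_ ?_,
    .of_one (-3) 0 ?_ ?_ ?_ ?_ ?_ ?_⟩
  all_goals norm_num [Matrix.det_fin_two]
  all_goals (intro τ; ring)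

end Bimodular

namespace Bimodular

open Filter Asymptotics Real

/-! ### The eta function at `τ + 1/2` -/

lemma multipliable_one_sub_pow_mul_add {q : ℂ} (hq : ‖q‖ < 1) {a : ℕ} (ha : 0 < a) (b : ℕ) :
    Multipliable fun n : ℕ ↦ 1 - q ^ (a * n + b) := by
  apply multipliable_one_add_of_summable (f := fun n ↦ -q ^ (a * n + b))
  simp only [norm_neg, pow_add, pow_mul, norm_mul, norm_pow]
  exact (summable_geometric_of_lt_one (by positivity)
    (pow_lt_one₀ (norm_nonneg _) hq ha.ne')).mul_right _

/-- Splitting Euler's product into its even and odd factors. -/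
lemma tprod_one_sub_pow_eq {q : ℂ} (hq : ‖q‖ < 1) : ∏' n : ℕ, (1 - q ^ (n + 1)) =
    (∏' n : ℕ, (1 - q ^ (2 * n + 1))) * ∏' n : ℕ, (1 - (q ^ 2) ^ (n + 1)) := by
  have h1 := multipliable_one_sub_pow_mul_add hq two_pos 1
  have h2 := multipliable_one_sub_pow_mul_add hq two_pos 2
  rw [← tprod_even_mul_odd (f := fun n ↦ 1 - q ^ (n + 1)) h1 h2]
  congr 1
  refine tprod_congr fun n ↦ ?_
  rw [← pow_mul]
  ring_nf

/-- `η(z + 1/2) η(z) η(4z) = exp(2πi / 48) η(2z)³`. -/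
lemma eta_add_half {z : ℂ} (hz : 0 < z.im) :
    ModularForm.eta (z + 1 / 2) * ModularForm.eta z * ModularForm.eta (4 * z) =
      Complex.exp (2 * π * Complex.I / 48) * ModularForm.eta (2 * z) ^ 3 := by
  set q := Function.Periodic.qParam 1 z with hqz
  have hq : ‖q‖ < 1 := by
    simpa using UpperHalfPlane.norm_qParam_lt_one 1 ⟨z, hz⟩
  have q2 : Function.Periodic.qParam 1 (2 * z) = q ^ 2 := by
    rw [hqz, Function.Periodic.qParam, Function.Periodic.qParam, ← Complex.exp_nat_mul]
    congr 1
    push_cast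
    ring
  have q4 : Function.Periodic.qParam 1 (4 * z) = (q ^ 2) ^ 2 := by
    rw [hqz, Function.Periodic.qParam, Function.Periodic.qParam, ← pow_mul, ← Complex.exp_nat_mul]
    congr 1
    push_cast
    ring
  have qh : Function.Periodic.qParam 1 (z + 1 / 2) = -q := by
    rw [hqz, Function.Periodic.qParam, Function.Periodic.qParam, ← Complex.exp_add_pi_mul_I]
    congr 1
    push_cast
    ring
  have hq' : ‖-q‖ < 1 := by rwa [norm_neg]
  have hq2 : ‖q ^ 2‖ < 1 := by
    rw [norm_pow]
    exact pow_lt_one₀ (norm_nonneg _) hq two_ne_zero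
  have odd : (∏' n : ℕ, (1 - (-q) ^ (2 * n + 1))) * ∏' n : ℕ, (1 - q ^ (2 * n + 1)) =
      ∏' n : ℕ, (1 - (q ^ 2) ^ (2 * n + 1)) := by
    rw [← (multipliable_one_sub_pow_mul_add hq' two_pos 1).tprod_mul
      (multipliable_one_sub_pow_mul_add hq two_pos 1)]
    refine tprod_congr fun n ↦ ?_
    rw [Odd.neg_pow ⟨n, rfl⟩, ← pow_mul, mul_comm 2, pow_mul]
    ring
  have e1 := tprod_one_sub_pow_eq hq
  have e2 := tprod_one_sub_pow_eq hq'
  have e3 := tprod_one_sub_pow_eq hq2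
  rw [neg_sq] at e2
  have key : (∏' n : ℕ, (1 - (-q) ^ (n + 1))) * (∏' n : ℕ, (1 - q ^ (n + 1))) *
      (∏' n : ℕ, (1 - ((q ^ 2) ^ 2) ^ (n + 1))) = (∏' n : ℕ, (1 - (q ^ 2) ^ (n + 1))) ^ 3 := by
    rw [e1, e2]
    rw [← odd] at e3
    linear_combination (-(∏' n : ℕ, (1 - (q ^ 2) ^ (n + 1))) ^ 2) * e3
  have hexp : Function.Periodic.qParam 24 (z + 1 / 2) * Function.Periodic.qParam 24 z *
      Function.Periodic.qParam 24 (4 * z) =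
      Complex.exp (2 * π * Complex.I / 48) * Function.Periodic.qParam 24 (2 * z) ^ 3 := by
    simp only [Function.Periodic.qParam]
    rw [← Complex.exp_nat_mul, ← Complex.exp_add, ← Complex.exp_add, ← Complex.exp_add]
    congr 1
    push_cast
    ring
  simp only [ModularForm.eta, ModularForm.eta_q, q2, q4, qh]
  rw [mul_pow, ← key]
  linear_combination ((∏' n : ℕ, (1 - (-q) ^ (n + 1))) * (∏' n : ℕ, (1 - q ^ (n + 1))) *
    (∏' n : ℕ, (1 - ((q ^ 2) ^ 2) ^ (n + 1)))) * hexp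

lemma case12_slash : etaQuot [(2, 10), (1, -4), (4, -4)]
    (fun n ↦ if n = 2 then 4 else 2) (fun n ↦ if n = 1 then 1 / 2 else 0) =
      ζ₂₄ ^ (-2 : ℤ) • etaQuot [(4, -2), (8, 4)] id 0 := by
  ext τ
  have h2 := ModularForm.eta_ne_zero (im_linear_pos (k := 2) (by norm_num) 0 τ)
  have h4 := ModularForm.eta_ne_zero (im_linear_pos (k := 4) (by norm_num) 0 τ)
  have h8 := ModularForm.eta_ne_zero (im_linear_pos (k := 8) (by norm_num) 0 τ)
  have hh := ModularForm.eta_ne_zero (im_linear_pos (k := 2) (by norm_num) (1 / 2) τ)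
  have h := eta_add_half (z := 2 * τ) (by simpa using τ.im_pos)
  have hexp : Complex.exp (2 * π * Complex.I / 48) ^ 4 = ζ₂₄ ^ 2 := by
    rw [ζ₂₄, ← Complex.exp_nat_mul, ← Complex.exp_nat_mul]
    congr 1
    push_cast
    ring
  have hz := ζ₂₄_ne_zero
  rw [show (4 * (2 * τ) : ℂ) = 8 * τ by ring, show (2 * (2 * τ) : ℂ) = 4 * τ by ring] at h
  have h' := congrArg (· ^ 4) h
  simp only [mul_pow, hexp] at h'
  simp [etaQuot] at h2 h4 h8 hh h' ⊢
  generalize ModularForm.eta (2 * (τ : ℂ)) = e2 at *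
  generalize ModularForm.eta (4 * (τ : ℂ)) = e4 at *
  generalize ModularForm.eta (8 * (τ : ℂ)) = e8 at *
  generalize ModularForm.eta (2 * (τ : ℂ) + 2⁻¹) = eh at *
  field_simp
  linear_combination -h'

/-! ### The analytic data of the five eta cases -/

lemma ζ₂₄_pow_neg_six : ζ₂₄ ^ (-6 : ℤ) = -Complex.I := by
  rw [zpow_neg, ζ₂₄_pow_six, Complex.inv_I]

lemma ζ₂₄_pow_neg_twelve : ζ₂₄ ^ (-12 : ℤ) = -1 := by
  rw [zpow_neg, ζ₂₄_pow_twelve]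
  norm_num

lemma ζ₂₄_pow_neg_eighteen : ζ₂₄ ^ (-18 : ℤ) = Complex.I := by
  rw [show (-18 : ℤ) = -12 + -6 by norm_num, zpow_add₀ ζ₂₄_ne_zero, ζ₂₄_pow_neg_twelve,
    ζ₂₄_pow_neg_six]
  ring

lemma ζ₂₄_pow_neg_four : ζ₂₄ ^ (-4 : ℤ) = (1 - Sporadic.sqrtNegThree) / 2 := by
  rw [ζ₂₄_zpow, show 2 * π * Complex.I * ((-4 : ℤ) : ℂ) / 24 = ((-(π / 3) : ℝ) : ℂ) * Complex.I by
    push_cast; ring, Complex.exp_mul_I, ← Complex.ofReal_cos, ← Complex.ofReal_sin, Real.cos_neg,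
    Real.sin_neg, Real.cos_pi_div_three, Real.sin_pi_div_three, Sporadic.sqrtNegThree]
  push_cast
  ring

lemma ζ₂₄_pow_neg_fourteen : ζ₂₄ ^ (-14 : ℤ) = (-(√3 : ℝ) + Complex.I) / 2 := by
  rw [show (-14 : ℤ) = -12 + -2 by norm_num, zpow_add₀ ζ₂₄_ne_zero, ζ₂₄_pow_neg_twelve, ζ₂₄_zpow,
    show 2 * π * Complex.I * ((-2 : ℤ) : ℂ) / 24 = ((-(π / 6) : ℝ) : ℂ) * Complex.I by
    push_cast; ring, Complex.exp_mul_I, ← Complex.ofReal_cos, ← Complex.ofReal_sin, Real.cos_neg,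
    Real.sin_neg, Real.cos_pi_div_six, Real.sin_pi_div_six]
  push_cast
  ring

lemma sqrtNegThree_sq : Sporadic.sqrtNegThree ^ 2 = -3 := by
  have h := Real.sq_sqrt (show (0 : ℝ) ≤ 3 by norm_num)
  rw [Sporadic.sqrtNegThree, mul_pow, ← Complex.ofReal_pow, h, Complex.I_sq]
  norm_num

lemma α_mul_β_caseNeg9_ne_zero : Sporadic.caseNeg9.α * Sporadic.caseNeg9.β ≠ 0 := by
  have h : Sporadic.caseNeg9.α * Sporadic.caseNeg9.β = 27 := by
    simp only [Sporadic.α, Sporadic.β]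
    linear_combination (-9 / 4 : ℂ) * sqrtNegThree_sq
  rw [h]
  norm_num

lemma formData_case7 : ∃ κ l φ₂ φ₃, FormData Sporadic.case7.α Sporadic.case7.β
    Sporadic.case7.t Sporadic.case7.f (realOf !![2, -1; 6, -2] (by decide))
    (realOf !![3, -2; 6, -3] (by decide)) κ l φ₂ φ₃ := by
  have ht : Sporadic.case7.t = etaQuot [(1, 3), (6, 9), (2, -3), (3, -9)] id 0 := by
    ext τ
    simp [Sporadic.t, Sporadic.etaAt, etaQuot]
    field_simp
  have hf : Sporadic.case7.f = etaQuot [(2, 1), (3, 6), (1, -2), (6, -3)] id 0 := by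
    ext τ
    simp [Sporadic.f, Sporadic.etaAt, etaQuot]
    field_simp
  have hg : Sporadic.case7.t * Sporadic.case7.f =
      etaQuot [(1, 1), (2, -2), (3, -3), (6, 6)] id 0 := by
    ext τ
    rw [Pi.mul_apply, Sporadic.t, Sporadic.f]
    simp only [etaQuot, Sporadic.etaAt]
    simp
    have h1 := ModularForm.eta_ne_zero (im_linear_pos (k := 1) (by norm_num) 0 τ)
    have h2 := ModularForm.eta_ne_zero (im_linear_pos (k := 2) (by norm_num) 0 τ)
    have h3 := ModularForm.eta_ne_zero (im_linear_pos (k := 3) (by norm_num) 0 τ)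
    have h6 := ModularForm.eta_ne_zero (im_linear_pos (k := 6) (by norm_num) 0 τ)
    simp at h1 h2 h3 h6
    generalize ModularForm.eta (τ : ℂ) = e1 at *
    generalize ModularForm.eta (2 * (τ : ℂ)) = e2 at *
    generalize ModularForm.eta (3 * (τ : ℂ)) = e3 at *
    generalize ModularForm.eta (6 * (τ : ℂ)) = e6 at *
    field_simp
  refine FormData.of_eta _ _ _ _ _ (c := 0) (Bf := 0) (Bg := 0) (K₁ := -12) (K₂ := -6) (K₃ := 6)
    (v₁ := 8) (v₂ := 1 / 9) (v₃ := 1 / 9) ?_ ?_ ht hf hg (by decide) (by decide) (by decide)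
    (by decide) (by decide) (by decide) (by decide) (by decide) (by decide) (by norm_num)
    (by norm_num) etaAction_six_two etaAction_six_three (by decide) (by decide) (by decide)
    (by
      ext τ
      simp [etaQuot, -mul_eq_mul_left_iff, -mul_eq_mul_right_iff]
      ring) ?_ ?_ (by decide) (by decide)
    (by decide) ?_ ?_ ?_ ?_ ?_ ?_
  · norm_num [Sporadic.α]
  · norm_num [Sporadic.β]
  · norm_num
  · norm_num
  · norm_num [qProd]
  · norm_num [qProd]
  · norm_num [qProd]
  · rw [ζ₂₄_pow_neg_twelve]
    norm_num [Sporadic.α, Sporadic.β]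
  · rw [ζ₂₄_pow_neg_six]
    norm_num [Sporadic.α, Sporadic.β]
  · rw [ζ₂₄_pow_neg_six, ζ₂₄_pow_six]
    norm_num [Sporadic.α]

lemma formData_case10 : ∃ κ l φ₂ φ₃, FormData Sporadic.case10.α Sporadic.case10.β
    Sporadic.case10.t Sporadic.case10.f (realOf !![3, -2; 6, -3] (by decide))
    (realOf !![2, -1; 6, -2] (by decide)) κ l φ₂ φ₃ := by
  have ht : Sporadic.case10.t = etaQuot [(1, 4), (6, 8), (2, -8), (3, -4)] id 0 := by
    ext τ
    simp [Sporadic.t, Sporadic.etaAt, etaQuot]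
    field_simp
  have hf : Sporadic.case10.f = etaQuot [(2, 6), (3, 1), (1, -3), (6, -2)] id 0 := by
    ext τ
    simp [Sporadic.f, Sporadic.etaAt, etaQuot]
    field_simp
  have hg : Sporadic.case10.t * Sporadic.case10.f =
      etaQuot [(1, 1), (2, -2), (3, -3), (6, 6)] id 0 := by
    ext τ
    rw [Pi.mul_apply, Sporadic.t, Sporadic.f]
    simp only [etaQuot, Sporadic.etaAt]
    simp
    have h1 := ModularForm.eta_ne_zero (im_linear_pos (k := 1) (by norm_num) 0 τ)
    have h2 := ModularForm.eta_ne_zero (im_linear_pos (k := 2) (by norm_num) 0 τ)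
    have h3 := ModularForm.eta_ne_zero (im_linear_pos (k := 3) (by norm_num) 0 τ)
    have h6 := ModularForm.eta_ne_zero (im_linear_pos (k := 6) (by norm_num) 0 τ)
    simp at h1 h2 h3 h6
    generalize ModularForm.eta (τ : ℂ) = e1 at *
    generalize ModularForm.eta (2 * (τ : ℂ)) = e2 at *
    generalize ModularForm.eta (3 * (τ : ℂ)) = e3 at *
    generalize ModularForm.eta (6 * (τ : ℂ)) = e6 at *
    field_simp
  refine FormData.of_eta _ _ _ _ _ (c := 0) (Bf := 0) (Bg := 0) (K₁ := -18) (K₂ := 0) (K₃ := 0)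
    (v₁ := 9) (v₂ := 1 / 8) (v₃ := 1 / 8) ?_ ?_ ht hf hg (by decide) (by decide) (by decide)
    (by decide) (by decide) (by decide) (by decide) (by decide) (by decide) (by norm_num)
    (by norm_num) etaAction_six_three etaAction_six_two (by decide) (by decide) (by decide)
    (by
      ext τ
      simp [etaQuot, -mul_eq_mul_left_iff, -mul_eq_mul_right_iff]
      ring) ?_ ?_ (by decide) (by decide)
    (by decide) ?_ ?_ ?_ ?_ ?_ ?_
  · norm_num [Sporadic.α]
  · norm_num [Sporadic.β]
  · norm_num
  · norm_num
  · norm_num [qProd]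
  · norm_num [qProd]
  · norm_num [qProd]
  · rw [ζ₂₄_pow_neg_eighteen]
    norm_num [Sporadic.α, Sporadic.β]
  · norm_num [Sporadic.α, Sporadic.β]
  · norm_num [Sporadic.α]

lemma formData_caseNeg17 : ∃ κ l φ₂ φ₃, FormData Sporadic.caseNeg17.α Sporadic.caseNeg17.β
    Sporadic.caseNeg17.t Sporadic.caseNeg17.f (realOf !![0, -1; 6, 0] (by decide))
    (realOf !![2, -1; 6, -2] (by decide)) κ l φ₂ φ₃ := by
  have ht : Sporadic.caseNeg17.t = etaQuot [(2, 1), (6, 5), (1, -5), (3, -1)] id 0 := by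
    ext τ
    simp [Sporadic.t, Sporadic.etaAt, etaQuot]
    field_simp
  have hf : Sporadic.caseNeg17.f = etaQuot [(1, 6), (6, 1), (2, -3), (3, -2)] id 0 := by
    ext τ
    simp [Sporadic.f, Sporadic.etaAt, etaQuot]
    field_simp
  have hg : Sporadic.caseNeg17.t * Sporadic.caseNeg17.f =
      etaQuot [(1, 1), (2, -2), (3, -3), (6, 6)] id 0 := by
    ext τ
    rw [Pi.mul_apply, Sporadic.t, Sporadic.f]
    simp only [etaQuot, Sporadic.etaAt]
    simp
    have h1 := ModularForm.eta_ne_zero (im_linear_pos (k := 1) (by norm_num) 0 τ)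
    have h2 := ModularForm.eta_ne_zero (im_linear_pos (k := 2) (by norm_num) 0 τ)
    have h3 := ModularForm.eta_ne_zero (im_linear_pos (k := 3) (by norm_num) 0 τ)
    have h6 := ModularForm.eta_ne_zero (im_linear_pos (k := 6) (by norm_num) 0 τ)
    simp at h1 h2 h3 h6
    generalize ModularForm.eta (τ : ℂ) = e1 at *
    generalize ModularForm.eta (2 * (τ : ℂ)) = e2 at *
    generalize ModularForm.eta (3 * (τ : ℂ)) = e3 at *
    generalize ModularForm.eta (6 * (τ : ℂ)) = e6 at *
    field_simp
  refine FormData.of_eta _ _ _ _ _ (c := 0) (Bf := 0) (Bg := 0) (K₁ := -6) (K₂ := -12) (K₃ := 0)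
    (v₁ := 72) (v₂ := 8) (v₃ := 1 / 8) ?_ ?_ ht hf hg (by decide) (by decide) (by decide)
    (by decide) (by decide) (by decide) (by decide) (by decide) (by decide) (by norm_num)
    (by norm_num) etaAction_six_six etaAction_six_two (by decide) (by decide) (by decide)
    (by
      ext τ
      simp [etaQuot, -mul_eq_mul_left_iff, -mul_eq_mul_right_iff]
      ring) ?_ ?_ (by decide) (by decide)
    (by decide) ?_ ?_ ?_ ?_ ?_ ?_
  · norm_num [Sporadic.α]
  · norm_num [Sporadic.β]
  · norm_num
  · norm_num
  · norm_num [qProd]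
  · norm_num [qProd]
  · norm_num [qProd]
  · rw [ζ₂₄_pow_neg_six]
    norm_num [Sporadic.α, Sporadic.β]
  · rw [ζ₂₄_pow_neg_twelve]
    norm_num [Sporadic.α, Sporadic.β]
  · have h8 : √(1 / 8 : ℝ) = √8 / 8 := by
      rw [Real.sqrt_eq_iff_mul_self_eq (by norm_num) (by positivity)]
      have := Real.mul_self_sqrt (show (0 : ℝ) ≤ 8 by norm_num)
      linear_combination -this / 64
    rw [ζ₂₄_pow_neg_twelve, h8]
    norm_num [Sporadic.α]

lemma formData_case12 : ∃ κ l φ₂ φ₃, FormData Sporadic.case12.α Sporadic.case12.β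
    Sporadic.case12.t Sporadic.case12.f (realOf !![4, -3; 8, -4] (by decide))
    (realOf !![2, -1; 8, -2] (by decide)) κ l φ₂ φ₃ := by
  have ht : Sporadic.case12.t = etaQuot [(1, 4), (4, 2), (8, 4), (2, -10)] id 0 := by
    ext τ
    simp [Sporadic.t, Sporadic.etaAt, etaQuot]
    field_simp
  have hf : Sporadic.case12.f = etaQuot [(2, 10), (1, -4), (4, -4)] id 0 := by
    ext τ
    simp [Sporadic.f, Sporadic.etaAt, etaQuot]
    field_simp
  have hg : Sporadic.case12.t * Sporadic.case12.f =
      etaQuot [(4, -2), (8, 4)] id 0 := by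
    ext τ
    rw [Pi.mul_apply, Sporadic.t, Sporadic.f]
    simp only [etaQuot, Sporadic.etaAt]
    simp
    have h1 := ModularForm.eta_ne_zero (im_linear_pos (k := 1) (by norm_num) 0 τ)
    have h2 := ModularForm.eta_ne_zero (im_linear_pos (k := 2) (by norm_num) 0 τ)
    have h4 := ModularForm.eta_ne_zero (im_linear_pos (k := 4) (by norm_num) 0 τ)
    have h8 := ModularForm.eta_ne_zero (im_linear_pos (k := 8) (by norm_num) 0 τ)
    simp at h1 h2 h4 h8
    generalize ModularForm.eta (τ : ℂ) = e1 at *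
    generalize ModularForm.eta (2 * (τ : ℂ)) = e2 at *
    generalize ModularForm.eta (4 * (τ : ℂ)) = e4 at *
    generalize ModularForm.eta (8 * (τ : ℂ)) = e8 at *
    field_simp
  refine FormData.of_eta _ _ _ _ _ (c := -2) (Bf := -2) (Bg := 2) (K₁ := -18) (K₂ := 0) (K₃ := 0)
    (v₁ := 32) (v₂ := 1) (v₃ := 1 / 16) ?_ ?_ ht hf hg (by decide) (by decide) (by decide)
    (by decide) (by decide) (by decide) (by decide) (by decide) (by decide) (by norm_num)
    (by norm_num) etaAction_eight_one etaAction_eight_two (by decide) (by decide) (by decide)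
    case12_slash ?_ ?_ (by decide) (by decide)
    (by decide) ?_ ?_ ?_ ?_ ?_ ?_
  · norm_num [Sporadic.α]
  · norm_num [Sporadic.β]
  · norm_num
  · norm_num
  · norm_num [qProd]
  · norm_num [qProd]
  · norm_num [qProd]
  · rw [ζ₂₄_pow_neg_eighteen]
    norm_num [Sporadic.α, Sporadic.β]
  · norm_num [Sporadic.α, Sporadic.β]
  · have h16 : √(1 / 16 : ℝ) = 1 / 4 := by
      rw [Real.sqrt_eq_iff_mul_self_eq (by norm_num) (by positivity)]
      norm_num
    rw [h16]
    norm_num [Sporadic.α]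

lemma formData_caseNeg9 : ∃ κ l φ₂ φ₃, FormData Sporadic.caseNeg9.α Sporadic.caseNeg9.β
    Sporadic.caseNeg9.t Sporadic.caseNeg9.f (realOf !![0, -1; 9, 0] (by decide))
    (realOf !![-3, -2; 9, 3] (by decide)) κ l φ₂ φ₃ := by
  have ht : Sporadic.caseNeg9.t = etaQuot [(9, 3), (1, -3)] id 0 := by
    ext τ
    simp [Sporadic.t, Sporadic.etaAt, etaQuot]
    field_simp
  have hf : Sporadic.caseNeg9.f = etaQuot [(1, 3), (3, -1)] id 0 := by
    ext τ
    simp [Sporadic.f, Sporadic.etaAt, etaQuot]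
    field_simp
  have hg : Sporadic.caseNeg9.t * Sporadic.caseNeg9.f =
      etaQuot [(3, -1), (9, 3)] id 0 := by
    ext τ
    rw [Pi.mul_apply, Sporadic.t, Sporadic.f]
    simp only [etaQuot, Sporadic.etaAt]
    simp
    have h1 := ModularForm.eta_ne_zero (im_linear_pos (k := 1) (by norm_num) 0 τ)
    have h3 := ModularForm.eta_ne_zero (im_linear_pos (k := 3) (by norm_num) 0 τ)
    have h9 := ModularForm.eta_ne_zero (im_linear_pos (k := 9) (by norm_num) 0 τ)
    simp at h1 h3 h9
    generalize ModularForm.eta (τ : ℂ) = e1 at *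
    generalize ModularForm.eta (3 * (τ : ℂ)) = e3 at *
    generalize ModularForm.eta (9 * (τ : ℂ)) = e9 at *
    field_simp
  refine FormData.of_eta _ _ _ _ _ (c := 0) (Bf := -1) (Bg := 1) (K₁ := -6) (K₂ := -4) (K₃ := -14)
    (v₁ := 27) (v₂ := 1) (v₃ := 1 / 27) ?_ ?_ ht hf hg (by decide) (by decide) (by decide)
    (by decide) (by decide) (by decide) (by decide) (by decide) (by decide) (by norm_num)
    (by norm_num) etaAction_nine_one etaAction_nine_two (by decide) (by decide) (by decide)
    (by
      ext τ
      simp [etaQuot, -mul_eq_mul_left_iff, -mul_eq_mul_right_iff]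
      ring) ?_ ?_ (by decide) (by decide)
    (by decide) ?_ ?_ ?_ ?_ ?_ ?_
  · exact left_ne_zero_of_mul α_mul_β_caseNeg9_ne_zero
  · exact right_ne_zero_of_mul α_mul_β_caseNeg9_ne_zero
  · norm_num
  · norm_num
  · norm_num [qProd]
  · norm_num [qProd]
  · norm_num [qProd]
  · rw [ζ₂₄_pow_neg_six]
    simp only [Sporadic.α, Sporadic.β]
    push_cast
    linear_combination (-9 / 4 : ℂ) * sqrtNegThree_sq + 27 * Complex.I_sq
  · rw [ζ₂₄_pow_neg_four]
    simp only [Sporadic.α, Sporadic.β]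
    push_cast
    linear_combination (-3 / 4 * Sporadic.sqrtNegThree + 3 / 2) * sqrtNegThree_sq
  · have h27 : √(1 / 27 : ℝ) = √3 / 9 := by
      rw [Real.sqrt_eq_iff_mul_self_eq (by norm_num) (by positivity)]
      have := Real.mul_self_sqrt (show (0 : ℝ) ≤ 3 by norm_num)
      linear_combination -this / 81
    rw [ζ₂₄_pow_neg_fourteen, ζ₂₄_pow_neg_four, h27]
    rw [eq_div_iff (left_ne_zero_of_mul α_mul_β_caseNeg9_ne_zero)]
    simp only [Sporadic.α, Real.sqrt_one, Sporadic.sqrtNegThree]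
    have h3 : ((√3 : ℝ) : ℂ) ^ 2 = 3 := by
      rw [← Complex.ofReal_pow, Real.sq_sqrt (by norm_num)]
      norm_num
    push_cast
    linear_combination ((9 - 3 * Complex.I * (√3 : ℝ) + 3 * Complex.I ^ 2) / 36) * h3 +
      9 / 36 * Complex.I_sq

end Bimodular

namespace Bimodular

open Filter Real

/-! ### A uniqueness theorem for quasi-periodic functions -/

/-- Two entire functions with the same quasi-periods `1` and `τ` and the same simple zero at the
origin agree, if the first one vanishes only at lattice points. -/
theorem eq_of_quasiPeriodic {K M : ℂ → ℂ} {τ : ℂ} (hτ : 0 < τ.im) {μ : ℂ → ℂ} (hμ : ∀ z, μ z ≠ 0)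
    (hK : Differentiable ℂ K) (hM : Differentiable ℂ M)
    (K_one : ∀ z, K (z + 1) = -K z) (M_one : ∀ z, M (z + 1) = -M z)
    (K_τ : ∀ z, K (z + τ) = μ z * K z) (M_τ : ∀ z, M (z + τ) = μ z * M z)
    (K_zero : K 0 = 0) (M_zero : M 0 = 0) (K_deriv : deriv K 0 = 1) (M_deriv : deriv M 0 = 1)
    (zeros : ∀ z, K z = 0 → ∃ m n : ℤ, z = m + n * τ) : M = K := by
  classical
  set R : ℂ → ℂ := fun z ↦ if K z = 0 then 1 else M z / K z with hR
  have per_one : Function.Periodic R 1 := fun z ↦ by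
    simp only [hR, K_one, M_one, neg_eq_zero, neg_div_neg_eq]
  have per_τ : Function.Periodic R τ := fun z ↦ by
    simp only [hR, K_τ, M_τ, mul_eq_zero, hμ, false_or, mul_div_mul_left _ _ (hμ z)]
  have per (z : ℂ) (m n : ℤ) : R (z + (m + n * τ)) = R z := by
    rw [← add_assoc, per_τ.int_mul n, ← mul_one (m : ℂ), per_one.int_mul m]
  have diff_zero : DifferentiableAt ℂ R 0 := by
    have hd {F : ℂ → ℂ} (hF : Differentiable ℂ F) : DifferentiableAt ℂ (dslope F 0) 0 :=
      ((Complex.differentiableOn_dslope univ_mem).mpr hF.differentiableOn).differentiableAt univ_mem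
    have h0 : dslope K 0 0 ≠ 0 := by simp [K_deriv]
    refine DifferentiableAt.congr_of_eventuallyEq ((hd hM).div (hd hK) h0) ?_
    filter_upwards [(hd hK).continuousAt.eventually_ne h0] with z hz
    by_cases h : z = 0
    · simp [hR, h, K_zero, K_deriv, M_deriv]
    · rw [Pi.div_apply, dslope_of_ne _ h, dslope_of_ne _ h, slope_def_field, slope_def_field,
        K_zero, M_zero, sub_zero, sub_zero, sub_zero]
      rw [dslope_of_ne _ h, slope_def_field, K_zero, sub_zero, sub_zero] at hz
      have hKz : K z ≠ 0 := fun h' ↦ hz (by rw [h', zero_div])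
      simp only [hR, hKz, if_false]
      rw [div_div_div_cancel_right₀ h]
  have diff : Differentiable ℂ R := by
    intro z
    by_cases hz : K z = 0
    · obtain ⟨m, n, hmn⟩ := zeros z hz
      have h1 : R = fun w ↦ R (w - z) := by
        ext w
        rw [← per (w - z) m n, ← hmn, sub_add_cancel]
      rw [h1]
      have h2 : DifferentiableAt ℂ R (z - z) := by simpa using diff_zero
      exact h2.comp z (f := fun w ↦ w - z) (by fun_prop)
    · refine DifferentiableAt.congr_of_eventuallyEq ((hM z).div (hK z) hz) ?_
      filter_upwards [(hK z).continuousAt.eventually_ne hz] with w hw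
      simp [hR, hw]
  have bdd : Bornology.IsBounded (Set.range R) := by
    have hcomp : IsCompact ((fun p : ℝ × ℝ ↦ R ((p.1 : ℂ) + p.2 * τ)) ''
        (Set.Icc 0 1 ×ˢ Set.Icc 0 1)) := by
      refine (isCompact_Icc.prod isCompact_Icc).image ?_
      exact diff.continuous.comp (by fun_prop)
    refine hcomp.isBounded.subset ?_
    rintro _ ⟨z, rfl⟩
    set y : ℝ := z.im / τ.im with hy
    set x : ℝ := z.re - y * τ.re with hx
    have hz : z = (x : ℂ) + y * τ := by
      apply Complex.ext
      · simp [hx]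
      · simp [hy, div_mul_cancel₀ _ hτ.ne']
    refine ⟨(Int.fract x, Int.fract y), ⟨⟨Int.fract_nonneg _, (Int.fract_lt_one _).le⟩,
      ⟨Int.fract_nonneg _, (Int.fract_lt_one _).le⟩⟩, ?_⟩
    refine (per ((Int.fract x : ℝ) + (Int.fract y : ℝ) * τ) ⌊x⌋ ⌊y⌋).symm.trans ?_
    congr 1
    have e1 : ((Int.fract x : ℝ) : ℂ) + (⌊x⌋ : ℂ) = x := by exact_mod_cast Int.fract_add_floor x
    have e2 : ((Int.fract y : ℝ) : ℂ) + (⌊y⌋ : ℂ) = y := by exact_mod_cast Int.fract_add_floor y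
    rw [hz]
    linear_combination e1 + τ * e2
  have hone (z : ℂ) : R z = 1 := by
    rw [diff.apply_eq_apply_of_bounded bdd z 0]
    simp [hR, K_zero]
  -- at the zeros of `K`, the two functions agree by continuity
  have hne (z : ℂ) (hz : K z ≠ 0) : M z = K z := by
    have := hone z
    simp only [hR, hz, if_false] at this
    exact (div_eq_one_iff_eq hz).mp this
  have hMz (z : ℂ) (hz : K z = 0) : M z = 0 := by
    obtain ⟨m, n, rfl⟩ := zeros z hz
    have hM1 (z : ℂ) (h : M z = 0) (m : ℤ) : M (z + m) = 0 := by
      induction m with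
      | zero => simpa using h
      | succ k ih =>
        have := M_one (z + (k : ℤ))
        rw [ih, neg_zero] at this
        rw [← this]
        congr 1
        push_cast
        ring
      | pred k ih =>
        have := M_one (z + ((-k - 1 : ℤ) : ℂ))
        rw [← neg_eq_zero, ← this, ← ih]
        congr 1
        push_cast
        ring
    have hM2 (z : ℂ) (h : M z = 0) (m : ℤ) : M (z + m * τ) = 0 := by
      induction m with
      | zero => simpa using h
      | succ k ih =>
        have := M_τ (z + (k : ℤ) * τ)
        rw [ih, mul_zero] at this
        rw [← this]
        congr 1
        push_cast
        ring
      | pred k ih =>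
        have := M_τ (z + ((-k - 1 : ℤ) : ℂ) * τ)
        have h2 : M (z + ((-k - 1 : ℤ) : ℂ) * τ + τ) = 0 := by
          rw [← ih]
          congr 1
          push_cast
          ring
        rw [h2] at this
        exact (mul_eq_zero.mp this.symm).resolve_left (hμ _)
    have := hM1 0 M_zero m
    rw [zero_add] at this
    exact hM2 _ this n
  ext z
  by_cases hz : K z = 0
  · rw [hz, hMz z hz]
  · exact hne z hz

/-! ### Infinite products -/

lemma differentiableOn_tprod_one_sub {g : ℕ → ℂ → ℂ} {U : Set ℂ} (hU : IsOpen U)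
    (hg : ∀ n, DifferentiableOn ℂ (g n) U)
    (bound : ∀ K ⊆ U, IsCompact K → ∃ u : ℕ → ℝ, Summable u ∧ ∀ n, ∀ x ∈ K, ‖g n x‖ ≤ u n) :
    DifferentiableOn ℂ (fun x ↦ ∏' n, (1 - g n x)) U := by
  have h1 : HasProdLocallyUniformlyOn (fun n x ↦ 1 - g n x) (fun x ↦ ∏' n, (1 - g n x)) U := by
    simp_rw [sub_eq_add_neg]
    apply hasProdLocallyUniformlyOn_of_forall_compact hU
    intro K hKU hK
    obtain ⟨u, hu, hb⟩ := bound K hKU hK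
    exact hu.hasProdUniformlyOn_nat_one_add hK (.of_forall fun n x hx ↦ by simpa using hb n x hx)
      (fun n ↦ ((hg n).continuousOn.mono hKU).neg)
  exact h1.differentiableOn (.of_forall fun s ↦ by
    simpa [Finset.prod_fn] using DifferentiableOn.finsetProd fun n _ ↦ (hg n).const_sub 1) hU

/-- The product `∏ (1 - u qⁿ)`, over `n ≥ 0`. -/
noncomputable def qPoch (q u : ℂ) : ℂ := ∏' n : ℕ, (1 - u * q ^ n)

section qPoch

variable {q : ℂ} (hq : ‖q‖ < 1)
include hq

lemma multipliable_qPoch (u : ℂ) : Multipliable fun n : ℕ ↦ 1 - u * q ^ n := by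
  apply multipliable_one_add_of_summable (f := fun n ↦ -(u * q ^ n))
  simp only [norm_neg, norm_mul, norm_pow]
  exact (summable_geometric_of_lt_one (norm_nonneg _) hq).mul_left _

lemma qPoch_eq_mul (u : ℂ) : qPoch q u = (1 - u) * qPoch q (q * u) := by
  have e (n : ℕ) : 1 - u * q ^ (n + 1) = 1 - q * u * q ^ n := by ring
  have h : Multipliable fun n : ℕ ↦ 1 - u * q ^ (n + 1) := by
    simpa only [e] using multipliable_qPoch hq (q * u)
  have h2 := tprod_eq_zero_mul' (f := fun n : ℕ ↦ 1 - u * q ^ n) h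
  simp only [e, pow_zero, mul_one] at h2
  exact h2

lemma exists_eq_one_of_qPoch_eq_zero {u : ℂ} (h : qPoch q u = 0) : ∃ n : ℕ, u * q ^ n = 1 := by
  by_contra! hne
  refine tprod_one_add_ne_zero_of_summable (f := fun n ↦ -(u * q ^ n)) (fun n h0 ↦ hne n ?_) ?_
    (by simpa [qPoch, sub_eq_add_neg] using h)
  · linear_combination -h0
  · simp only [norm_neg, norm_mul, norm_pow]
    exact (summable_geometric_of_lt_one (norm_nonneg _) hq).mul_left _

lemma qPoch_ne_zero {u : ℂ} (hu : ‖u‖ < 1) : qPoch q u ≠ 0 := by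
  intro h
  obtain ⟨n, hn⟩ := exists_eq_one_of_qPoch_eq_zero hq h
  have h1 : ‖u * q ^ n‖ < 1 := by
    rw [norm_mul, norm_pow]
    exact mul_lt_one_of_nonneg_of_lt_one_left (norm_nonneg _) hu
      (pow_le_one₀ (norm_nonneg _) hq.le)
  rw [hn, norm_one] at h1
  exact lt_irrefl _ h1

lemma differentiable_qPoch : Differentiable ℂ (qPoch q) := by
  rw [← differentiableOn_univ]
  refine differentiableOn_tprod_one_sub isOpen_univ (fun n ↦ by fun_prop) fun K _ hK ↦ ?_
  obtain ⟨C, hC⟩ := hK.isBounded.exists_norm_le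
  refine ⟨fun n ↦ C * ‖q‖ ^ n, (summable_geometric_of_lt_one (norm_nonneg _) hq).mul_left _,
    fun n x hx ↦ ?_⟩
  rw [norm_mul, norm_pow]
  exact mul_le_mul_of_nonneg_right (hC x hx) (by positivity)

end qPoch

/-- As a function of `q`, the product `∏ (1 - c qᵃⁿ⁺ᵇ)` is holomorphic on the unit disc. -/
lemma differentiableOn_qPoch (c : ℂ) {a b : ℕ} (ha : 0 < a) :
    DifferentiableOn ℂ (fun q ↦ qPoch (q ^ a) (c * q ^ b)) (Metric.ball 0 1) := by
  refine differentiableOn_tprod_one_sub Metric.isOpen_ball (fun n ↦ by fun_prop) fun K hKU hK ↦ ?_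
  rcases K.eq_empty_or_nonempty with rfl | hne
  · exact ⟨fun _ ↦ 0, summable_zero, by simp⟩
  obtain ⟨q₀, hq₀, hmax⟩ := hK.exists_isMaxOn hne continuous_norm.continuousOn
  have h1 : ‖q₀‖ < 1 := by simpa using hKU hq₀
  refine ⟨fun n ↦ ‖c‖ * ‖q₀‖ ^ b * (‖q₀‖ ^ a) ^ n, (summable_geometric_of_lt_one (by positivity)
    (pow_lt_one₀ (norm_nonneg _) h1 ha.ne')).mul_left _, fun n x hx ↦ ?_⟩
  have h2 : ‖x‖ ≤ ‖q₀‖ := hmax hx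
  simp only [norm_mul, norm_pow]
  gcongr

end Bimodular

namespace Bimodular

open Filter Real

/-! ### The odd theta function and Klein forms -/

/-- `exp (2 π i z)`. -/
noncomputable def nome (z : ℂ) : ℂ := Complex.exp (2 * π * Complex.I * z)

lemma nome_add (z w : ℂ) : nome (z + w) = nome z * nome w := by
  rw [nome, nome, nome, ← Complex.exp_add, mul_add]

lemma nome_neg (z : ℂ) : nome (-z) = (nome z)⁻¹ := by
  rw [nome, nome, ← Complex.exp_neg, mul_neg]

lemma nome_ne_zero (z : ℂ) : nome z ≠ 0 := Complex.exp_ne_zero _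

lemma nome_zero : nome 0 = 1 := by simp [nome]

lemma nome_one : nome 1 = 1 := by simp [nome, Complex.exp_two_pi_mul_I]

lemma nome_nat_mul (n : ℕ) (z : ℂ) : nome (n * z) = nome z ^ n := by
  rw [nome, nome, ← Complex.exp_nat_mul]
  congr 1
  ring

lemma nome_eq_one {z : ℂ} (h : nome z = 1) : ∃ m : ℤ, z = m := by
  obtain ⟨m, hm⟩ := Complex.exp_eq_one_iff.mp h
  exact ⟨m, mul_left_cancel₀ Complex.two_pi_I_ne_zero (by rw [hm]; ring)⟩

lemma norm_nome (z : ℂ) : ‖nome z‖ = Real.exp (-2 * π * z.im) := by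
  rw [nome, Complex.norm_exp]
  simp

lemma norm_nome_lt_one {z : ℂ} (hz : 0 < z.im) : ‖nome z‖ < 1 := by
  rw [norm_nome, Real.exp_lt_one_iff]
  have := Real.pi_pos
  nlinarith

lemma differentiable_nome : Differentiable ℂ nome := by
  unfold nome
  fun_prop

/-- The odd theta function `θ₁`, divided by its derivative at the origin, as a function of the
elliptic variable `z`. -/
noncomputable def oddTheta (τ z : ℂ) : ℂ :=
  Complex.sin (π * z) / π * (qPoch (nome τ) (nome τ * nome z) *
    qPoch (nome τ) (nome τ * nome (-z)) / qPoch (nome τ) (nome τ) ^ 2)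

lemma oddTheta_neg (τ z : ℂ) : oddTheta τ (-z) = -oddTheta τ z := by
  simp only [oddTheta, mul_neg, Complex.sin_neg, neg_neg]
  ring

lemma oddTheta_add_one (τ z : ℂ) : oddTheta τ (z + 1) = -oddTheta τ z := by
  have h : nome (-(z + 1)) = nome (-z) := by
    rw [nome_neg, nome_neg, nome_add, nome_one, mul_one]
  rw [oddTheta, oddTheta, h, nome_add, nome_one, mul_one, mul_add, mul_one, Complex.sin_add_pi]
  ring

lemma oddTheta_add_one_left (τ z : ℂ) : oddTheta (τ + 1) z = oddTheta τ z := by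
  simp only [oddTheta, nome_add, nome_one, mul_one]

lemma oddTheta_zero (τ : ℂ) : oddTheta τ 0 = 0 := by simp [oddTheta]

section

variable {τ : ℂ} (hτ : 0 < τ.im)
include hτ

lemma oddTheta_eq (z : ℂ) : oddTheta τ z = Complex.I / (2 * π) / qPoch (nome τ) (nome τ) ^ 2 *
    (Complex.exp (-(π * Complex.I * z)) * qPoch (nome τ) (nome z) *
      qPoch (nome τ) (nome τ * nome (-z))) := by
  have h1 : Complex.sin (π * z) =
      Complex.I / 2 * (Complex.exp (-(π * Complex.I * z)) * (1 - nome z)) := by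
    have h2 : nome z = Complex.exp (π * Complex.I * z) * Complex.exp (π * Complex.I * z) := by
      rw [nome, ← Complex.exp_add]
      congr 1
      ring
    have h3 : Complex.exp (π * Complex.I * z) * Complex.exp (-(π * Complex.I * z)) = 1 := by
      rw [← Complex.exp_add, add_neg_cancel, Complex.exp_zero]
    rw [Complex.sin, h2, show -(π * z) * Complex.I = -(π * Complex.I * z) by ring,
      show π * z * Complex.I = π * Complex.I * z by ring]
    linear_combination Complex.I / 2 * Complex.exp (π * Complex.I * z) * h3
  rw [oddTheta, h1, qPoch_eq_mul (norm_nome_lt_one hτ) (nome z)]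
  ring

lemma oddTheta_add_period (z : ℂ) : oddTheta τ (z + τ) =
    -Complex.exp (-(π * Complex.I * τ) - 2 * π * Complex.I * z) * oddTheta τ z := by
  rw [oddTheta_eq hτ, oddTheta_eq hτ, qPoch_eq_mul (norm_nome_lt_one hτ) (nome z), neg_add,
    nome_add, nome_add, nome_neg τ, mul_comm (nome (-z)), mul_inv_cancel_left₀ (nome_ne_zero τ),
    qPoch_eq_mul (norm_nome_lt_one hτ) (nome (-z)), mul_comm (nome z) (nome τ),
    show -(π * Complex.I * (z + τ)) = -(π * Complex.I * τ) + -(π * Complex.I * z) by ring,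
    Complex.exp_add, show -(π * Complex.I * τ) - 2 * π * Complex.I * z =
      -(π * Complex.I * τ) + 2 * π * Complex.I * -z by ring, Complex.exp_add, ← nome]
  have h : nome z * nome (-z) = 1 := by rw [← nome_add, add_neg_cancel, nome_zero]
  linear_combination -(Complex.I / (2 * π) / qPoch (nome τ) (nome τ) ^ 2 *
    Complex.exp (-(π * Complex.I * τ)) * Complex.exp (-(π * Complex.I * z)) *
    qPoch (nome τ) (nome τ * nome z) * qPoch (nome τ) (nome τ * nome (-z))) * h

lemma differentiable_oddTheta : Differentiable ℂ (oddTheta τ) := by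
  have h := differentiable_qPoch (norm_nome_lt_one hτ)
  have h1 : Differentiable ℂ fun z ↦ qPoch (nome τ) (nome τ * nome z) :=
    h.comp (differentiable_nome.const_mul _)
  have h2 : Differentiable ℂ fun z ↦ qPoch (nome τ) (nome τ * nome (-z)) :=
    h1.comp differentiable_neg
  unfold oddTheta
  fun_prop

lemma deriv_oddTheta_zero : deriv (oddTheta τ) 0 = 1 := by
  have hq := norm_nome_lt_one hτ
  have h := differentiable_qPoch hq
  have h1 : Differentiable ℂ fun z ↦ qPoch (nome τ) (nome τ * nome z) :=
    h.comp (differentiable_nome.const_mul _)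
  have h2 : Differentiable ℂ fun z ↦ qPoch (nome τ) (nome τ * nome (-z)) :=
    h1.comp differentiable_neg
  have h3 : DifferentiableAt ℂ (fun z ↦ qPoch (nome τ) (nome τ * nome z) *
      qPoch (nome τ) (nome τ * nome (-z)) / qPoch (nome τ) (nome τ) ^ 2) 0 := by fun_prop
  have h4 : HasDerivAt (fun z : ℂ ↦ Complex.sin (π * z) / π) 1 0 := by
    have h5 : HasDerivAt (fun z : ℂ ↦ (π : ℂ) * z) π 0 := by
      simpa using (hasDerivAt_id (0 : ℂ)).const_mul (π : ℂ)
    have h6 := h5.csin.div_const (π : ℂ)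
    simpa [Complex.ofReal_ne_zero.mpr Real.pi_ne_zero] using h6
  have h5 := (h4.mul h3.hasDerivAt).deriv
  have h6 := qPoch_ne_zero hq hq
  refine h5.trans ?_
  simp only [neg_zero, nome_zero, mul_one, mul_zero, Complex.sin_zero, zero_div, zero_mul, add_zero,
    one_mul]
  field_simp

lemma exists_of_oddTheta_eq_zero {z : ℂ} (h : oddTheta τ z = 0) : ∃ m n : ℤ, z = m + n * τ := by
  have hq := norm_nome_lt_one hτ
  have hpi : (π : ℂ) ≠ 0 := Complex.ofReal_ne_zero.mpr Real.pi_ne_zero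
  have key (z : ℂ) (h0 : qPoch (nome τ) (nome τ * nome z) = 0) : ∃ m n : ℤ, z = m + n * τ := by
    obtain ⟨n, hn⟩ := exists_eq_one_of_qPoch_eq_zero hq h0
    rw [← nome_nat_mul, ← nome_add, ← nome_add] at hn
    obtain ⟨m, hm⟩ := nome_eq_one hn
    refine ⟨m, -(n + 1), ?_⟩
    push_cast
    linear_combination hm
  rw [oddTheta, mul_eq_zero, div_eq_zero_iff, div_eq_zero_iff, mul_eq_zero] at h
  rcases h with (h | h) | (h | h) | h
  · obtain ⟨k, hk⟩ := Complex.sin_eq_zero_iff.mp h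
    exact ⟨k, 0, by
      rw [Int.cast_zero, zero_mul, add_zero]
      exact mul_left_cancel₀ hpi (by rw [hk]; ring)⟩
  · exact absurd h hpi
  · exact key z h
  · obtain ⟨m, n, hmn⟩ := key (-z) h
    exact ⟨-m, -n, by push_cast; linear_combination -hmn⟩
  · exact absurd h (pow_ne_zero _ (qPoch_ne_zero hq hq))

/-- The transformation of the odd theta function under `τ ↦ -1/τ`: both sides have the same
quasi-periods and the same zeros. -/
lemma oddTheta_neg_inv (z : ℂ) : oddTheta (-τ⁻¹) (z / τ) =
    τ⁻¹ * Complex.exp (π * Complex.I * z ^ 2 / τ) * oddTheta τ z := by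
  have hτ0 : τ ≠ 0 := fun h ↦ by simp [h] at hτ
  have hτ' : 0 < (-τ⁻¹).im := by
    rw [Complex.neg_im, Complex.inv_im, neg_div, neg_neg]
    exact div_pos hτ (Complex.normSq_pos.mpr hτ0)
  have hd := differentiable_oddTheta hτ'
  have key : (fun z ↦ τ * Complex.exp (-(π * Complex.I * z ^ 2 / τ)) *
      oddTheta (-τ⁻¹) (z / τ)) = oddTheta τ := by
    refine eq_of_quasiPeriodic hτ
      (μ := fun z ↦ -Complex.exp (-(π * Complex.I * τ) - 2 * π * Complex.I * z))
      (fun z ↦ neg_ne_zero.mpr (Complex.exp_ne_zero _))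
      (differentiable_oddTheta hτ) ?_ (oddTheta_add_one τ) ?_ (oddTheta_add_period hτ) ?_
      (oddTheta_zero τ) (by simp [oddTheta_zero]) (deriv_oddTheta_zero hτ) ?_
      fun z h ↦ exists_of_oddTheta_eq_zero hτ h
    · fun_prop
    · intro z
      have h := oddTheta_add_period hτ' (z / τ - -τ⁻¹)
      rw [sub_add_cancel, show z / τ - -τ⁻¹ = (z + 1) / τ by field_simp; ring] at h
      have e : Complex.exp (-(π * Complex.I * z ^ 2 / τ)) =
          Complex.exp (-(π * Complex.I * (z + 1) ^ 2 / τ)) *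
          (Complex.exp (-(π * Complex.I * -τ⁻¹) - 2 * π * Complex.I * ((z + 1) / τ)))⁻¹ := by
        rw [← Complex.exp_neg, ← Complex.exp_add]
        congr 1
        field_simp
        ring
      rw [h, e]
      field_simp [Complex.exp_ne_zero]
    · intro z
      have e : -(π * Complex.I * (z + τ) ^ 2 / τ) = -(π * Complex.I * z ^ 2 / τ) +
          (-(π * Complex.I * τ) - 2 * π * Complex.I * z) := by
        field_simp
        ring
      rw [add_div, div_self hτ0, oddTheta_add_one, e, Complex.exp_add]
      ring
    · have h1 : HasDerivAt (fun z : ℂ ↦ oddTheta (-τ⁻¹) (z / τ)) τ⁻¹ 0 := by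
        have h2 := (hd (0 / τ)).hasDerivAt
        rw [zero_div, deriv_oddTheta_zero hτ', ← zero_div τ] at h2
        have h3 := h2.comp 0 ((hasDerivAt_id (0 : ℂ)).div_const τ)
        rw [one_mul, one_div] at h3
        exact h3
      have h2 : DifferentiableAt ℂ
        (fun z : ℂ ↦ τ * Complex.exp (-(π * Complex.I * z ^ 2 / τ))) 0 := by fun_prop
      refine (h2.hasDerivAt.mul h1).deriv.trans ?_
      simp [oddTheta_zero, hτ0]
  rw [← congrFun key z]
  have h : Complex.exp (π * Complex.I * z ^ 2 / τ) *
      Complex.exp (-(π * Complex.I * z ^ 2 / τ)) = 1 := by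
    rw [← Complex.exp_add, add_neg_cancel, Complex.exp_zero]
  linear_combination (-oddTheta (-τ⁻¹) (z / τ)) * h -
    Complex.exp (π * Complex.I * z ^ 2 / τ) * Complex.exp (-(π * Complex.I * z ^ 2 / τ)) *
      oddTheta (-τ⁻¹) (z / τ) * (inv_mul_cancel₀ hτ0)

end

/-- The Klein form with characteristic `(a, b)`, up to normalization. -/
noncomputable def klein (a b τ : ℂ) : ℂ :=
  Complex.exp (π * Complex.I * a * (a * τ + b)) * oddTheta τ (a * τ + b)

lemma klein_neg (a b τ : ℂ) : klein (-a) (-b) τ = -klein a b τ := by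
  rw [klein, klein, show -a * τ + -b = -(a * τ + b) by ring, oddTheta_neg,
    show π * Complex.I * -a * -(a * τ + b) = π * Complex.I * a * (a * τ + b) by ring, mul_neg]

lemma klein_add_one_left (a b τ : ℂ) : klein a b (τ + 1) = klein a (a + b) τ := by
  rw [klein, klein, oddTheta_add_one_left, show a * (τ + 1) + b = a * τ + (a + b) by ring]

lemma klein_add_one_right (a b τ : ℂ) :
    klein a (b + 1) τ = -Complex.exp (π * Complex.I * a) * klein a b τ := by
  rw [klein, klein, ← add_assoc, oddTheta_add_one,
    show π * Complex.I * a * (a * τ + b + 1) = π * Complex.I * a + π * Complex.I * a * (a * τ + b)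
      by ring, Complex.exp_add]
  ring

lemma klein_add_one {τ : ℂ} (hτ : 0 < τ.im) (a b : ℂ) :
    klein (a + 1) b τ = -Complex.exp (-(π * Complex.I * b)) * klein a b τ := by
  rw [klein, klein, show (a + 1) * τ + b = a * τ + b + τ by ring, oddTheta_add_period hτ,
    show π * Complex.I * (a + 1) * (a * τ + b + τ) = -(π * Complex.I * b) +
      π * Complex.I * a * (a * τ + b) - (-(π * Complex.I * τ) - 2 * π * Complex.I * (a * τ + b))
      by ring, Complex.exp_sub, Complex.exp_add]
  field_simp [Complex.exp_ne_zero]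

lemma klein_neg_inv {τ : ℂ} (hτ : 0 < τ.im) (a b : ℂ) :
    klein a b (-τ⁻¹) = τ⁻¹ * klein b (-a) τ := by
  have hτ0 : τ ≠ 0 := fun h ↦ by simp [h] at hτ
  rw [klein, klein, show a * -τ⁻¹ + b = (b * τ + -a) / τ by field_simp; ring, oddTheta_neg_inv hτ,
    show π * Complex.I * b * (b * τ + -a) = π * Complex.I * a * ((b * τ + -a) / τ) +
      π * Complex.I * (b * τ + -a) ^ 2 / τ by field_simp; ring, Complex.exp_add]
  ring

end Bimodular

namespace Bimodular

open Filter Real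

/-! ### Products over residue classes modulo five -/

/-- The product of `1 - qⁿ` over the positive integers `n ≡ r (mod 5)`, for `1 ≤ r ≤ 5`. -/
noncomputable def fifth (r : ℕ) (q : ℂ) : ℂ := qPoch (q ^ 5) (q ^ r)

lemma norm_pow_five_lt_one {q : ℂ} (hq : ‖q‖ < 1) : ‖q ^ 5‖ < 1 := by
  rw [norm_pow]
  exact pow_lt_one₀ (norm_nonneg _) hq (by norm_num)

lemma fifth_ne_zero {r : ℕ} (hr : r ≠ 0) {q : ℂ} (hq : ‖q‖ < 1) : fifth r q ≠ 0 :=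
  qPoch_ne_zero (norm_pow_five_lt_one hq) (by
    rw [norm_pow]
    exact pow_lt_one₀ (norm_nonneg _) hq hr)

lemma differentiableOn_fifth (r : ℕ) : DifferentiableOn ℂ (fifth r) (Metric.ball 0 1) := by
  have h := differentiableOn_qPoch 1 (a := 5) (b := r) (by norm_num)
  simp only [one_mul] at h
  exact h

lemma tendsto_qPoch (c : ℂ) {a b : ℕ} (ha : 0 < a) (hb : b ≠ 0) :
    Tendsto (fun q ↦ qPoch (q ^ a) (c * q ^ b)) (𝓝 0) (𝓝 1) := by
  have h := ((differentiableOn_qPoch c (b := b) ha).differentiableAt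
    (Metric.ball_mem_nhds (0 : ℂ) one_pos)).continuousAt.tendsto
  simpa [qPoch, hb] using h

lemma tendsto_fifth {r : ℕ} (hr : r ≠ 0) : Tendsto (fifth r) (𝓝 0) (𝓝 1) := by
  have h := tendsto_qPoch 1 (a := 5) (by norm_num) hr
  simp only [one_mul] at h
  exact h

lemma hasProd_fifth {q : ℂ} (hq : ‖q‖ < 1) {r : ℕ} (h0 : 0 < r) (h5 : r < 5) :
    HasProd (fun n : ℕ ↦ if (n + 1) % 5 = r then 1 - q ^ (n + 1) else 1) (fifth r q) := by
  have hinj : Function.Injective fun k : ℕ ↦ 5 * k + (r - 1) := fun a b h ↦ by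
    simp only at h
    omega
  refine (hinj.hasProd_iff fun n hn ↦ if_neg fun h ↦ hn ⟨n / 5, ?_⟩).mp ?_
  · simp only
    omega
  · have h := (multipliable_qPoch (norm_pow_five_lt_one hq) (q ^ r)).hasProd
    refine h.congr_fun fun k ↦ ?_
    have h1 : 5 * k + (r - 1) + 1 = r + 5 * k := by omega
    have h2 : (r + 5 * k) % 5 = r := by omega
    simp only [Function.comp_apply, h1, h2, if_true]
    rw [pow_add, pow_mul]

lemma jacobiSym_five (n : ℕ) : jacobiSym (n : ℤ) 5 =
    if n % 5 = 1 ∨ n % 5 = 4 then 1 else if n % 5 = 2 ∨ n % 5 = 3 then -1 else 0 := by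
  rw [jacobiSym.mod_left]
  have h1 : ((n : ℤ) % (5 : ℕ)) = ((n % 5 : ℕ) : ℤ) := by push_cast; rfl
  rw [h1]
  have h2 : n % 5 < 5 := Nat.mod_lt _ (by norm_num)
  interval_cases n % 5 <;> norm_num

lemma coe_q_eq_nome (τ : ℍ) : Sporadic.q τ = nome τ := rfl

lemma norm_nome_coe_lt_one (τ : ℍ) : ‖nome τ‖ < 1 := norm_nome_lt_one τ.im_pos

lemma t_case11_eq (τ : ℍ) : Sporadic.case11.t τ = nome τ *
    ((fifth 1 (nome τ) * fifth 4 (nome τ)) / (fifth 2 (nome τ) * fifth 3 (nome τ))) ^ 5 := by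
  have hq := norm_nome_coe_lt_one τ
  simp only [Sporadic.t, coe_q_eq_nome]
  congr 1
  have h1 := hasProd_fifth hq (r := 1) (by norm_num) (by norm_num)
  have h2 := hasProd_fifth hq (r := 2) (by norm_num) (by norm_num)
  have h3 := hasProd_fifth hq (r := 3) (by norm_num) (by norm_num)
  have h4 := hasProd_fifth hq (r := 4) (by norm_num) (by norm_num)
  have h23 := (h2.mul h3).inv₀ (mul_ne_zero (fifth_ne_zero two_ne_zero hq)
    (fifth_ne_zero three_ne_zero hq))
  rw [div_eq_mul_inv, ← (((h1.mul h4).mul h23).pow 5).tprod_eq]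
  refine tprod_congr fun n ↦ ?_
  rw [jacobiSym_five]
  have h5 : (n + 1) % 5 < 5 := Nat.mod_lt _ (by norm_num)
  have z1 (x : ℂ) : x ^ (5 : ℤ) = x ^ 5 := by norm_cast
  have z2 (x : ℂ) : x ^ (-5 : ℤ) = (x ^ 5)⁻¹ := by rw [zpow_neg, z1]
  interval_cases (n + 1) % 5 <;> simp [z1, z2]

lemma f_case11_eq (τ : ℍ) : Sporadic.case11.f τ = fifth 5 (nome τ) ^ 2 *
    (fifth 2 (nome τ) * fifth 3 (nome τ)) ^ 2 / (fifth 1 (nome τ) * fifth 4 (nome τ)) ^ 3 := by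
  have hq := norm_nome_coe_lt_one τ
  simp only [Sporadic.f, coe_q_eq_nome]
  have h1 := hasProd_fifth hq (r := 1) (by norm_num) (by norm_num)
  have h2 := hasProd_fifth hq (r := 2) (by norm_num) (by norm_num)
  have h3 := hasProd_fifth hq (r := 3) (by norm_num) (by norm_num)
  have h4 := hasProd_fifth hq (r := 4) (by norm_num) (by norm_num)
  have h5 := (multipliable_qPoch (norm_pow_five_lt_one hq) (nome τ ^ 5)).hasProd.pow 2
  have h14 := ((h1.mul h4).pow 3).inv₀ (pow_ne_zero 3 (mul_ne_zero (fifth_ne_zero one_ne_zero hq)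
    (fifth_ne_zero four_ne_zero hq)))
  have h23 := (h2.mul h3).pow 2
  rw [div_eq_mul_inv, mul_right_comm, ← h23.tprod_eq, ← h14.tprod_eq, fifth, qPoch, ← h5.tprod_eq]
  congr 1
  · congr 1
    · refine tprod_congr fun n ↦ ?_
      rw [← pow_mul, ← pow_add, show 5 * (n + 1) = 5 + 5 * n by ring]
    · refine tprod_congr fun n ↦ ?_
      have h5 : (n + 1) % 5 < 5 := Nat.mod_lt _ (by norm_num)
      interval_cases (n + 1) % 5 <;> simp
  · refine tprod_congr fun n ↦ ?_
    have h5 : (n + 1) % 5 < 5 := Nat.mod_lt _ (by norm_num)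
    interval_cases (n + 1) % 5 <;> simp

/-! ### Level five -/

lemma klein_fifth {τ : ℂ} (hτ : 0 < τ.im) (r : ℕ) (hr : r ≤ 5) : klein (r / 5) 0 (5 * τ) =
    Complex.I / (2 * π) / fifth 5 (nome τ) ^ 2 *
      Complex.exp (π * Complex.I * (r ^ 2 / 5 - r) * τ) *
      (fifth r (nome τ) * fifth (5 - r) (nome τ)) := by
  have h5 : 0 < (5 * τ).im := by simpa using hτ
  have e1 : nome (5 * τ) = nome τ ^ 5 := by exact_mod_cast nome_nat_mul 5 τ
  have e2 : nome (r / 5 * (5 * τ) + 0) = nome τ ^ r := by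
    rw [← nome_nat_mul]
    congr 1
    ring
  have e3 : nome (5 * τ) * nome (-(r / 5 * (5 * τ) + 0)) = nome τ ^ (5 - r) := by
    rw [← nome_add, ← nome_nat_mul, Nat.cast_sub hr]
    congr 1
    push_cast
    ring
  have e4 : π * Complex.I * (r ^ 2 / 5 - r) * τ = π * Complex.I * (r / 5) * (r / 5 * (5 * τ) + 0) +
      -(π * Complex.I * (r / 5 * (5 * τ) + 0)) := by ring
  rw [klein, oddTheta_eq h5, e3, e2, e1, e4, Complex.exp_add]
  simp only [fifth]
  ring

lemma f_case11_eq_klein (τ : ℍ) : Sporadic.case11.f τ = Complex.I / (2 * π) *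
    klein (2 / 5) 0 (5 * τ) ^ 2 / klein (1 / 5) 0 (5 * τ) ^ 3 := by
  have h1 := klein_fifth τ.im_pos 1 (by norm_num)
  have h2 := klein_fifth τ.im_pos 2 (by norm_num)
  have hq := norm_nome_coe_lt_one τ
  have n1 := fifth_ne_zero one_ne_zero hq
  have n4 := fifth_ne_zero four_ne_zero hq
  have n5 := fifth_ne_zero (show 5 ≠ 0 by norm_num) hq
  have hpi : (π : ℂ) ≠ 0 := Complex.ofReal_ne_zero.mpr Real.pi_ne_zero
  push_cast at h1 h2
  rw [f_case11_eq, h1, h2]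
  have e : Complex.exp (π * Complex.I * (2 ^ 2 / 5 - 2) * τ) ^ 2 =
      Complex.exp (π * Complex.I * (1 ^ 2 / 5 - 1) * τ) ^ 3 := by
    rw [← Complex.exp_nat_mul, ← Complex.exp_nat_mul]
    congr 1
    push_cast
    ring
  have e' := Complex.exp_ne_zero (π * Complex.I * (1 ^ 2 / 5 - 1) * τ)
  simp only [mul_pow, e]
  field_simp

lemma tf_case11_eq_klein (τ : ℍ) : (Sporadic.case11.t * Sporadic.case11.f) τ =
    Complex.I / (2 * π) * klein (1 / 5) 0 (5 * τ) ^ 2 / klein (2 / 5) 0 (5 * τ) ^ 3 := by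
  have h1 := klein_fifth τ.im_pos 1 (by norm_num)
  have h2 := klein_fifth τ.im_pos 2 (by norm_num)
  have hq := norm_nome_coe_lt_one τ
  have n1 := fifth_ne_zero one_ne_zero hq
  have n2 := fifth_ne_zero two_ne_zero hq
  have n3 := fifth_ne_zero three_ne_zero hq
  have n4 := fifth_ne_zero four_ne_zero hq
  have n5 := fifth_ne_zero (show 5 ≠ 0 by norm_num) hq
  have hpi : (π : ℂ) ≠ 0 := Complex.ofReal_ne_zero.mpr Real.pi_ne_zero
  push_cast at h1 h2
  rw [Pi.mul_apply, t_case11_eq, f_case11_eq, h1, h2]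
  have e : Complex.exp (π * Complex.I * (1 ^ 2 / 5 - 1) * τ) ^ 2 = nome τ *
      Complex.exp (π * Complex.I * (2 ^ 2 / 5 - 2) * τ) ^ 3 := by
    rw [← Complex.exp_nat_mul, ← Complex.exp_nat_mul, nome, ← Complex.exp_add]
    congr 1
    push_cast
    ring
  have e' := Complex.exp_ne_zero (π * Complex.I * (2 ^ 2 / 5 - 2) * τ)
  simp only [mul_pow, div_pow, e]
  field_simp

lemma klein_zero_left (b τ : ℂ) : klein 0 b τ = oddTheta τ b := by simp [klein]

/-- The transform `(t f)|s₂`, respectively `f|s₂`, for `r = 1`, `s = 2`, respectively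
`r = 2`, `s = 1`. -/
noncomputable def frickeTransform (r s : ℂ) (τ : ℍ) : ℂ :=
  -(Complex.I * (√5 : ℝ) / (10 * π)) * oddTheta τ (r / 5) ^ 2 / oddTheta τ (s / 5) ^ 3

lemma slashEq_frickeTransform {φ : ℍ → ℂ} {r s : ℂ}
    (h : ∀ τ : ℍ, φ τ = Complex.I / (2 * π) * klein (r / 5) 0 (5 * τ) ^ 2 /
      klein (s / 5) 0 (5 * τ) ^ 3) :
    SlashEq φ (realOf !![0, -1; 5, 0] (by decide)) (frickeTransform r s) := by
  intro τ
  have h5 : ((√5 : ℝ) : ℂ) ≠ 0 := by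
    exact_mod_cast (Real.sqrt_pos.mpr (by norm_num : (0 : ℝ) < 5)).ne'
  have e : (5 : ℂ) * ((realOf !![0, -1; 5, 0] (by decide) • τ : ℍ) : ℂ) = -(τ : ℂ)⁻¹ := by
    rw [coe_realOf_smul]
    simp
    field_simp
  have e2 : autFactor (realOf !![0, -1; 5, 0] (by decide)) τ = 5 * (τ : ℂ) / (√5 : ℝ) := by
    rw [autFactor_realOf]
    simp
  have hτ := τ.ne_zero
  rw [h, e, e2, klein_neg_inv τ.im_pos, klein_neg_inv τ.im_pos, klein_zero_left, klein_zero_left,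
    oddTheta_neg, oddTheta_neg, frickeTransform]
  field_simp
  ring

lemma klein_slash (τ : ℍ) (a : ℂ) :
    klein a 0 (5 * ((realOf !![2, -1; 5, -2] (by decide) • τ : ℍ) : ℂ)) =
      (5 * (τ : ℂ) - 2)⁻¹ * klein (2 * a) (-(5 * a)) (5 * τ) := by
  have him : 0 < (5 * (τ : ℂ) - 2).im := by simpa using τ.im_pos
  have h0 : 5 * (τ : ℂ) - 2 ≠ 0 := fun h ↦ by simp [h] at him
  have e : 5 * ((realOf !![2, -1; 5, -2] (by decide) • τ : ℍ) : ℂ) =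
      -(5 * (τ : ℂ) - 2)⁻¹ + 1 + 1 := by
    rw [coe_realOf_smul]
    simp only [Matrix.of_apply, Matrix.cons_val', Matrix.cons_val_zero, Matrix.cons_val_one,
      Matrix.cons_val_fin_one]
    push_cast
    rw [← sub_eq_add_neg, ← sub_eq_add_neg]
    field_simp
    ring
  rw [e, klein_add_one_left, klein_add_one_left, klein_neg_inv him,
    show 5 * (τ : ℂ) = 5 * (τ : ℂ) - 2 + 1 + 1 by ring, klein_add_one_left, klein_add_one_left,
    show 5 * (τ : ℂ) - 2 + 1 + 1 - 2 = 5 * (τ : ℂ) - 2 by ring]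
  congr 2 <;> ring

lemma slashEq_f_case11 : SlashEq Sporadic.case11.f (realOf !![2, -1; 5, -2] (by decide))
    ((-1 : ℂ) • (Sporadic.case11.t * Sporadic.case11.f)) := by
  intro τ
  have e2 : autFactor (realOf !![2, -1; 5, -2] (by decide)) τ = 5 * (τ : ℂ) - 2 := by
    rw [autFactor_realOf]
    simp [Matrix.det_fin_two]
    ring
  have him : 0 < (5 * (τ : ℂ) - 2).im := by simpa using τ.im_pos
  have h0 : 5 * (τ : ℂ) - 2 ≠ 0 := fun h ↦ by simp [h] at him
  have h5 : 0 < (5 * (τ : ℂ)).im := by simpa using τ.im_pos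
  have E (x : ℂ) := Complex.exp_ne_zero x
  have k1 : klein (2 * (1 / 5)) (-(5 * (1 / 5))) (5 * τ) =
      -Complex.exp (-(2 * π * Complex.I / 5)) * klein (2 / 5) 0 (5 * τ) := by
    have h := klein_add_one_right (2 / 5) (-1) (5 * τ)
    rw [neg_add_cancel] at h
    rw [h, show π * Complex.I * (2 / 5) = 2 * π * Complex.I / 5 by ring, Complex.exp_neg,
      show (2 : ℂ) * (1 / 5) = 2 / 5 by ring, show -((5 : ℂ) * (1 / 5)) = -1 by ring]
    field_simp [E]
  have k2 : klein (2 * (2 / 5)) (-(5 * (2 / 5))) (5 * τ) =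
      Complex.exp (-(8 * π * Complex.I / 5)) * klein (1 / 5) 0 (5 * τ) := by
    have h := klein_add_one_right (4 / 5) (-1) (5 * τ)
    have h' := klein_add_one_right (4 / 5) (-2) (5 * τ)
    have h2 := klein_add_one h5 (-(1 / 5)) 0
    have h3 := klein_neg (1 / 5) 0 (5 * τ)
    rw [neg_add_cancel] at h
    rw [show (-2 : ℂ) + 1 = -1 by ring] at h'
    rw [neg_zero] at h3
    rw [mul_zero, neg_zero, Complex.exp_zero, h3, show (-(1 / 5) + 1 : ℂ) = 4 / 5 by ring,
      h, h'] at h2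
    have h4 : klein (1 / 5) 0 (5 * τ) = Complex.exp (8 * π * Complex.I / 5) *
        klein (4 / 5) (-2) (5 * τ) := by
      rw [show 8 * π * Complex.I / 5 = π * Complex.I * (4 / 5) + π * Complex.I * (4 / 5) by ring,
        Complex.exp_add]
      linear_combination -h2
    rw [h4, Complex.exp_neg, show (2 : ℂ) * (2 / 5) = 4 / 5 by ring,
      show -((5 : ℂ) * (2 / 5)) = -2 by ring, inv_mul_cancel_left₀ (E _)]
  have e : Complex.exp (-(8 * π * Complex.I / 5)) ^ 2 =
      Complex.exp (-(2 * π * Complex.I / 5)) ^ 3 := by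
    rw [← Complex.exp_nat_mul, ← Complex.exp_nat_mul, Complex.exp_eq_exp_iff_exists_int]
    exact ⟨-1, by push_cast; ring⟩
  rw [f_case11_eq_klein, Pi.smul_apply, tf_case11_eq_klein, e2, klein_slash, klein_slash, k1, k2]
  have hpi : (π : ℂ) ≠ 0 := Complex.ofReal_ne_zero.mpr Real.pi_ne_zero
  simp only [mul_pow, e, smul_eq_mul]
  have := E (-(2 * π * Complex.I / 5))
  field_simp

end Bimodular

namespace Bimodular

open Filter Real Asymptotics

/-! ### The analytic data of the case of level five -/

lemma tendsto_nome_atImInfty : Tendsto (fun τ : ℍ ↦ nome τ) atImInfty (𝓝 0) := by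
  rw [tendsto_zero_iff_norm_tendsto_zero]
  simp only [norm_nome]
  refine Real.tendsto_exp_atBot.comp ?_
  refine Tendsto.const_mul_atTop_of_neg ?_ tendsto_comap
  linarith [Real.pi_pos]

lemma nome_coe_T_smul (τ : ℍ) : nome ((intToReal ModularGroup.T • τ : ℍ) : ℂ) = nome τ := by
  rw [coe_T_smul, nome_add, nome_one, mul_one]

lemma mdifferentiable_comp_nome {g : ℂ → ℂ} (hg : DifferentiableOn ℂ g (Metric.ball 0 1)) :
    MDifferentiable 𝓘(ℂ) 𝓘(ℂ) fun τ : ℍ ↦ g (nome τ) := by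
  rw [UpperHalfPlane.mdifferentiable_iff]
  refine (hg.comp differentiable_nome.differentiableOn (s := {z : ℂ | 0 < z.im})
    fun z hz ↦ ?_).congr fun z hz ↦ ?_
  · simpa using norm_nome_lt_one hz
  · simp [ofComplex_apply_of_im_pos hz]

lemma tendsto_oddTheta (b : ℂ) : Tendsto (fun τ : ℍ ↦ oddTheta τ b) atImInfty
    (𝓝 (Complex.sin (π * b) / π)) := by
  have h (c : ℂ) : Tendsto (fun τ : ℍ ↦ qPoch (nome τ) (nome τ * c)) atImInfty (𝓝 1) := by
    have h1 := (tendsto_qPoch c one_pos one_ne_zero).comp tendsto_nome_atImInfty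
    simpa only [Function.comp_def, pow_one, mul_comm c] using h1
  have h1 := h 1
  simp only [mul_one] at h1
  have h2 := (((h (nome b)).mul (h (nome (-b)))).div (h1.pow 2) (by norm_num)).const_mul
    (Complex.sin (π * b) / π)
  simpa [oddTheta] using h2

lemma sin_two_pi_div_five : Real.sin (π * (2 / 5)) = (1 + √5) / 2 * Real.sin (π * (1 / 5)) := by
  rw [show π * (2 / 5) = 2 * (π / 5) by ring, show π * (1 / 5) = π / 5 by ring, Real.sin_two_mul,
    Real.cos_pi_div_five]
  ring

lemma sin_sq_pi_div_five : Real.sin (π * (1 / 5)) ^ 2 = (5 - √5) / 8 := by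
  have h := Real.sin_sq_add_cos_sq (π * (1 / 5))
  have h5 := Real.sq_sqrt (by norm_num : (0 : ℝ) ≤ 5)
  rw [show π * (1 / 5) = π / 5 by ring, Real.cos_pi_div_five] at h
  rw [show π * (1 / 5) = π / 5 by ring]
  linear_combination h - 1 / 16 * h5

theorem formData_case11 : ∃ κ l φ₂ φ₃, FormData Sporadic.case11.α Sporadic.case11.β
    Sporadic.case11.t Sporadic.case11.f (realOf !![2, -1; 5, -2] (by decide))
    (realOf !![0, -1; 5, 0] (by decide)) κ l φ₂ φ₃ := by
  have h5 := Real.sq_sqrt (by norm_num : (0 : ℝ) ≤ 5)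
  have h5' : ((√5 : ℝ) : ℂ) ^ 2 = 5 := by exact_mod_cast h5
  have hpi : (π : ℂ) ≠ 0 := Complex.ofReal_ne_zero.mpr Real.pi_ne_zero
  have hs0 : Real.sin (π * (1 / 5)) ≠ 0 := fun h ↦ by
    have h1 := sin_sq_pi_div_five
    rw [h] at h1
    nlinarith
  set S : ℂ := Complex.sin (π * (1 / 5)) with hS
  have hS_real : S = (Real.sin (π * (1 / 5)) : ℝ) := by
    rw [hS]
    push_cast
    rfl
  have hS_ne : S ≠ 0 := by
    rw [hS_real]
    exact_mod_cast hs0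
  have hS_sq : S ^ 2 = (5 - (√5 : ℝ)) / 8 := by
    rw [hS_real, ← Complex.ofReal_pow, sin_sq_pi_div_five]
    push_cast
    rfl
  have hS_two : Complex.sin (π * (2 / 5)) = (1 + (√5 : ℝ)) / 2 * S := by
    have h := congrArg ((↑) : ℝ → ℂ) sin_two_pi_div_five
    push_cast at h
    exact h
  -- the fifth power of the golden ratio is `α`
  have hgold : ((1 + ((√5 : ℝ) : ℂ)) / 2) ^ 5 = (11 + 5 * ((√5 : ℝ) : ℂ)) / 2 := by
    linear_combination ((√5 : ℝ) ^ 3 + 5 * (√5 : ℝ) ^ 2 + 15 * (√5 : ℝ) + 35 : ℂ) / 32 * h5'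
  have hw : (1 + ((√5 : ℝ) : ℂ)) ≠ 0 := by
    have : (1 + √5 : ℝ) ≠ 0 := by positivity
    exact_mod_cast this
  have hα : (11 + 5 * ((√5 : ℝ) : ℂ)) ≠ 0 := by
    have : (11 + 5 * √5 : ℝ) ≠ 0 := by positivity
    exact_mod_cast this
  have hαβ : (11 + 5 * ((√5 : ℝ) : ℂ)) * (11 - 5 * ((√5 : ℝ) : ℂ)) = -4 := by
    linear_combination -25 * h5'
  have hq (τ : ℍ) := norm_nome_coe_lt_one τ
  have n1 (τ : ℍ) := fifth_ne_zero one_ne_zero (hq τ)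
  have n2 (τ : ℍ) := fifth_ne_zero two_ne_zero (hq τ)
  have n3 (τ : ℍ) := fifth_ne_zero three_ne_zero (hq τ)
  have n4 (τ : ℍ) := fifth_ne_zero four_ne_zero (hq τ)
  have n5 (τ : ℍ) := fifth_ne_zero (show 5 ≠ 0 by norm_num) (hq τ)
  have n (r : ℕ) (hr : r ≠ 0) (q : ℂ) (hq : q ∈ Metric.ball (0 : ℂ) 1) : fifth r q ≠ 0 :=
    fifth_ne_zero hr (by simpa using hq)
  have d := differentiableOn_fifth
  have lim {r : ℕ} (hr : r ≠ 0) : Tendsto (fun τ : ℍ ↦ fifth r (nome τ)) atImInfty (𝓝 1) :=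
    (tendsto_fifth hr).comp tendsto_nome_atImInfty
  have limP : Tendsto (fun τ : ℍ ↦ ((fifth 1 (nome τ) * fifth 4 (nome τ)) /
      (fifth 2 (nome τ) * fifth 3 (nome τ))) ^ 5) atImInfty (𝓝 1) := by
    have := (((lim one_ne_zero).mul (lim four_ne_zero)).div
      ((lim two_ne_zero).mul (lim three_ne_zero)) (by norm_num)).pow 5
    simpa using this
  have f_T : SlashEq Sporadic.case11.f (intToReal ModularGroup.T) Sporadic.case11.f := by
    rw [slashEq_T_iff]
    intro τ
    rw [f_case11_eq, f_case11_eq, nome_coe_T_smul]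
  have fricke_T (r s : ℂ) :
      SlashEq (frickeTransform r s) (intToReal ModularGroup.T) (frickeTransform r s) := by
    rw [slashEq_T_iff]
    intro τ
    simp only [frickeTransform, coe_T_smul, oddTheta_add_one_left]
  have fricke_lim (r s : ℂ) (hs : Complex.sin (π * (s / 5)) ≠ 0) :
      Tendsto (frickeTransform r s) atImInfty (𝓝 (-(Complex.I * (√5 : ℝ) / (10 * π)) *
        (Complex.sin (π * (r / 5)) / π) ^ 2 / (Complex.sin (π * (s / 5)) / π) ^ 3)) :=
    (((tendsto_oddTheta (r / 5)).pow 2).const_mul _).div ((tendsto_oddTheta (s / 5)).pow 3)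
      (pow_ne_zero _ (div_ne_zero hs hpi))
  have hS2_ne : Complex.sin (π * (2 / 5)) ≠ 0 := by
    rw [hS_two]
    exact mul_ne_zero (div_ne_zero hw two_ne_zero) hS_ne
  refine ⟨-1, _, _, _,
    { α_ne := ?_, β_ne := ?_, f_s₂ := slashEq_frickeTransform f_case11_eq_klein,
      tf_s₂ := slashEq_frickeTransform tf_case11_eq_klein, f_s₁ := slashEq_f_case11,
      t_holo := ?_, f_holo := ?_, t_ne := ?_, f_ne := ?_, f_T := f_T, tf_T := ?_,
      φ₂_T := fricke_T _ _, φ₃_T := fricke_T _ _, t_lim := ?_, t_bound := ?_, f_lim := ?_,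
      φ₂_lim := fricke_lim _ _ hS_ne, φ₃_lim := ?_, κ_sq := ?_, l_sq := ?_ }⟩
  · exact div_ne_zero hα two_ne_zero
  · refine div_ne_zero (fun h ↦ ?_) two_ne_zero
    rw [h, mul_zero] at hαβ
    norm_num at hαβ
  · simp only [funext t_case11_eq]
    refine mdifferentiable_comp_nome (g := fun q ↦ q * ((fifth 1 q * fifth 4 q) /
      (fifth 2 q * fifth 3 q)) ^ 5) (differentiableOn_id.mul ((((d 1).mul (d 4)).div
      ((d 2).mul (d 3)) fun q hq ↦ ?_).pow 5))
    exact mul_ne_zero (n 2 two_ne_zero q hq) (n 3 three_ne_zero q hq)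
  · simp only [funext f_case11_eq]
    refine mdifferentiable_comp_nome (g := fun q ↦ fifth 5 q ^ 2 * (fifth 2 q * fifth 3 q) ^ 2 /
      (fifth 1 q * fifth 4 q) ^ 3) ((((d 5).pow 2).mul (((d 2).mul (d 3)).pow 2)).div
      (((d 1).mul (d 4)).pow 3) fun q hq ↦ ?_)
    exact pow_ne_zero _ (mul_ne_zero (n 1 one_ne_zero q hq) (n 4 four_ne_zero q hq))
  · intro τ
    rw [t_case11_eq]
    exact mul_ne_zero (nome_ne_zero _) (pow_ne_zero _ (div_ne_zero (mul_ne_zero (n1 τ) (n4 τ))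
      (mul_ne_zero (n2 τ) (n3 τ))))
  · intro τ
    rw [f_case11_eq]
    exact div_ne_zero (mul_ne_zero (pow_ne_zero _ (n5 τ)) (pow_ne_zero _ (mul_ne_zero (n2 τ)
      (n3 τ)))) (pow_ne_zero _ (mul_ne_zero (n1 τ) (n4 τ)))
  · rw [slashEq_T_iff]
    intro τ
    rw [Pi.mul_apply, Pi.mul_apply, f_case11_eq, f_case11_eq, t_case11_eq, t_case11_eq,
      nome_coe_T_smul]
  · simp only [funext t_case11_eq]
    simpa using tendsto_nome_atImInfty.mul limP
  · refine .of_bound 2 ?_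
    filter_upwards [limP.norm.eventually_const_lt (show (1 / 2 : ℝ) < ‖(1 : ℂ)‖ by norm_num)]
      with τ hτ
    rw [t_case11_eq, norm_mul, norm_nome, Real.norm_of_nonneg (Real.exp_pos _).le, coe_im]
    nlinarith [Real.exp_pos (-2 * π * τ.im)]
  · simp only [funext f_case11_eq]
    have : Tendsto (fun τ : ℍ ↦ fifth 5 (nome τ) ^ 2 * (fifth 2 (nome τ) * fifth 3 (nome τ)) ^ 2 /
        (fifth 1 (nome τ) * fifth 4 (nome τ)) ^ 3) atImInfty
        (𝓝 (1 ^ 2 * (1 * 1) ^ 2 / (1 * 1) ^ 3)) := (((lim (show 5 ≠ 0 by norm_num)).pow 2).mul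
      (((lim two_ne_zero).mul (lim three_ne_zero)).pow 2)).div
      (((lim one_ne_zero).mul (lim four_ne_zero)).pow 3) (by norm_num)
    simpa using this
  · convert fricke_lim 1 2 hS2_ne using 2
    rw [hS_two, ← hS, Sporadic.α]
    rw [← hgold]
    field_simp
  · simp only [Sporadic.α, Sporadic.β]
    linear_combination 1 / 4 * hαβ
  · simp only [Sporadic.α, Sporadic.β]
    rw [hS_two, ← hS]
    have hd : 5 - ((√5 : ℝ) : ℂ) ≠ 0 := fun h ↦ by
      rw [h, zero_div] at hS_sq
      exact hS_ne (pow_eq_zero_iff two_ne_zero |>.mp hS_sq)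
    have e : (-(Complex.I * (√5 : ℝ) / (10 * π)) * ((1 + (√5 : ℝ)) / 2 * S / π) ^ 2 /
        (S / π) ^ 3) ^ 2 = Complex.I ^ 2 * ((√5 : ℝ) ^ 2 * ((1 + (√5 : ℝ)) / 2) ^ 4 /
          (100 * S ^ 2)) := by
      field_simp
      ring
    rw [e, hS_sq, Complex.I_sq, ← hgold, h5']
    field_simp
    linear_combination
      (40 * ((√5 : ℝ) ^ 3 + 5 * (√5 : ℝ) ^ 2 + 15 * (√5 : ℝ) + 35 : ℂ) + 1600) * h5'

end Bimodular

/-! ### The six sporadic cases -/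

theorem mainTheorem3 (s : Bimodular.Sporadic) :
    -- `α` and `β` are the tabulated numbers with `1 - a X + c X² = (1 - α X)(1 - β X)`
    (∀ X : ℂ, 1 - s.a * X + s.c * X ^ 2 = (1 - s.α * X) * (1 - s.β * X)) ∧
    -- `σ₁` is realized by the tabulated elements of the normalizer
    ((Bimodular.represented s.σ₁).Nonempty ∧
      ∀ g ∈ Bimodular.represented s.σ₁, g ∈ Bimodular.realNormalizer s.Γ ∧
        ∀ τ : UpperHalfPlane, s.c * s.t τ ≠ 0 ∧ s.t (g • τ) = 1 / (s.c * s.t τ)) ∧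
    -- `σ₂` is realized by the tabulated elements of the normalizer
    ((Bimodular.represented s.σ₂).Nonempty ∧
      ∀ g ∈ Bimodular.represented s.σ₂, g ∈ Bimodular.realNormalizer s.Γ ∧
        ∀ τ : UpperHalfPlane, s.α * (1 - s.β * s.t τ) ≠ 0 ∧
          s.t (g • τ) = (1 - s.α * s.t τ) / (s.α * (1 - s.β * s.t τ))) ∧
    -- `x` and `y` are bimodular functions
    Bimodular.IsBimodularFunction s.Γ s.G s.x ∧
    Bimodular.IsBimodularFunction s.Γ s.G s.y ∧
    -- `F` is a bimodular form of weight one with the tabulated characters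
    ∃ (χ₁ : s.Γ →* ℂˣ) (χ₂ : s.G →* ℂˣ),
      (∀ γ : s.Γ, (χ₁ γ : ℂ) = (s.chi₁Value γ : ℂ)) ∧
      (∀ p ∈ s.chi₂Table, (Bimodular.represented p.1).Nonempty ∧
        ∀ g ∈ Bimodular.represented p.1, ∃ hg : g ∈ s.G, χ₂ ⟨g, hg⟩ = p.2) ∧
      Bimodular.IsBimodularForm 1 s.Γ s.G χ₁ χ₂ s.F := by
  have r3 : ((√3 : ℝ) : ℂ) ^ 2 = 3 := by exact_mod_cast Real.sq_sqrt (by norm_num : (0 : ℝ) ≤ 3)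
  have r5 : ((√5 : ℝ) : ℂ) ^ 2 = 5 := by exact_mod_cast Real.sq_sqrt (by norm_num : (0 : ℝ) ≤ 5)
  have i3 : Bimodular.Sporadic.sqrtNegThree ^ 2 = -3 := by
    rw [Bimodular.Sporadic.sqrtNegThree, mul_pow, Complex.I_sq, r3]
    ring
  have ha : s.a = s.α + s.β := by
    cases s <;>
      simp only [Bimodular.Sporadic.a, Bimodular.Sporadic.abc, Bimodular.Sporadic.α,
        Bimodular.Sporadic.β] <;>
      push_cast <;> ring
  have hc : s.c = s.α * s.β := by
    cases s <;>
      simp only [Bimodular.Sporadic.c, Bimodular.Sporadic.abc, Bimodular.Sporadic.α,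
        Bimodular.Sporadic.β] <;>
      push_cast
    case caseNeg9 => linear_combination 9 / 4 * i3
    case case11 => linear_combination 25 / 4 * r5
    all_goals ring
  cases s with
  | case7 =>
    obtain ⟨_, _, _, _, D⟩ := Bimodular.formData_case7
    exact Bimodular.statement_of_data Bimodular.cuspData_case7 D Bimodular.groupData_case7 ha hc
  | case10 =>
    obtain ⟨_, _, _, _, D⟩ := Bimodular.formData_case10
    exact Bimodular.statement_of_data Bimodular.cuspData_case10 D Bimodular.groupData_case10 ha hc
  | caseNeg17 =>
    obtain ⟨_, _, _, _, D⟩ := Bimodular.formData_caseNeg17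
    exact Bimodular.statement_of_data Bimodular.cuspData_caseNeg17 D
      Bimodular.groupData_caseNeg17 ha hc
  | case12 =>
    obtain ⟨_, _, _, _, D⟩ := Bimodular.formData_case12
    exact Bimodular.statement_of_data Bimodular.cuspData_case12 D Bimodular.groupData_case12 ha hc
  | caseNeg9 =>
    obtain ⟨_, _, _, _, D⟩ := Bimodular.formData_caseNeg9
    exact Bimodular.statement_of_data Bimodular.cuspData_caseNeg9 D
      Bimodular.groupData_caseNeg9 ha hc
  | case11 =>
    obtain ⟨_, _, _, _, D⟩ := Bimodular.formData_case11
    exact Bimodular.statement_of_data Bimodular.cuspData_case11 D Bimodular.groupData_case11 ha hc
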